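/- **Setting.** Let $\mathfrak h$ be a finite-dimensional complex vector space, $W\subseteq \mathrm{GL}(\mathfrak h)$ a finite group, and $R=\{r\in W: \operatorname{codim}\operatorname{fix}_{\mathfrak h}(r)=1\}$ its set of reflections. For each $r\in R$ fix $\alpha_r\in\mathfrak h^*$ with zero set $\operatorname{fix}_{\mathfrak h}(r)$ and $c_r\in\mathbf C$ such that $c_{wrw^{-1}}=c_r$ and $c_{r^{-1}}=\overline{c_r}$ for $r\in R$, $w\in W$. For $y\in\mathfrak h$ let $$D_y(f)=\partial_y(f)-\sum_{r\in R}c_r\langle\alpha_r,y\rangle\frac{f-r(f)}{\alpha_r}$$ be the Dunkl operator on the ring $\mathbf C[\mathfrak h]$ of polynomial functions, and let $H_c\subseteq\mathrm{End}_{\mathbf C}(\mathbf C[\mathfrak h])$ be the rational Cherednik algebra, i.e. the subalgebra generated by $W$, by multiplication by elements of $\mathbf C[\mathfrak h]$, and by the Dunkl operators. An element $y\in\mathfrak h$ acts on an $H_c$-module as $D_y$. The Euler field $\mathrm{eu}=\sum_i x_i\,\partial/\partial x_i$ belongs to $H_c$; for an $H_c$-module $M$ and $d\in\mathbf C$ let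 $M_d$ be the generalized eigenspace of $\mathrm{eu}$ with eigenvalue $d$. Let $\mathcal O_c$ be the (abelian) full subcategory of $H_c$-modules consisting of the finitely generated modules on which each Dunkl operator acts locally nilpotently. Fix a conjugate-linear $W$-equivariant isomorphism $\mathfrak h\to\mathfrak h^*$, $v\mapsto\overline v$, which is Hermitian: $\langle\overline u,v\rangle=\overline{\langle\overline v,u\rangle}$ for all $u,v\in\mathfrak h$. For an $H_c$-module $M$, let $F(M)=M\otimes_{\mathbf C[\mathfrak h]}\mathbf C=M/\mathfrak h^*M$ and $G(M)=H^0(\mathfrak h,M)=\{m\in M: ym=0\text{ for all }y\in\mathfrak h\}$. These are additive functors from $\mathcal O_c$ to the abelian category $\mathrm{Gr}$ of $\mathbf C$-graded $\mathbf CW$-modules, the degree $d$ part of $F(M)$ being the image of $M_d$, and that of $G(M)$ being $G(M)\cap M_d$. On $\mathrm{Gr}$ there is the exact duality $(N^\vee)_d=(N_d)^\vee$, where for a $\mathbf CW$-module $E$ one writes $E^\vee$ for its space of conjugate-linear forms, with $(w\phi)(e)=\phi(w^{-1}e)$. **Theorem.** 1. There is a conjugate-linear anti-automorphism $h\mapsto\overline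 h$ of $H_c$ with $\overline w=w^{-1}$ for $w\in W$, and which exchanges the Dunkl operator $D_v$ with (multiplication by) the linear form $\overline v$, for all $v\in\mathfrak h$. 2. For $M$ in $\mathcal O_c$ let $M^\vee=\bigoplus_d (M_d)^\vee$ be the restricted dual, that is, the space of conjugate-linear forms on $M$ which are non-zero on only finitely many $M_d$, with $H_c$ acting by $(h\phi)(m)=\phi(\overline h\,m)$. Then $M^\vee$ is in $\mathcal O_c$, and $M\mapsto M^\vee$ is an exact contravariant functor from $\mathcal O_c$ to itself. 3. $\mathcal O_c$ has enough projectives and enough injectives; hence the derived functors $LF:D^-(\mathcal O_c)\to D^-(\mathrm{Gr})$ and $RG:D^+(\mathcal O_c)\to D^+(\mathrm{Gr})$ exist. 4. There is an isomorphism $$LF(M)^\vee\cong RG(M^\vee)$$ of contravariant functors of $M\in\mathcal O_c$ with values in $D^+(\mathrm{Gr})$; more generally, there is such an isomorphism of contravariant functors of $M\in D^-(\mathcal O_c)$, where $\vee$ denotes the functors $D^-\to D^+$ induced by the exact dualities on $\mathcal O_c$ and on $\mathrm{Gr}$. -/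

import Mathlib

open CategoryTheory Limits
open scoped ComplexConjugate

universe u

noncomputable section

namespace Cherednik

section Polynomials

variable (V : Type u) [AddCommGroup V] [Module ℂ V]

/-- The algebra of polynomial functions on `V`: the functions generated by linear forms. -/
def polFun : Subalgebra ℂ (V → ℂ) :=
  Algebra.adjoin ℂ (Set.range fun l : Module.Dual ℂ V => (l : V → ℂ))

/-- The ring `ℂ[V]` of polynomial functions on `V`. -/
def Pol : Type u := polFun V

instance : CommRing (Pol V) := inferInstanceAs (CommRing (polFun V))

instance : Algebra ℂ (Pol V) := inferInstanceAs (Algebra ℂ (polFun V))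

instance : FunLike (Pol V) V ℂ where
  coe f := f.1
  coe_injective _ _ h := Subtype.ext h

variable {V}

/-- A linear form, as a polynomial function. -/
def linPoly (l : Module.Dual ℂ V) : Pol V :=
  ⟨l, Algebra.subset_adjoin ⟨l, rfl⟩⟩

@[simp] lemma linPoly_coe (l : Module.Dual ℂ V) : (linPoly l : V → ℂ) = l := rfl

lemma Pol.ext {f g : Pol V} (h : (f : V → ℂ) = g) : f = g := DFunLike.coe_injective h

@[simp] lemma pol_add (f g : Pol V) (x : V) : (f + g) x = f x + g x := rfl

@[simp] lemma pol_mul (f g : Pol V) (x : V) : (f * g) x = f x * g x := rfl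

@[simp] lemma pol_smul (a : ℂ) (f : Pol V) (x : V) : (a • f) x = a * f x := rfl

@[simp] lemma pol_sum {ι : Type*} (s : Finset ι) (f : ι → Pol V) (x : V) :
    (∑ i ∈ s, f i) x = ∑ i ∈ s, f i x := by
  classical
  induction s using Finset.induction_on with
  | empty => rfl
  | insert i s hi ih => rw [Finset.sum_insert hi, Finset.sum_insert hi, pol_add, ih]

lemma Pol.ind {p : Pol V → Prop} (hlin : ∀ l, p (linPoly l))
    (hconst : ∀ a : ℂ, p (algebraMap ℂ (Pol V) a))
    (hadd : ∀ f g, p f → p g → p (f + g)) (hmul : ∀ f g, p f → p g → p (f * g))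
    (f : Pol V) : p f := by
  obtain ⟨f, hf⟩ := f
  induction hf using Algebra.adjoin_induction with
  | mem x hx => obtain ⟨l, rfl⟩ := hx; exact hlin l
  | algebraMap r => exact hconst r
  | add x y hx hy h1 h2 => exact hadd ⟨x, hx⟩ ⟨y, hy⟩ h1 h2
  | mul x y hx hy h1 h2 => exact hmul ⟨x, hx⟩ ⟨y, hy⟩ h1 h2

/-- A polynomial function is differentiable, with linear differential, along all lines. -/
lemma exists_hasLineDerivAt (f : Pol V) (x : V) :
    ∃ L : Module.Dual ℂ V, ∀ v, HasLineDerivAt ℂ (f : V → ℂ) (L v) x v := by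
  induction f using Pol.ind with
  | hlin l =>
    refine ⟨l, fun v => ?_⟩
    simp only [HasLineDerivAt, linPoly_coe, map_add, map_smul, smul_eq_mul]
    simpa using ((hasDerivAt_id (0 : ℂ)).mul_const (l v)).const_add (l x)
  | hconst a => exact ⟨0, fun v => hasDerivAt_const _ _⟩
  | hadd f g hf hg =>
    obtain ⟨L, hL⟩ := hf
    obtain ⟨K, hK⟩ := hg
    exact ⟨L + K, fun v => HasDerivAt.add (hL v) (hK v)⟩
  | hmul f g hf hg =>
    obtain ⟨L, hL⟩ := hf
    obtain ⟨K, hK⟩ := hg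
    refine ⟨(g : V → ℂ) x • L + (f : V → ℂ) x • K, fun v => ?_⟩
    have := HasDerivAt.mul (hL v) (hK v)
    simp only [zero_smul, add_zero] at this
    have e : ((g : V → ℂ) x • L + (f : V → ℂ) x • K) v =
        L v * (g : V → ℂ) x + (f : V → ℂ) x * K v := by
      simp [mul_comm]
    rw [e]
    exact this

lemma lineDeriv_linPoly (l : Module.Dual ℂ V) (x v : V) :
    lineDeriv ℂ (linPoly l : V → ℂ) x v = l v := by
  apply HasLineDerivAt.lineDeriv
  simp only [HasLineDerivAt, linPoly_coe, map_add, map_smul, smul_eq_mul]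
  simpa using ((hasDerivAt_id (0 : ℂ)).mul_const (l v)).const_add (l x)

lemma lineDeriv_algebraMap (a : ℂ) (x v : V) :
    lineDeriv ℂ (algebraMap ℂ (Pol V) a : V → ℂ) x v = 0 :=
  HasLineDerivAt.lineDeriv (hasDerivAt_const _ _)

lemma lineDeriv_polyAdd (f g : Pol V) (x v : V) :
    lineDeriv ℂ ((f + g : Pol V) : V → ℂ) x v =
      lineDeriv ℂ (f : V → ℂ) x v + lineDeriv ℂ (g : V → ℂ) x v := by
  obtain ⟨L, hL⟩ := exists_hasLineDerivAt f x
  obtain ⟨K, hK⟩ := exists_hasLineDerivAt g x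
  rw [(hL v).lineDeriv, (hK v).lineDeriv]
  exact HasLineDerivAt.lineDeriv (HasDerivAt.add (hL v) (hK v))

lemma lineDeriv_polyMul (f g : Pol V) (x v : V) :
    lineDeriv ℂ ((f * g : Pol V) : V → ℂ) x v =
      lineDeriv ℂ (f : V → ℂ) x v * (g : V → ℂ) x + (f : V → ℂ) x * lineDeriv ℂ (g : V → ℂ) x v := by
  obtain ⟨L, hL⟩ := exists_hasLineDerivAt f x
  obtain ⟨K, hK⟩ := exists_hasLineDerivAt g x
  rw [(hL v).lineDeriv, (hK v).lineDeriv]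
  have := HasDerivAt.mul (hL v) (hK v)
  simp only [zero_smul, add_zero] at this
  exact HasLineDerivAt.lineDeriv this

lemma lineDeriv_polySum_dir {ι : Type*} (s : Finset ι) (a : ι → ℂ) (b : ι → V) (f : Pol V) (x : V) :
    lineDeriv ℂ (f : V → ℂ) x (∑ i ∈ s, a i • b i) =
      ∑ i ∈ s, a i * lineDeriv ℂ (f : V → ℂ) x (b i) := by
  obtain ⟨L, hL⟩ := exists_hasLineDerivAt f x
  simp [(hL _).lineDeriv, map_sum]

/-- A vector field with linear coefficients differentiates polynomials to polynomials. -/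
lemma lineDeriv_poly_mem (A : V →ₗ[ℂ] V) (b : V) (f : Pol V) :
    (fun x => lineDeriv ℂ (f : V → ℂ) x (A x + b)) ∈ polFun V := by
  induction f using Pol.ind with
  | hlin l =>
    have : (fun x => lineDeriv ℂ (linPoly l : V → ℂ) x (A x + b)) =
        (linPoly (l ∘ₗ A) + algebraMap ℂ (Pol V) (l b) : Pol V) := by
      funext x
      rw [lineDeriv_linPoly, map_add]
      rfl
    rw [this]
    exact Subtype.property _
  | hconst a =>
    have : (fun x => lineDeriv ℂ (algebraMap ℂ (Pol V) a : V → ℂ) x (A x + b)) = 0 := by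
      funext x
      exact lineDeriv_algebraMap a x _
    rw [this]
    exact zero_mem _
  | hadd f g hf hg =>
    convert! add_mem hf hg using 1
    funext x
    exact lineDeriv_polyAdd f g x _
  | hmul f g hf hg =>
    convert! add_mem (mul_mem hf g.2) (mul_mem f.2 hg) using 1
    funext x
    exact lineDeriv_polyMul f g x _

/-- The operator on polynomials given by a vector field `x ↦ A x + b`. -/
def vectorField (A : V →ₗ[ℂ] V) (b : V) : Module.End ℂ (Pol V) where
  toFun f := ⟨fun x => lineDeriv ℂ (f : V → ℂ) x (A x + b), lineDeriv_poly_mem A b f⟩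
  map_add' f g := Pol.ext <| funext fun x => lineDeriv_polyAdd f g x _
  map_smul' a f := by
    apply Pol.ext
    funext x
    have := lineDeriv_polyMul (algebraMap ℂ (Pol V) a) f x (A x + b)
    rw [← Algebra.smul_def, lineDeriv_algebraMap, zero_mul, zero_add] at this
    exact this

lemma vectorField_mul (A : V →ₗ[ℂ] V) (b : V) (f g : Pol V) :
    vectorField A b (f * g) = vectorField A b f * g + f * vectorField A b g :=
  Pol.ext <| funext fun x => lineDeriv_polyMul f g x _

lemma vectorField_linPoly (A : V →ₗ[ℂ] V) (b : V) (l : Module.Dual ℂ V) :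
    vectorField A b (linPoly l) = linPoly (l ∘ₗ A) + algebraMap ℂ _ (l b) := by
  apply Pol.ext
  funext x
  change lineDeriv ℂ (linPoly l : V → ℂ) x (A x + b) = _
  rw [lineDeriv_linPoly, map_add]
  rfl

lemma vectorField_algebraMap (A : V →ₗ[ℂ] V) (b : V) (a : ℂ) :
    vectorField A b (algebraMap ℂ (Pol V) a) = 0 :=
  Pol.ext <| funext fun x => lineDeriv_algebraMap a x _

/-- The directional derivative `∂_v` on polynomial functions. -/
def partialDeriv (v : V) : Module.End ℂ (Pol V) := vectorField 0 v

lemma partialDeriv_apply (v : V) (f : Pol V) (x : V) :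
    (partialDeriv v f : V → ℂ) x = lineDeriv ℂ (f : V → ℂ) x v := by
  change lineDeriv ℂ (f : V → ℂ) x (0 + v) = _
  rw [zero_add]

/-- The Euler field `∑ xᵢ ∂/∂xᵢ`, i.e. the derivative at `x` in the direction `x`. -/
def eulerField : Module.End ℂ (Pol V) := vectorField LinearMap.id 0

lemma eulerField_apply (f : Pol V) (x : V) :
    (eulerField f : V → ℂ) x = lineDeriv ℂ (f : V → ℂ) x x := by
  change lineDeriv ℂ (f : V → ℂ) x (x + 0) = _
  rw [add_zero]

/-- The action of a linear automorphism on polynomial functions: `(w f)(x) = f (w⁻¹ x)`. -/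
def polyAction : (V ≃ₗ[ℂ] V) →* Module.End ℂ (Pol V) where
  toFun w :=
    { toFun f := ⟨fun x => (f : V → ℂ) (w⁻¹ x), by
        induction f using Pol.ind with
        | hlin l => exact (linPoly (l ∘ₗ (w⁻¹ : V ≃ₗ[ℂ] V).toLinearMap)).2
        | hconst a => exact (algebraMap ℂ (Pol V) a).2
        | hadd f g hf hg => exact add_mem hf hg
        | hmul f g hf hg => exact mul_mem hf hg⟩
      map_add' f g := rfl
      map_smul' a f := rfl }
  map_one' := by ext; rfl
  map_mul' w w' := by
    apply LinearMap.ext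
    intro f
    apply Pol.ext
    funext x
    change (f : V → ℂ) ((w * w')⁻¹ x) = (f : V → ℂ) (w'⁻¹ (w⁻¹ x))
    rw [mul_inv_rev]
    rfl

lemma polyAction_apply (w : V ≃ₗ[ℂ] V) (f : Pol V) (x : V) :
    (polyAction w f : V → ℂ) x = (f : V → ℂ) (w⁻¹ x) := rfl

lemma polyAction_mul_apply (w : V ≃ₗ[ℂ] V) (f g : Pol V) :
    polyAction w (f * g) = polyAction w f * polyAction w g := rfl

lemma polyAction_linPoly (w : V ≃ₗ[ℂ] V) (l : Module.Dual ℂ V) :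
    polyAction w (linPoly l) = linPoly (l ∘ₗ (w⁻¹ : V ≃ₗ[ℂ] V).toLinearMap) := rfl

lemma polyAction_algebraMap (w : V ≃ₗ[ℂ] V) (a : ℂ) :
    polyAction w (algebraMap ℂ (Pol V) a) = algebraMap ℂ (Pol V) a := rfl

/-- Nonzero linear forms are not zero divisors. -/
lemma linPoly_mul_cancel {l : Module.Dual ℂ V} (hl : l ≠ 0) {f g : Pol V}
    (h : linPoly l * f = linPoly l * g) : f = g := by
  have key : ∀ x, l x ≠ 0 → (f : V → ℂ) x = (g : V → ℂ) x := fun x hx =>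
    mul_left_cancel₀ hx (congrFun (congrArg Subtype.val h) x)
  apply Pol.ext
  funext x
  by_cases hx : l x = 0
  · obtain ⟨u, hu⟩ : ∃ u, l u ≠ 0 := by
      by_contra! h0
      exact hl (LinearMap.ext h0)
    have hcont : ∀ q : Pol V, ContinuousAt (fun t : ℂ => (q : V → ℂ) (x + t • u)) 0 := fun q => by
      obtain ⟨L, hL⟩ := exists_hasLineDerivAt q x
      exact HasDerivAt.continuousAt (hL u)
    have h1 : Filter.Tendsto (fun t : ℂ => (f : V → ℂ) (x + t • u)) (nhdsWithin 0 {0}ᶜ)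
        (nhds ((f : V → ℂ) x)) := by
      simpa using (hcont f).tendsto.mono_left nhdsWithin_le_nhds
    have h2 : Filter.Tendsto (fun t : ℂ => (g : V → ℂ) (x + t • u)) (nhdsWithin 0 {0}ᶜ)
        (nhds ((g : V → ℂ) x)) := by
      simpa using (hcont g).tendsto.mono_left nhdsWithin_le_nhds
    refine tendsto_nhds_unique (h1.congr' ?_) h2
    filter_upwards [self_mem_nhdsWithin] with t ht
    apply key
    simpa [hx] using ⟨ht, hu⟩
  · exact key x hx

open Classical in
/-- The quotient `g / l` of a polynomial by a linear form (zero if `l` does not divide `g`). -/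
def divLin (l : Module.Dual ℂ V) (g : Pol V) : Pol V :=
  if h : ∃ q, linPoly l * q = g then h.choose else 0

lemma divLin_eq {l : Module.Dual ℂ V} (hl : l ≠ 0) {g q : Pol V} (h : linPoly l * q = g) :
    divLin l g = q := by
  have hex : ∃ q, linPoly l * q = g := ⟨q, h⟩
  rw [divLin, dif_pos hex]
  exact linPoly_mul_cancel hl (hex.choose_spec.trans h.symm)

lemma exists_smul_eq (l m : Module.Dual ℂ V) (h : ∀ x, l x = 0 → m x = 0) :
    ∃ a : ℂ, a • l = m := by
  by_cases hl : ∃ u, l u ≠ 0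
  · obtain ⟨u, hu⟩ := hl
    refine ⟨m u / l u, LinearMap.ext fun x => ?_⟩
    have := h (x - (l x / l u) • u) (by simp [hu])
    rw [map_sub, map_smul, sub_eq_zero, smul_eq_mul] at this
    rw [LinearMap.smul_apply, smul_eq_mul, this]
    ring
  · push Not at hl
    exact ⟨0, LinearMap.ext fun x => by simp [h x (hl x)]⟩

/-- If `r` fixes the hyperplane `l = 0` pointwise, then `k - r k` is a multiple of `l`. -/
lemma exists_coeff (l k : Module.Dual ℂ V) (r : V ≃ₗ[ℂ] V) (hr : ∀ x, l x = 0 → r x = x) :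
    ∃ a : ℂ, a • l = k - k ∘ₗ (r⁻¹ : V ≃ₗ[ℂ] V).toLinearMap := by
  refine exists_smul_eq _ _ fun x hx => ?_
  have h1 : (r⁻¹ : V ≃ₗ[ℂ] V) x = x := by
    conv_lhs => rw [← hr x hx]
    exact r.symm_apply_apply x
  change k x - k ((r⁻¹ : V ≃ₗ[ℂ] V) x) = 0
  rw [h1, sub_self]

/-- If `r` fixes the hyperplane `l = 0` pointwise, then `l` divides `f - r f`. -/
lemma exists_div (l : Module.Dual ℂ V) (r : V ≃ₗ[ℂ] V) (hr : ∀ x, l x = 0 → r x = x)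
    (f : Pol V) : ∃ q, linPoly l * q = f - polyAction r f := by
  induction f using Pol.ind with
  | hlin k =>
    obtain ⟨a, ha⟩ := exists_coeff l k r hr
    refine ⟨algebraMap ℂ _ a, ?_⟩
    rw [polyAction_linPoly, mul_comm, ← Algebra.smul_def]
    apply Pol.ext
    funext x
    exact LinearMap.congr_fun ha x
  | hconst a => exact ⟨0, by rw [polyAction_algebraMap, sub_self, mul_zero]⟩
  | hadd f g hf hg =>
    obtain ⟨p, hp⟩ := hf
    obtain ⟨q, hq⟩ := hg
    refine ⟨p + q, ?_⟩
    rw [mul_add, hp, hq, map_add]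
    ring
  | hmul f g hf hg =>
    obtain ⟨p, hp⟩ := hf
    obtain ⟨q, hq⟩ := hg
    refine ⟨p * g + polyAction r f * q, ?_⟩
    rw [polyAction_mul_apply]
    linear_combination g * hp + polyAction r f * hq


lemma lineDeriv_polyAction (w : V ≃ₗ[ℂ] V) (f : Pol V) (x v : V) :
    lineDeriv ℂ (polyAction w f : V → ℂ) x v = lineDeriv ℂ (f : V → ℂ) (w⁻¹ x) (w⁻¹ v) := by
  simp only [lineDeriv, polyAction_apply, map_add, map_smul]

lemma partialDeriv_polyAction (w : V ≃ₗ[ℂ] V) (v : V) (f : Pol V) :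
    partialDeriv v (polyAction w f) = polyAction w (partialDeriv (w⁻¹ v) f) := by
  apply Pol.ext
  funext x
  rw [partialDeriv_apply, lineDeriv_polyAction, polyAction_apply, partialDeriv_apply]

lemma eulerField_polyAction (w : V ≃ₗ[ℂ] V) (f : Pol V) :
    eulerField (polyAction w f) = polyAction w (eulerField f) := by
  apply Pol.ext
  funext x
  rw [eulerField_apply, lineDeriv_polyAction, polyAction_apply, eulerField_apply]

lemma partialDeriv_mul (v : V) (f g : Pol V) :
    partialDeriv v (f * g) = partialDeriv v f * g + f * partialDeriv v g :=
  vectorField_mul _ _ f g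

lemma eulerField_mul (f g : Pol V) :
    eulerField (f * g) = eulerField f * g + f * eulerField g :=
  vectorField_mul _ _ f g

lemma partialDeriv_linPoly (v : V) (l : Module.Dual ℂ V) :
    partialDeriv v (linPoly l) = algebraMap ℂ (Pol V) (l v) := by
  rw [partialDeriv, vectorField_linPoly, LinearMap.comp_zero]
  exact zero_add _

lemma eulerField_linPoly (l : Module.Dual ℂ V) : eulerField (linPoly l) = linPoly l := by
  rw [eulerField, vectorField_linPoly, map_zero, map_zero, add_zero, LinearMap.comp_id]

lemma partialDeriv_algebraMap (v : V) (a : ℂ) : partialDeriv v (algebraMap ℂ (Pol V) a) = 0 :=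
  vectorField_algebraMap _ _ a

lemma eulerField_algebraMap (a : ℂ) : eulerField (algebraMap ℂ (Pol V) a) = 0 :=
  vectorField_algebraMap _ _ a

lemma eulerField_partialDeriv (v : V) (f : Pol V) :
    eulerField (partialDeriv v f) + partialDeriv v f = partialDeriv v (eulerField f) := by
  induction f using Pol.ind with
  | hlin l =>
    rw [partialDeriv_linPoly, eulerField_algebraMap, eulerField_linPoly, partialDeriv_linPoly,
      zero_add]
  | hconst a => simp [partialDeriv_algebraMap, eulerField_algebraMap]
  | hadd f g hf hg =>
    simp only [map_add]
    linear_combination hf + hg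
  | hmul f g hf hg =>
    simp only [partialDeriv_mul, eulerField_mul, map_add]
    linear_combination g * hf + f * hg

lemma partialDeriv_sum_smul {ι : Type*} (s : Finset ι) (a : ι → ℂ) (b : ι → V) (f : Pol V) :
    partialDeriv (∑ i ∈ s, a i • b i) f = ∑ i ∈ s, a i • partialDeriv (b i) f := by
  apply Pol.ext
  funext x
  rw [partialDeriv_apply, lineDeriv_polySum_dir]
  simp [partialDeriv_apply]

lemma partialDeriv_add (v w : V) (f : Pol V) :
    partialDeriv (v + w) f = partialDeriv v f + partialDeriv w f := by
  have := partialDeriv_sum_smul Finset.univ (fun _ : Fin 2 => (1 : ℂ)) ![v, w] f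
  simpa using this

lemma partialDeriv_smul (a : ℂ) (v : V) (f : Pol V) :
    partialDeriv (a • v) f = a • partialDeriv v f := by
  have := partialDeriv_sum_smul Finset.univ (fun _ : Fin 1 => a) ![v] f
  simpa using this

end Polynomials

/-- The space of vectors fixed by `w`. -/
def fixedSpace {V : Type u} [AddCommGroup V] [Module ℂ V] (w : V ≃ₗ[ℂ] V) : Submodule ℂ V :=
  LinearMap.eqLocus w.toLinearMap LinearMap.id

/-- `w` is a reflection: its fixed space has codimension one. -/
def IsReflection {V : Type u} [AddCommGroup V] [Module ℂ V] (w : V ≃ₗ[ℂ] V) : Prop :=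
  Module.finrank ℂ (fixedSpace w) + 1 = Module.finrank ℂ V

/-- The data defining a rational Cherednik algebra: a finite linear group `W ⊆ GL(V)`, linear forms
`α r` defining the reflection hyperplanes and deformation parameters `c r`, for the reflections `r`
in `W` (the values of `α` and `c` at other elements of `W` are never used). -/
structure Datum (V : Type u) [AddCommGroup V] [Module ℂ V] where
  /-- the finite linear group -/
  W : Subgroup (V ≃ₗ[ℂ] V)
  finite_W : Finite W
  /-- the linear forms whose zero sets are the reflection hyperplanes -/
  α : W → Module.Dual ℂ V
  ker_α : ∀ r : W, IsReflection r.1 → LinearMap.ker (α r) = fixedSpace r.1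
  /-- the deformation parameters -/
  c : W → ℂ
  c_conj : ∀ r w : W, IsReflection r.1 → c (w * r * w⁻¹) = c r
  c_inv : ∀ r : W, IsReflection r.1 → c r⁻¹ = conj (c r)

namespace Datum

variable {V : Type u} [AddCommGroup V] [Module ℂ V] (D : Datum V)

/-- The reflections in `W`. -/
abbrev R : Type u := {r : D.W // IsReflection r.1}

noncomputable instance : Fintype D.W := @Fintype.ofFinite _ D.finite_W

open Classical in
noncomputable instance : Fintype D.R := Fintype.ofFinite _

variable {D}

/-- The action on polynomials of `w ∈ W`. -/
abbrev act (w : D.W) : Module.End ℂ (Pol V) := polyAction w.1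

lemma R.ker_iff (r : D.R) (x : V) : D.α r.1 x = 0 ↔ r.1.1 x = x := by
  rw [← LinearMap.mem_ker, D.ker_α r.1 r.2]
  rfl

lemma R.α_ne (r : D.R) : D.α r.1 ≠ 0 := fun h => by
  have h1 := D.ker_α r.1 r.2
  rw [h, LinearMap.ker_zero] at h1
  have h2 := r.2
  rw [IsReflection, ← h1, finrank_top] at h2
  omega

lemma R.exists_div (r : D.R) (f : Pol V) : ∃ q, linPoly (D.α r.1) * q = f - act r.1 f :=
  Cherednik.exists_div _ _ (fun x hx => (r.ker_iff x).1 hx) f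

/-- The divided difference `f ↦ (f - r f) / α_r`. -/
def divDiff (r : D.R) : Module.End ℂ (Pol V) where
  toFun f := divLin (D.α r.1) (f - act r.1 f)
  map_add' f g := by
    obtain ⟨p, hp⟩ := r.exists_div f
    obtain ⟨q, hq⟩ := r.exists_div g
    rw [divLin_eq r.α_ne hp, divLin_eq r.α_ne hq]
    apply divLin_eq r.α_ne
    rw [mul_add, hp, hq, map_add]
    ring
  map_smul' a f := by
    obtain ⟨p, hp⟩ := r.exists_div f
    rw [divLin_eq r.α_ne hp, RingHom.id_apply]
    apply divLin_eq r.α_ne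
    rw [mul_smul_comm, hp, map_smul, smul_sub]

lemma mul_divDiff (r : D.R) (f : Pol V) :
    linPoly (D.α r.1) * divDiff r f = f - act r.1 f := by
  obtain ⟨p, hp⟩ := r.exists_div f
  change _ * divLin _ _ = _
  rw [divLin_eq r.α_ne hp, hp]

lemma divDiff_eq (r : D.R) {f q : Pol V} (h : linPoly (D.α r.1) * q = f - act r.1 f) :
    divDiff r f = q := divLin_eq r.α_ne h

lemma divDiff_mul (r : D.R) (f g : Pol V) :
    divDiff r (f * g) = f * divDiff r g + divDiff r f * act r.1 g := by
  apply divDiff_eq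
  rw [polyAction_mul_apply]
  linear_combination f * mul_divDiff r g + act r.1 g * mul_divDiff r f

/-- The Dunkl operator
`D_v f = ∂_v f - ∑ c_r ⟨α_r, v⟩ (f - r f) / α_r`, the sum over the reflections `r` of `W`. -/
def dunkl (D : Datum V) (v : V) : Module.End ℂ (Pol V) :=
  partialDeriv v - ∑ r : D.R, (D.c r.1 * D.α r.1 v) • divDiff r

lemma dunkl_apply (v : V) (f : Pol V) :
    D.dunkl v f = partialDeriv v f - ∑ r : D.R, (D.c r.1 * D.α r.1 v) • divDiff r f := by
  simp [dunkl]

lemma dunkl_add (v w : V) : D.dunkl (v + w) = D.dunkl v + D.dunkl w := by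
  ext1 f
  simp only [dunkl_apply, LinearMap.add_apply, partialDeriv_add, map_add, mul_add, add_smul,
    Finset.sum_add_distrib]
  ring

lemma dunkl_smul (a : ℂ) (v : V) : D.dunkl (a • v) = a • D.dunkl v := by
  ext1 f
  simp only [dunkl_apply, LinearMap.smul_apply, partialDeriv_smul, map_smul, smul_eq_mul, smul_sub,
    Finset.smul_sum, smul_smul]
  congr 1
  refine Finset.sum_congr rfl fun r _ => ?_
  congr 1
  ring

lemma dunkl_mul (v : V) (f g : Pol V) :
    D.dunkl v (f * g) = f * D.dunkl v g + partialDeriv v f * g -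
      ∑ r : D.R, (D.c r.1 * D.α r.1 v) • (divDiff r f * act r.1 g) := by
  simp only [dunkl_apply, partialDeriv_mul, divDiff_mul, smul_add, Finset.sum_add_distrib, mul_sub,
    Finset.mul_sum, mul_smul_comm]
  ring

lemma dunkl_one (v : V) : D.dunkl v 1 = 0 := by
  have h1 : ∀ r : D.R, divDiff r 1 = 0 := fun r => divDiff_eq r (by
    rw [mul_zero, ← map_one (algebraMap ℂ (Pol V)), polyAction_algebraMap, sub_self])
  rw [dunkl_apply, ← map_one (algebraMap ℂ (Pol V)), partialDeriv_algebraMap, map_one]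
  simp [h1]

lemma isReflection_conj (w r : V ≃ₗ[ℂ] V) (hr : IsReflection r) :
    IsReflection (w * r * w⁻¹) := by
  have h : fixedSpace (w * r * w⁻¹) = (fixedSpace r).map w.toLinearMap := by
    ext x
    constructor
    · intro hx
      refine ⟨w⁻¹ x, ?_, w.apply_symm_apply x⟩
      change r (w⁻¹ x) = w⁻¹ x
      conv_rhs => rw [← show (w * r * w⁻¹) x = x from hx]
      exact (w.symm_apply_apply _).symm
    · rintro ⟨y, hy, rfl⟩
      change w (r (w⁻¹ (w y))) = w y
      rw [show w⁻¹ (w y) = y from w.symm_apply_apply y, show r y = y from hy]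
  rw [IsReflection, h, LinearEquiv.finrank_map_eq]
  exact hr

/-- Conjugation of reflections. -/
def R.conj (w : D.W) : D.R ≃ D.R where
  toFun r := ⟨w * r.1 * w⁻¹, isReflection_conj _ _ r.2⟩
  invFun r := ⟨w⁻¹ * r.1 * w, by
    have := isReflection_conj (w⁻¹).1 _ r.2
    simpa using this⟩
  left_inv r := Subtype.ext (by simp [mul_assoc])
  right_inv r := Subtype.ext (by simp [mul_assoc])

/-- The term `⟨α_r, v⟩ (f - r f) / α_r` of a Dunkl operator does not depend on the choice of
`α_r`. -/
lemma smul_divDiff (r : D.R) {l : Module.Dual ℂ V} (hr : ∀ x, r.1.1 x = x → l x = 0)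
    {f q : Pol V} (h : linPoly l * q = f - act r.1 f) (v : V) :
    D.α r.1 v • divDiff r f = l v • q := by
  obtain ⟨a, ha⟩ : ∃ a : ℂ, a • D.α r.1 = l :=
    exists_smul_eq _ _ fun x hx => hr x ((r.ker_iff x).1 hx)
  subst ha
  have : divDiff r f = a • q := divDiff_eq r (by
    rw [← h, mul_smul_comm, ← smul_mul_assoc]
    rfl)
  rw [this, smul_smul, LinearMap.smul_apply, smul_eq_mul, mul_comm]

lemma dunkl_act (w : D.W) (v : V) (f : Pol V) :
    D.dunkl v (act w f) = act w (D.dunkl (w⁻¹.1 v) f) := by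
  rw [dunkl_apply, dunkl_apply, map_sub, partialDeriv_polyAction, map_sum]
  congr 1
  rw [← (R.conj w).sum_comp]
  refine Finset.sum_congr rfl fun r _ => ?_
  have h := smul_divDiff (R.conj w r)
    (l := D.α r.1 ∘ₗ (w.1⁻¹ : V ≃ₗ[ℂ] V).toLinearMap) (f := act w f) (q := act w (divDiff r f))
    (fun x hx => (r.ker_iff _).2 (by
      change r.1.1 (w.1⁻¹ x) = w.1⁻¹ x
      conv_rhs => rw [← show (w.1 * r.1.1 * w.1⁻¹) x = x from hx]
      exact (w.1.symm_apply_apply _).symm))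
    (by
      rw [← polyAction_linPoly, ← polyAction_mul_apply, mul_divDiff, map_sub]
      congr 1
      have : (R.conj w r).1 = w * r.1 * w⁻¹ := rfl
      rw [this]
      change _ = (polyAction (w.1 * r.1.1 * w.1⁻¹) * polyAction w.1) f
      rw [← map_mul, inv_mul_cancel_right, map_mul]
      rfl) v
  have hc : D.c (R.conj w r).1 = D.c r.1 := D.c_conj _ _ r.2
  rw [mul_smul, h, hc, ← mul_smul, map_smul]
  rfl

/-- The commutator of a Dunkl operator and multiplication by a linear form. -/
lemma dunkl_linPoly_mul (l : Module.Dual ℂ V) : ∃ k : D.R → ℂ, ∀ (v : V) (f : Pol V),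
    D.dunkl v (linPoly l * f) = linPoly l * D.dunkl v f + l v • f -
      ∑ r : D.R, (D.c r.1 * D.α r.1 v * k r) • act r.1 f := by
  have h : ∀ r : D.R, ∃ a : ℂ, divDiff r (linPoly l) = algebraMap ℂ _ a := fun r => by
    obtain ⟨a, ha⟩ := exists_coeff (D.α r.1) l r.1.1 (fun x hx => (r.ker_iff x).1 hx)
    refine ⟨a, divDiff_eq r ?_⟩
    rw [polyAction_linPoly, mul_comm, ← Algebra.smul_def]
    apply Pol.ext
    funext x
    exact LinearMap.congr_fun ha x
  choose k hk using h
  refine ⟨k, fun v f => ?_⟩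
  rw [dunkl_mul, partialDeriv_linPoly, ← Algebra.smul_def]
  congr 1
  refine Finset.sum_congr rfl fun r _ => ?_
  rw [hk, ← Algebra.smul_def, smul_smul]

lemma R.symm_pairing (r : D.R) (u v : V) :
    D.α r.1 v • (r.1⁻¹.1 u - u) = D.α r.1 u • (r.1⁻¹.1 v - v) := by
  have h1 : D.α r.1 (D.α r.1 v • u - D.α r.1 u • v) = 0 := by
    simp only [map_sub, map_smul, smul_eq_mul]
    ring
  have h2 : r.1⁻¹.1 (D.α r.1 v • u - D.α r.1 u • v) = D.α r.1 v • u - D.α r.1 u • v := by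
    conv_lhs => rw [← (r.ker_iff _).1 h1]
    exact r.1.1.symm_apply_apply _
  rw [map_sub, map_smul, map_smul] at h2
  rw [smul_sub, smul_sub, sub_eq_sub_iff_sub_eq_sub]
  exact h2

lemma dunkl_sub (v w : V) : D.dunkl (v - w) = D.dunkl v - D.dunkl w := by
  have h := dunkl_add (D := D) (v - w) w
  rw [sub_add_cancel] at h
  ext1 f
  have h2 := LinearMap.congr_fun h f
  rw [LinearMap.add_apply] at h2
  rw [LinearMap.sub_apply, h2, add_sub_cancel_right]

lemma dunkl_comm (u v : V) : D.dunkl u * D.dunkl v = D.dunkl v * D.dunkl u := by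
  have h1 : ∀ (l : Module.Dual ℂ V) (f : Pol V),
      D.dunkl u (D.dunkl v (linPoly l * f)) - D.dunkl v (D.dunkl u (linPoly l * f)) =
      linPoly l * (D.dunkl u (D.dunkl v f) - D.dunkl v (D.dunkl u f)) := by
    intro l f
    obtain ⟨k, hk⟩ := dunkl_linPoly_mul (D := D) l
    have h2 : ∀ r : D.R, (D.c r.1 * D.α r.1 v * k r) • (D.dunkl u (act r.1 f) - act r.1 (D.dunkl u f))
        = (D.c r.1 * D.α r.1 u * k r) • (D.dunkl v (act r.1 f) - act r.1 (D.dunkl v f)) := by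
      intro r
      have e : ∀ z : V, D.dunkl z (act r.1 f) - act r.1 (D.dunkl z f) =
          act r.1 (D.dunkl (r.1⁻¹.1 z - z) f) := fun z => by
        rw [dunkl_act, dunkl_sub, LinearMap.sub_apply, map_sub]
      have e2 := congrArg (fun z => (D.c r.1 * k r) • act r.1 (D.dunkl z f)) (r.symm_pairing u v)
      simp only [dunkl_smul, LinearMap.smul_apply, map_smul, smul_smul] at e2
      rw [e, e]
      convert! e2 using 2 <;> ring
    have h3 := Finset.sum_congr rfl (fun r (_ : r ∈ (Finset.univ : Finset D.R)) => h2 r)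
    simp only [smul_sub, Finset.sum_sub_distrib] at h3
    simp only [hk, map_add, map_sub, map_sum, map_smul]
    linear_combination (-1 : Pol V) * h3
  have h4 : ∀ g f : Pol V,
      D.dunkl u (D.dunkl v (g * f)) - D.dunkl v (D.dunkl u (g * f)) =
      g * (D.dunkl u (D.dunkl v f) - D.dunkl v (D.dunkl u f)) := by
    intro g
    induction g using Pol.ind with
    | hlin l => exact h1 l
    | hconst a =>
      intro f
      simp only [← Algebra.smul_def, map_smul, smul_sub]
    | hadd p q hp hq =>
      intro f
      simp only [add_mul, map_add]
      linear_combination hp f + hq f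
    | hmul p q hp hq =>
      intro f
      rw [mul_assoc, hp, hq, mul_assoc]
  ext1 f
  have := h4 f 1
  rw [mul_one, dunkl_one, dunkl_one, map_zero, map_zero, sub_zero, mul_zero, sub_eq_zero] at this
  exact this

lemma euler_dunkl (v : V) (f : Pol V) :
    eulerField (D.dunkl v f) + D.dunkl v f = D.dunkl v (eulerField f) := by
  have h1 : ∀ r : D.R, eulerField (divDiff r f) + divDiff r f = divDiff r (eulerField f) :=
    fun r => (divDiff_eq r (by
      have := congrArg eulerField (mul_divDiff r f)
      rw [eulerField_mul, eulerField_linPoly, map_sub, eulerField_polyAction] at this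
      linear_combination this)).symm
  simp only [dunkl_apply, map_sub, map_sum, map_smul, ← eulerField_partialDeriv, ← h1, smul_add,
    Finset.sum_add_distrib]
  ring

lemma euler_eq [FiniteDimensional ℂ V] :
    (eulerField : Module.End ℂ (Pol V)) =
      ∑ i, LinearMap.mulLeft ℂ (linPoly ((Module.finBasis ℂ V).coord i)) *
        D.dunkl (Module.finBasis ℂ V i) + ∑ r : D.R, D.c r.1 • (1 - act r.1) := by
  ext1 f
  set b := Module.finBasis ℂ V
  have h1 : eulerField f = ∑ i, linPoly (b.coord i) * partialDeriv (b i) f := by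
    apply Pol.ext
    funext x
    rw [eulerField_apply]
    conv_lhs => rw [← b.sum_repr x]
    rw [← b.sum_repr x, lineDeriv_polySum_dir, b.sum_repr x]
    simp [partialDeriv_apply]
  have h2 : ∀ l : Module.Dual ℂ V, ∑ i, l (b i) • linPoly (b.coord i) = linPoly l := fun l => by
    apply Pol.ext
    funext x
    conv_rhs => rw [linPoly_coe, ← b.sum_repr x, map_sum]
    simp [mul_comm]
  have h3 : ∀ r : D.R, f - act r.1 f = ∑ i, D.α r.1 (b i) • (linPoly (b.coord i) * divDiff r f) := by
    intro r
    rw [← mul_divDiff, ← h2 (D.α r.1), Finset.sum_mul]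
    simp only [smul_mul_assoc]
  simp only [LinearMap.add_apply, LinearMap.sum_apply, LinearMap.smul_apply, LinearMap.sub_apply,
    Module.End.mul_apply, Module.End.one_apply, LinearMap.mulLeft_apply, dunkl_apply, h1, h3,
    mul_sub, Finset.mul_sum, Finset.smul_sum, Finset.sum_sub_distrib, smul_smul, mul_smul_comm]
  rw [Finset.sum_comm, sub_add_cancel]


end Datum

namespace Datum

variable {V : Type u} [AddCommGroup V] [Module ℂ V]

section Algebra

variable (D : Datum V)

/-- The rational Cherednik algebra `H_c(W, V)`: the algebra of operators on `ℂ[V]` generated by the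
group `W`, the multiplications by polynomials, and the Dunkl operators. -/
def cherednik : Subalgebra ℂ (Module.End ℂ (Pol V)) :=
  Algebra.adjoin ℂ (Set.range (fun w : D.W => act w) ∪
    Set.range (fun f : Pol V => LinearMap.mulLeft ℂ f) ∪ Set.range (fun v : V => D.dunkl v))

/-- The rational Cherednik algebra `H_c(W, V)`, as a type. -/
def H : Type u := D.cherednik

instance : Ring D.H := inferInstanceAs (Ring D.cherednik)

instance : Algebra ℂ D.H := inferInstanceAs (Algebra ℂ D.cherednik)

/-- The action of `H_c` on polynomials. -/
def op : D.H →ₐ[ℂ] Module.End ℂ (Pol V) := D.cherednik.val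

lemma op_injective : Function.Injective D.op := Subtype.val_injective

/-- The group elements in `H_c`. -/
def grp : D.W →* D.H where
  toFun w := ⟨act w, Algebra.subset_adjoin (Or.inl (Or.inl ⟨w, rfl⟩))⟩
  map_one' := Subtype.ext (map_one polyAction)
  map_mul' w w' := Subtype.ext (map_mul polyAction w.1 w'.1)

/-- The polynomials in `H_c`, acting by multiplication. -/
def pol : Pol V →ₐ[ℂ] D.H where
  toFun f := ⟨LinearMap.mulLeft ℂ f, Algebra.subset_adjoin (Or.inl (Or.inr ⟨f, rfl⟩))⟩
  map_one' := Subtype.ext (by ext1 g; exact one_mul g)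
  map_mul' f f' := Subtype.ext (by ext1 g; exact mul_assoc f f' g)
  map_zero' := Subtype.ext (by ext1 g; exact zero_mul g)
  map_add' f f' := Subtype.ext (by ext1 g; exact add_mul f f' g)
  commutes' a := Subtype.ext (by ext1 g; exact (Algebra.smul_def a g).symm)

/-- The Dunkl operators in `H_c`. -/
def dun : V →ₗ[ℂ] D.H where
  toFun v := ⟨D.dunkl v, Algebra.subset_adjoin (Or.inr ⟨v, rfl⟩)⟩
  map_add' v w := Subtype.ext (dunkl_add v w)
  map_smul' a v := Subtype.ext (dunkl_smul a v)

lemma H_induction {p : D.H → Prop} (hg : ∀ w, p (D.grp w)) (hp : ∀ f, p (D.pol f))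
    (hd : ∀ v, p (D.dun v)) (hs : ∀ a : ℂ, p (algebraMap ℂ D.H a))
    (hadd : ∀ a b, p a → p b → p (a + b)) (hmul : ∀ a b, p a → p b → p (a * b)) (h : D.H) :
    p h := by
  obtain ⟨h, hh⟩ := h
  induction hh using Algebra.adjoin_induction with
  | mem x hx =>
    rcases hx with (⟨w, rfl⟩ | ⟨f, rfl⟩) | ⟨v, rfl⟩
    exacts [hg w, hp f, hd v]
  | algebraMap r => exact hs r
  | add x y hx hy h1 h2 => exact hadd ⟨x, hx⟩ ⟨y, hy⟩ h1 h2
  | mul x y hx hy h1 h2 => exact hmul ⟨x, hx⟩ ⟨y, hy⟩ h1 h2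

variable {D}

lemma dun_grp (w : D.W) (v : V) : D.dun v * D.grp w = D.grp w * D.dun (w⁻¹.1 v) :=
  Subtype.ext (by ext1 f; exact dunkl_act w v f)

lemma grp_pol (w : D.W) (f : Pol V) : D.grp w * D.pol f = D.pol (act w f) * D.grp w :=
  Subtype.ext (by ext1 g; rfl)

lemma dun_comm (u v : V) : D.dun u * D.dun v = D.dun v * D.dun u :=
  Subtype.ext (dunkl_comm u v)

lemma dun_pol (v : V) (f : Pol V) : D.dun v * D.pol f = D.pol f * D.dun v +
    D.pol (partialDeriv v f) -
      ∑ r : D.R, (D.c r.1 * D.α r.1 v) • (D.pol (divDiff r f) * D.grp r.1) := by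
  apply D.op_injective
  ext1 g
  rw [map_sub, map_sum, LinearMap.sub_apply, LinearMap.sum_apply]
  exact dunkl_mul v f g

variable (D) [FiniteDimensional ℂ V]

/-- The Euler element `eu = ∑ xᵢ ∂/∂xᵢ` of `H_c`. -/
def eu : D.H := ⟨eulerField, by
  rw [euler_eq (D := D)]
  refine add_mem (sum_mem fun i _ => mul_mem (D.pol _).2 (D.dun _).2)
    (sum_mem fun r _ => Subalgebra.smul_mem _ (sub_mem (one_mem _) (D.grp r.1).2) _)⟩

variable {D}

lemma eu_grp (w : D.W) : D.eu * D.grp w = D.grp w * D.eu :=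
  Subtype.ext (by ext1 f; exact eulerField_polyAction w.1 f)

lemma eu_pol (l : Module.Dual ℂ V) :
    D.eu * D.pol (linPoly l) = D.pol (linPoly l) * (D.eu + 1) := by
  apply Subtype.ext
  ext1 f
  change eulerField (linPoly l * f) = linPoly l * (eulerField f + f)
  rw [eulerField_mul, eulerField_linPoly]
  ring

lemma eu_dun (v : V) : D.eu * D.dun v = D.dun v * (D.eu - 1) := by
  apply Subtype.ext
  ext1 f
  change eulerField (D.dunkl v f) = D.dunkl v (eulerField f - f)
  rw [map_sub, ← euler_dunkl]
  ring

instance : IsNoetherianRing (Pol V) := by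
  classical
  have : Algebra.FiniteType ℂ (polFun V) := by
    rw [← Subalgebra.fg_iff_finiteType]
    refine ⟨Finset.univ.image fun i => ((Module.finBasis ℂ V).coord i : V → ℂ), ?_⟩
    apply le_antisymm
    · refine Algebra.adjoin_mono ?_
      intro x hx
      simp only [Finset.coe_image, Set.mem_image] at hx
      obtain ⟨i, -, rfl⟩ := hx
      exact ⟨_, rfl⟩
    · refine Algebra.adjoin_le ?_
      rintro _ ⟨l, rfl⟩
      have : (l : V → ℂ) =
          ∑ i, l (Module.finBasis ℂ V i) • ((Module.finBasis ℂ V).coord i : V → ℂ) := by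
        funext x
        conv_lhs => rw [← (Module.finBasis ℂ V).sum_repr x, map_sum]
        simp [mul_comm]
      simp only [SetLike.mem_coe]
      rw [this]
      refine sum_mem fun i _ => Subalgebra.smul_mem _ (Algebra.subset_adjoin ?_) _
      simp
  exact Algebra.FiniteType.isNoetherianRing ℂ (polFun V)

variable (D)

/-- Each Dunkl operator acts locally nilpotently on `M`. -/
def LocNilp (M : Type*) [AddCommGroup M] [Module D.H M] : Prop :=
  ∀ (v : V) (m : M), ∃ n : ℕ, (D.dun v) ^ n • m = 0

section Noetherian

variable {D}
variable {M : Type*} [AddCommGroup M] [Module D.H M] [Module ℂ M] [IsScalarTower ℂ D.H M]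

lemma exists_stable_step (hM : D.LocNilp M) (U : Submodule ℂ M) (hU : U.FG) (v : V) :
    ∃ U' : Submodule ℂ M, U'.FG ∧ U ≤ U' ∧ (∀ m ∈ U', D.dun v • m ∈ U') ∧
      ∀ u : V, (∀ m ∈ U, D.dun u • m ∈ U) → ∀ m ∈ U', D.dun u • m ∈ U' := by
  let T : V → M →ₗ[ℂ] M := fun v => Algebra.lsmul ℂ ℂ M (D.dun v)
  obtain ⟨S, rfl⟩ := hU
  choose n hn using hM v
  have hN : ∃ N : ℕ, ∀ m ∈ Submodule.span ℂ (S : Set M), (D.dun v) ^ N • m = 0 := by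
    refine ⟨S.sup n, fun m hm => ?_⟩
    induction hm using Submodule.span_induction with
    | mem x hx =>
      obtain ⟨k, hk⟩ := Nat.exists_eq_add_of_le' (Finset.le_sup (f := n) hx)
      rw [hk, pow_add, mul_smul, hn, smul_zero]
    | zero => exact smul_zero _
    | add x y _ _ h1 h2 => rw [smul_add, h1, h2, add_zero]
    | smul a x _ h1 => rw [smul_comm, h1, smul_zero]
  obtain ⟨N, hN⟩ := hN
  set U := Submodule.span ℂ (S : Set M) with hUdef
  refine ⟨⨆ k : Fin (N + 1), U.map (T v ^ k.1), ?_, ?_, ?_, ?_⟩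
  · exact Submodule.fg_iSup _ fun k => Submodule.FG.map _ ⟨S, rfl⟩
  · refine le_trans ?_ (le_iSup _ (0 : Fin (N + 1)))
    intro m hm
    exact ⟨m, hm, by simp⟩
  · intro m hm
    induction hm using Submodule.iSup_induction' with
    | mem k x hx =>
      obtain ⟨y, hy, rfl⟩ := hx
      have e : D.dun v • (T v ^ k.1) y = (T v ^ (k.1 + 1)) y := by
        rw [pow_succ']
        rfl
      rw [e]
      by_cases hk : k.1 + 1 < N + 1
      · exact Submodule.mem_iSup_of_mem (⟨k.1 + 1, hk⟩ : Fin (N + 1)) ⟨y, hy, rfl⟩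
      · have : k.1 + 1 = 1 + N := by omega
        have h0 : (T v ^ N) y = 0 := by
          have := hN y hy
          rw [← map_pow]
          exact this
        rw [this, pow_add, Module.End.mul_apply, h0, map_zero]
        exact zero_mem _
    | zero => rw [smul_zero]; exact zero_mem _
    | add x y _ _ h1 h2 => rw [smul_add]; exact add_mem h1 h2
  · intro u hu m hm
    have hcomm : Commute (T u) (T v) := by
      have := congrArg (Algebra.lsmul ℂ ℂ M) (dun_comm (D := D) u v)
      rwa [map_mul, map_mul] at this
    induction hm using Submodule.iSup_induction' with
    | mem k x hx =>
      obtain ⟨y, hy, rfl⟩ := hx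
      have e : D.dun u • (T v ^ k.1) y = (T v ^ k.1) (D.dun u • y) :=
        LinearMap.congr_fun (hcomm.pow_right k.1).eq y
      rw [e]
      exact Submodule.mem_iSup_of_mem k ⟨_, hu y hy, rfl⟩
    | zero => rw [smul_zero]; exact zero_mem _
    | add x y _ _ h1 h2 => rw [smul_add]; exact add_mem h1 h2

lemma exists_stable (hM : D.LocNilp M) (S : Finset M) :
    ∃ U : Submodule ℂ M, U.FG ∧ (S : Set M) ⊆ U ∧ (∀ v, ∀ m ∈ U, D.dun v • m ∈ U) ∧
      ∀ w, ∀ m ∈ U, D.grp w • m ∈ U := by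
  classical
  have h1 : ∀ s : Finset V, ∃ U : Submodule ℂ M, U.FG ∧ (S : Set M) ⊆ U ∧
      ∀ v ∈ s, ∀ m ∈ U, D.dun v • m ∈ U := by
    intro s
    induction s using Finset.induction_on with
    | empty => exact ⟨Submodule.span ℂ S, ⟨S, rfl⟩, Submodule.subset_span, by simp⟩
    | insert v s _ ih =>
      obtain ⟨U, hfg, hS, hU⟩ := ih
      obtain ⟨U', hfg', hle, hv, hu⟩ := exists_stable_step hM U hfg v
      refine ⟨U', hfg', hS.trans hle, fun u hus => ?_⟩
      rcases Finset.mem_insert.1 hus with rfl | h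
      · exact hv
      · exact hu u (hU u h)
  obtain ⟨U, hfg, hS, hU⟩ := h1 (Finset.univ.image (Module.finBasis ℂ V))
  have hU' : ∀ v, ∀ m ∈ U, D.dun v • m ∈ U := by
    intro v m hm
    rw [← (Module.finBasis ℂ V).sum_repr v, map_sum, Finset.sum_smul]
    refine sum_mem fun i _ => ?_
    rw [map_smul, smul_assoc]
    exact U.smul_mem _ (hU _ (by simp) m hm)
  let T : D.W → M →ₗ[ℂ] M := fun w => Algebra.lsmul ℂ ℂ M (D.grp w)
  refine ⟨⨆ w, U.map (T w), Submodule.fg_iSup _ fun w => hfg.map _, ?_, ?_, ?_⟩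
  · intro m hm
    refine Submodule.mem_iSup_of_mem (1 : D.W) ⟨m, hS hm, ?_⟩
    change D.grp 1 • m = m
    rw [map_one, one_smul]
  · intro v m hm
    induction hm using Submodule.iSup_induction' with
    | mem w x hx =>
      obtain ⟨y, hy, rfl⟩ := hx
      refine Submodule.mem_iSup_of_mem w ⟨_, hU' (w⁻¹.1 v) y hy, ?_⟩
      change D.grp w • D.dun _ • y = D.dun v • D.grp w • y
      rw [← mul_smul, ← mul_smul, dun_grp]
    | zero => rw [smul_zero]; exact zero_mem _
    | add x y _ _ h1 h2 => rw [smul_add]; exact add_mem h1 h2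
  · intro w' m hm
    induction hm using Submodule.iSup_induction' with
    | mem w x hx =>
      obtain ⟨y, hy, rfl⟩ := hx
      refine Submodule.mem_iSup_of_mem (w' * w) ⟨y, hy, ?_⟩
      change D.grp (w' * w) • y = D.grp w' • D.grp w • y
      rw [← mul_smul, map_mul]
    | zero => rw [smul_zero]; exact zero_mem _
    | add x y _ _ h1 h2 => rw [smul_add]; exact add_mem h1 h2

/-- The modules in category `O` are finitely generated over `ℂ[V]`, hence Noetherian. -/
lemma isNoetherian_of_locNilp [Module.Finite D.H M] (hM : D.LocNilp M) : IsNoetherian D.H M := by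
  let _ : Module (Pol V) M := Module.compHom M (D.pol : Pol V →+* D.H)
  let _ : SMul (Pol V) D.H := (Module.compHom D.H (D.pol : Pol V →+* D.H)).toSMul
  have tow : IsScalarTower (Pol V) D.H M := ⟨fun f h m => mul_smul (D.pol f) h m⟩
  have tow' : IsScalarTower ℂ (Pol V) M := ⟨fun a f m => by
    change D.pol (a • f) • m = a • D.pol f • m
    rw [map_smul, smul_assoc]⟩
  have fin : Module.Finite (Pol V) M := by
    obtain ⟨S, hS⟩ := Module.Finite.fg_top (R := D.H) (M := M)
    obtain ⟨U, ⟨B, hB⟩, hSU, hd, hg⟩ := exists_stable hM S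
    refine ⟨⟨B, ?_⟩⟩
    have hUle : ∀ m ∈ U, m ∈ Submodule.span (Pol V) (B : Set M) := fun m hm => by
      rw [← hB] at hm
      exact Submodule.span_le_restrictScalars ℂ (Pol V) _ hm
    have hle : Submodule.span (Pol V) (B : Set M) ≤ Submodule.span (Pol V) (U : Set M) := by
      refine Submodule.span_mono ?_
      rw [← hB]
      exact Submodule.subset_span
    have keyg : ∀ (w : D.W) (m : M), m ∈ Submodule.span (Pol V) (U : Set M) →
        D.grp w • m ∈ Submodule.span (Pol V) (U : Set M) := by
      intro w m hm
      induction hm using Submodule.span_induction with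
      | mem x hx => exact Submodule.subset_span (hg w x hx)
      | zero => rw [smul_zero]; exact zero_mem _
      | add x y _ _ h1 h2 => rw [smul_add]; exact add_mem h1 h2
      | smul f x _ h1 =>
        change D.grp w • D.pol f • x ∈ _
        rw [← mul_smul, grp_pol, mul_smul]
        exact Submodule.smul_mem _ (act w f) h1
    have key : ∀ (h : D.H) (m : M), m ∈ Submodule.span (Pol V) (U : Set M) →
        h • m ∈ Submodule.span (Pol V) (U : Set M) := by
      intro h
      induction h using D.H_induction with
      | hg w => exact keyg w
      | hp f => exact fun m hm => Submodule.smul_mem _ f hm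
      | hd v =>
        intro m hm
        induction hm using Submodule.span_induction with
        | mem x hx => exact Submodule.subset_span (hd v x hx)
        | zero => rw [smul_zero]; exact zero_mem _
        | add x y _ _ h1 h2 => rw [smul_add]; exact add_mem h1 h2
        | smul f x hx h1 =>
          change D.dun v • D.pol f • x ∈ _
          rw [← mul_smul, dun_pol, sub_smul, add_smul, Finset.sum_smul, mul_smul]
          refine sub_mem (add_mem (Submodule.smul_mem _ f h1)
            (Submodule.smul_mem _ (partialDeriv v f) hx)) (sum_mem fun r _ => ?_)
          rw [smul_assoc, mul_smul (D.pol (divDiff r f))]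
          have := Submodule.smul_mem _ (algebraMap ℂ (Pol V) (D.c r.1 * D.α r.1 v))
            (Submodule.smul_mem _ (divDiff r f) (keyg r.1 x hx))
          rwa [algebraMap_smul] at this
      | hs a =>
        intro m hm
        rw [algebraMap_smul]
        have := Submodule.smul_mem _ (algebraMap ℂ (Pol V) a) hm
        rwa [algebraMap_smul] at this
      | hadd a b ha hb => exact fun m hm => by rw [add_smul]; exact add_mem (ha m hm) (hb m hm)
      | hmul a b ha hb => exact fun m hm => by rw [mul_smul]; exact ha _ (hb m hm)
    have key2 : ∀ m, m ∈ Submodule.span D.H (S : Set M) → m ∈ Submodule.span (Pol V) (U : Set M) := by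
      intro m hm
      induction hm using Submodule.span_induction with
      | mem x hx => exact Submodule.subset_span (hSU hx)
      | zero => exact zero_mem _
      | add x y _ _ h1 h2 => exact add_mem h1 h2
      | smul h x _ h1 => exact key h x h1
    rw [eq_top_iff]
    intro m _
    have hm := key2 m (by rw [hS]; trivial)
    exact Submodule.span_le.2 (fun x hx => hUle x hx) hm
  exact isNoetherian_of_tower (Pol V) inferInstance

end Noetherian

/-- Category `O_c`: the property of `H_c`-modules of being finitely generated, with locally nilpotent
action of the Dunkl operators. -/
def isO : ObjectProperty (ModuleCat.{u} D.H) := fun M => Module.Finite D.H M ∧ D.LocNilp M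

/-- Category `O_c`, a full subcategory of the category of `H_c`-modules. -/
abbrev O := D.isO.FullSubcategory

lemma LocNilp.of_injective {D : Datum V} {M N : Type*} [AddCommGroup M] [Module D.H M]
    [AddCommGroup N] [Module D.H N] (f : M →ₗ[D.H] N) (hf : Function.Injective f)
    (hN : D.LocNilp N) : D.LocNilp M := fun v m => by
  obtain ⟨n, hn⟩ := hN v (f m)
  exact ⟨n, hf (by rw [map_smul, hn, map_zero])⟩

lemma LocNilp.of_surjective {D : Datum V} {M N : Type*} [AddCommGroup M] [Module D.H M]
    [AddCommGroup N] [Module D.H N] (f : M →ₗ[D.H] N) (hf : Function.Surjective f)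
    (hM : D.LocNilp M) : D.LocNilp N := fun v m => by
  obtain ⟨m, rfl⟩ := hf m
  obtain ⟨n, hn⟩ := hM v m
  exact ⟨n, by rw [← map_smul, hn, map_zero]⟩

lemma isO_of_mono {D : Datum V} {X Y : ModuleCat.{u} D.H} (f : X ⟶ Y) [Mono f] (hY : D.isO Y) :
    D.isO X := by
  have hf := (ModuleCat.mono_iff_injective f).1 inferInstance
  have := hY.1
  let _ : Module ℂ Y := Module.compHom Y (algebraMap ℂ D.H)
  have : IsScalarTower ℂ D.H Y := ⟨fun a h m => by
    rw [Algebra.smul_def, mul_smul]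
    rfl⟩
  have := isNoetherian_of_locNilp hY.2
  have := isNoetherian_of_injective f.hom hf
  exact ⟨inferInstance, hY.2.of_injective f.hom hf⟩

lemma isO_of_epi {D : Datum V} {X Y : ModuleCat.{u} D.H} (f : X ⟶ Y) [Epi f] (hX : D.isO X) :
    D.isO Y := by
  have hf := (ModuleCat.epi_iff_surjective f).1 inferInstance
  have := hX.1
  exact ⟨Module.Finite.of_surjective f.hom hf, hX.2.of_surjective f.hom hf⟩

instance : D.isO.IsClosedUnderKernels where
  kernels_le := by
    rintro _ ⟨f, k, hk, hf⟩
    have : Mono k.ι := Fork.IsLimit.mono hk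
    exact isO_of_mono k.ι hf.1

instance : D.isO.IsClosedUnderCokernels where
  cokernels_le := by
    rintro _ ⟨f, k, hk, hf⟩
    have : Epi k.π := Cofork.IsColimit.epi hk
    exact isO_of_epi k.π hf.2

instance : D.isO.IsClosedUnderIsomorphisms where
  of_iso e hX := isO_of_epi e.hom hX

instance : D.isO.ContainsZero where
  exists_zero := ⟨ModuleCat.of D.H PUnit.{u+1}, ModuleCat.isZero_of_subsingleton _,
    (inferInstance : Module.Finite D.H PUnit.{u+1}), fun _ _ => ⟨0, rfl⟩⟩

instance : D.isO.IsClosedUnderBinaryProducts :=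
  .mk' (by
    rintro _ ⟨F, hF⟩
    have h1 := hF ⟨WalkingPair.left⟩
    have h2 := hF ⟨WalkingPair.right⟩
    generalize hX : F.obj ⟨WalkingPair.left⟩ = X at h1
    generalize hY : F.obj ⟨WalkingPair.right⟩ = Y at h2
    have e : ModuleCat.of D.H (X × Y) ≅ limit F := by
      subst hX hY
      exact (ModuleCat.biprodIsoProd _ _).symm ≪≫ biprod.isoProd _ _ ≪≫
        HasLimit.isoOfNatIso (diagramIsoPair F).symm
    refine D.isO.prop_of_iso e ⟨?_, ?_⟩
    · have := h1.1
      have := h2.1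
      exact (inferInstance : Module.Finite D.H (X × Y))
    · rintro v ⟨x, y⟩
      obtain ⟨n, hn⟩ := h1.2 v x
      obtain ⟨m, hm⟩ := h2.2 v y
      refine ⟨n + m, Prod.ext ?_ ?_⟩
      · change (D.dun v) ^ (n + m) • x = 0
        rw [add_comm, pow_add, mul_smul, hn, smul_zero]
      · change (D.dun v) ^ (n + m) • y = 0
        rw [pow_add, mul_smul, hm, smul_zero])

instance : D.isO.IsClosedUnderFiniteProducts := .mk'

end Algebra

section Modules

variable [FiniteDimensional ℂ V] (D : Datum V)
variable (M : Type u) [AddCommGroup M] [Module D.H M] [Module ℂ M] [IsScalarTower ℂ D.H M]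

/-- The weight space `M_d`: the generalized eigenspace of the Euler element for the eigenvalue
`d`. -/
def weight (d : ℂ) : Submodule ℂ M :=
  Module.End.maxGenEigenspace (Algebra.lsmul ℂ ℂ M D.eu) d

/-- The action of `W` on an `H_c`-module. -/
def rep : Representation ℂ D.W M :=
  ((Algebra.lsmul ℂ ℂ M : D.H →ₐ[ℂ] Module.End ℂ M) : D.H →* Module.End ℂ M).comp D.grp

/-- The subspace `V* M` spanned by the elements `x m`, for linear forms `x` and elements `m`. -/
def dualSmul : Submodule ℂ M :=
  Submodule.span ℂ {n | ∃ (x : Module.Dual ℂ V) (m : M), n = D.pol (linPoly x) • m}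

/-- The space `H⁰(V, M)` of elements killed by all Dunkl operators. -/
def inv : Submodule ℂ M where
  carrier := {m | ∀ v : V, D.dun v • m = 0}
  zero_mem' _ := smul_zero _
  add_mem' h1 h2 v := by rw [smul_add, h1 v, h2 v, add_zero]
  smul_mem' a m h v := by rw [smul_comm, h v, smul_zero]

variable {D M}

lemma weight_shift {h : D.H} {a : ℂ} (hh : D.eu * h = h * (D.eu + algebraMap ℂ D.H a)) {d : ℂ}
    {m : M} (hm : m ∈ D.weight M d) : h • m ∈ D.weight M (d + a) := by
  rw [weight, Module.End.mem_maxGenEigenspace] at hm ⊢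
  obtain ⟨k, hk⟩ := hm
  refine ⟨k, ?_⟩
  have e : SemiconjBy (Algebra.lsmul ℂ ℂ M h) (Algebra.lsmul ℂ ℂ M D.eu - d • 1)
      (Algebra.lsmul ℂ ℂ M D.eu - (d + a) • 1) := by
    have := congrArg (Algebra.lsmul ℂ ℂ M) hh
    rw [map_mul, map_mul, map_add, AlgHom.commutes, Algebra.algebraMap_eq_smul_one] at this
    rw [SemiconjBy, sub_mul, this, add_smul]
    simp only [mul_add, mul_sub, add_mul, smul_mul_assoc, mul_smul_comm, one_mul, mul_one]
    abel
  have := LinearMap.congr_fun (e.pow_right k).eq m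
  rw [Module.End.mul_apply, hk, map_zero] at this
  exact this.symm

lemma weight_grp (w : D.W) {d : ℂ} {m : M} (hm : m ∈ D.weight M d) :
    D.grp w • m ∈ D.weight M d := by
  have := weight_shift (h := D.grp w) (a := 0) (by rw [map_zero, add_zero, eu_grp]) hm
  rwa [add_zero] at this

lemma weight_pol (l : Module.Dual ℂ V) {d : ℂ} {m : M} (hm : m ∈ D.weight M d) :
    D.pol (linPoly l) • m ∈ D.weight M (d + 1) :=
  weight_shift (by rw [map_one, eu_pol]) hm

lemma weight_dun (v : V) {d : ℂ} {m : M} (hm : m ∈ D.weight M d) :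
    D.dun v • m ∈ D.weight M (d + -1) :=
  weight_shift (by rw [map_neg, map_one, eu_dun, sub_eq_add_neg]) hm

lemma rep_apply (w : D.W) (m : M) : D.rep M w m = D.grp w • m := rfl

lemma dualSmul_grp (w : D.W) : D.dualSmul M ≤ (D.dualSmul M).comap (D.rep M w) := by
  rw [dualSmul, Submodule.span_le]
  rintro _ ⟨x, m, rfl⟩
  refine Submodule.subset_span ⟨x ∘ₗ (w.1⁻¹ : V ≃ₗ[ℂ] V).toLinearMap, D.grp w • m, ?_⟩
  rw [rep_apply, ← mul_smul, grp_pol, mul_smul]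
  rfl

lemma inv_grp (w : D.W) {m : M} (hm : m ∈ D.inv M) : D.grp w • m ∈ D.inv M := fun v => by
  rw [← mul_smul, dun_grp, mul_smul, hm, smul_zero]

variable (D M)

/-- The degree `d` part of `H₀(V*, M) = M / V* M`: the image of `M_d`. -/
def coinvDeg (d : ℂ) : Submodule ℂ (M ⧸ D.dualSmul M) :=
  (D.weight M d).map (D.dualSmul M).mkQ

/-- The representation of `W` on the degree `d` part of `H₀(V*, M) = M / V* M`. -/
def coinvRep (d : ℂ) : Representation ℂ D.W (D.coinvDeg M d) :=
  ((D.rep M).quotient (D.dualSmul M) dualSmul_grp).subrepresentation (D.coinvDeg M d) (by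
    rintro w _ ⟨m, hm, rfl⟩
    exact ⟨D.grp w • m, weight_grp w hm, rfl⟩)

/-- The degree `d` part of `H⁰(V, M)`. -/
def invDeg (d : ℂ) : Submodule ℂ M := D.inv M ⊓ D.weight M d

/-- The representation of `W` on the degree `d` part of `H⁰(V, M)`. -/
def invRep (d : ℂ) : Representation ℂ D.W (D.invDeg M d) :=
  (D.rep M).subrepresentation (D.invDeg M d) (fun w _ hm =>
    ⟨inv_grp w hm.1, weight_grp w hm.2⟩)

variable {D M}
variable {N : Type u} [AddCommGroup N] [Module D.H N] [Module ℂ N] [IsScalarTower ℂ D.H N]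

lemma weight_map (f : M →ₗ[D.H] N) {d : ℂ} {m : M} (hm : m ∈ D.weight M d) :
    f m ∈ D.weight N d := by
  rw [weight, Module.End.mem_maxGenEigenspace] at hm ⊢
  obtain ⟨k, hk⟩ := hm
  refine ⟨k, ?_⟩
  have e : ∀ (P : Type u) [AddCommGroup P] [Module D.H P] [Module ℂ P] [IsScalarTower ℂ D.H P]
      (p : P), ((Algebra.lsmul ℂ ℂ P D.eu - d • 1) ^ k) p =
        (D.eu - algebraMap ℂ D.H d) ^ k • p := fun P _ _ _ _ p => by
    have := congrArg (fun T : Module.End ℂ P => T p)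
      (map_pow (Algebra.lsmul ℂ ℂ P) (D.eu - algebraMap ℂ D.H d) k)
    rw [map_sub, AlgHom.commutes, Algebra.algebraMap_eq_smul_one] at this
    exact this.symm
  rw [e] at hk ⊢
  rw [← map_smul, hk, map_zero]

/-- An `H_c`-linear map is complex linear. -/
def toComplex (f : M →ₗ[D.H] N) : M →ₗ[ℂ] N where
  toFun := f
  map_add' := map_add f
  map_smul' a m := by
    rw [← algebraMap_smul D.H a m, map_smul, algebraMap_smul]
    rfl

/-- The map induced on `M / V* M`. -/
def coinvMap (f : M →ₗ[D.H] N) : M ⧸ D.dualSmul M →ₗ[ℂ] N ⧸ D.dualSmul N :=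
  Submodule.mapQ _ _ (toComplex f) (by
    conv_lhs => rw [dualSmul]
    rw [Submodule.span_le]
    rintro _ ⟨x, m, rfl⟩
    exact Submodule.subset_span ⟨x, f m, map_smul f _ _⟩)

/-- The map induced on the degree `d` part of `M / V* M`. -/
def coinvDegMap (f : M →ₗ[D.H] N) (d : ℂ) :
    (D.coinvRep M d).IntertwiningMap (D.coinvRep N d) where
  toLinearMap := (coinvMap f).restrict (by
    rintro _ ⟨m, hm, rfl⟩
    exact ⟨f m, weight_map f hm, rfl⟩)
  isIntertwining' w := by
    ext1 ⟨_, ⟨m, hm, rfl⟩⟩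
    apply Subtype.ext
    exact congrArg (D.dualSmul N).mkQ (map_smul f (D.grp w) m)

/-- The map induced on the degree `d` part of `H⁰(V, M)`. -/
def invDegMap (f : M →ₗ[D.H] N) (d : ℂ) :
    (D.invRep M d).IntertwiningMap (D.invRep N d) where
  toLinearMap := (toComplex f).restrict (fun m hm =>
    ⟨fun v => by
      change D.dun v • f m = 0
      rw [← map_smul, hm.1 v, map_zero], weight_map f hm.2⟩)
  isIntertwining' w := by
    ext1 m
    apply Subtype.ext
    exact map_smul f (D.grp w) m.1

end Modules

section Functors

open scoped ModuleCat

attribute [local instance] ModuleCat.isScalarTower_of_algebra_moduleCat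

variable [FiniteDimensional ℂ V] (D : Datum V)

/-- The category of `ℂ`-graded representations of `W` over the complex numbers: a graded
representation is a family of representations indexed by the degree `d : ℂ`. -/
abbrev Gr := Discrete ℂ ⥤ Rep.{u} ℂ D.W

/-- The functor `F(M) = H₀(V*, M) = M / V* M` from category `O_c` to graded representations. -/
def F : D.O ⥤ D.Gr where
  obj M := Discrete.functor fun d => Rep.of (D.coinvRep M.obj d)
  map f := Discrete.natTrans fun d => Rep.ofHom (coinvDegMap f.hom.hom d.as)
  map_id M := by
    ext1
    funext d
    apply Rep.hom_ext
    ext1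
    ext1 ⟨_, ⟨m, hm, rfl⟩⟩
    rfl
  map_comp f g := by
    ext1
    funext d
    apply Rep.hom_ext
    ext1
    ext1 ⟨_, ⟨m, hm, rfl⟩⟩
    rfl

instance : D.F.Additive where
  map_add {M N f g} := by
    ext1
    funext d
    apply Rep.hom_ext
    ext1
    ext1 ⟨_, ⟨m, hm, rfl⟩⟩
    rfl

/-- The functor `G(M) = H⁰(V, M)` from category `O_c` to graded representations. -/
def G : D.O ⥤ D.Gr where
  obj M := Discrete.functor fun d => Rep.of (D.invRep M.obj d)
  map f := Discrete.natTrans fun d => Rep.ofHom (invDegMap f.hom.hom d.as)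
  map_id M := by
    ext1
    funext d
    rfl
  map_comp f g := by
    ext1
    funext d
    rfl

instance : D.G.Additive where
  map_add {M N f g} := by
    ext1
    funext d
    rfl

end Functors

section GradedDual

variable (D : Datum V)

section ConjDual

variable {X Y : Type u} [AddCommGroup X] [Module ℂ X] [AddCommGroup Y] [Module ℂ Y]

/-- The conjugate linear dual of a representation: `(w φ)(x) = φ (w⁻¹ x)`. -/
def conjDual (ρ : Representation ℂ D.W X) :
    Representation ℂ D.W (X →ₛₗ[starRingEnd ℂ] ℂ) where
  toFun w :=
    { toFun φ := φ.comp (ρ w⁻¹)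
      map_add' _ _ := rfl
      map_smul' _ _ := rfl }
  map_one' := by
    ext φ x
    change φ (ρ 1⁻¹ x) = φ x
    rw [inv_one, map_one]
    rfl
  map_mul' w w' := by
    ext φ x
    change φ (ρ (w * w')⁻¹ x) = φ (ρ w'⁻¹ (ρ w⁻¹ x))
    rw [mul_inv_rev, map_mul]
    rfl

/-- The transpose of an equivariant map, on conjugate linear duals. -/
def conjDualMap {ρ : Representation ℂ D.W X} {ρ' : Representation ℂ D.W Y}
    (f : ρ.IntertwiningMap ρ') : (D.conjDual ρ').IntertwiningMap (D.conjDual ρ) where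
  toFun φ := φ.comp f.toLinearMap
  map_add' _ _ := rfl
  map_smul' _ _ := rfl
  isIntertwining' w := by
    ext φ x
    exact congrArg φ (LinearMap.congr_fun (f.isIntertwining' w⁻¹) x).symm

end ConjDual

/-- The duality on graded representations, `(N^∨)_d = (N_d)^∨`, where `∨` is the conjugate linear
dual on representations. -/
def grDual : D.Grᵒᵖ ⥤ D.Gr where
  obj N := Discrete.functor fun d => Rep.of (D.conjDual (N.unop.obj ⟨d⟩).ρ)
  map f := Discrete.natTrans fun d => Rep.ofHom (D.conjDualMap (f.unop.app d).hom)
  map_id N := by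
    ext1
    funext d
    rfl
  map_comp f g := by
    ext1
    funext d
    rfl

instance : D.grDual.Additive where
  map_add {M N f g} := by
    ext1
    funext d
    apply Rep.hom_ext
    ext1
    apply LinearMap.ext
    intro φ
    let φ' : (M.unop.obj ⟨d.as⟩) →ₛₗ[starRingEnd ℂ] ℂ := φ
    exact LinearMap.ext fun x => φ'.map_add _ _

variable {D}

lemma gr_exact_iff (S : ShortComplex D.Gr) : S.Exact ↔
    ∀ (d : Discrete ℂ) (y : S.X₂.obj d), (S.g.app d).hom y = 0 → ∃ x, (S.f.app d).hom x = y := by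
  have h1 : S.Exact ↔ ∀ d, (S.map ((evaluation _ _).obj d)).Exact := by
    simp only [ShortComplex.exact_iff_isZero_homology]
    constructor
    · intro h d
      exact ((evaluation _ _).obj d).map_isZero h |>.of_iso
        (S.mapHomologyIso ((evaluation _ _).obj d))
    · intro h
      exact Functor.isZero _ fun d => (h d).of_iso
        (S.mapHomologyIso ((evaluation _ _).obj d)).symm
  rw [h1]
  refine forall_congr' fun d => ?_
  rw [← ShortComplex.exact_map_iff_of_faithful _ (forget₂ (Rep.{u} ℂ D.W) (ModuleCat.{u} ℂ)),
    ShortComplex.moduleCat_exact_iff]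
  rfl

lemma exists_dual_lift {X Y Z : Type u} [AddCommGroup X] [Module ℂ X] [AddCommGroup Y] [Module ℂ Y]
    [AddCommGroup Z] [Module ℂ Z] (f : X →ₗ[ℂ] Y) (g : Y →ₗ[ℂ] Z)
    (h : ∀ y, g y = 0 → ∃ x, f x = y) (φ : Y →ₛₗ[starRingEnd ℂ] ℂ) (hφ : ∀ x, φ (f x) = 0) :
    ∃ ψ : Z →ₛₗ[starRingEnd ℂ] ℂ, ∀ y, ψ (g y) = φ y := by
  obtain ⟨s, hs⟩ := LinearMap.exists_rightInverse_of_surjective g.rangeRestrict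
    (LinearMap.range_rangeRestrict g)
  let κ : ℂ →ₛₗ[starRingEnd ℂ] ℂ :=
    { toFun := conj, map_add' := map_add _, map_smul' := map_mul _ }
  obtain ⟨ψ, hψ⟩ := LinearMap.exists_extend ((κ.comp φ : Y →ₗ[ℂ] ℂ) ∘ₗ s)
  refine ⟨κ.comp ψ, fun y => ?_⟩
  have h1 := LinearMap.congr_fun hψ (g.rangeRestrict y)
  have h2 : g (s (g.rangeRestrict y) - y) = 0 := by
    have := congrArg Subtype.val (LinearMap.congr_fun hs (g.rangeRestrict y))
    rw [map_sub, sub_eq_zero]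
    exact this
  obtain ⟨x, hx⟩ := h _ h2
  have h3 := hφ x
  rw [hx, map_sub, sub_eq_zero] at h3
  have h4 : ψ (g y) = conj (φ (s (g.rangeRestrict y))) := h1
  change conj (ψ (g y)) = φ y
  rw [h4, h3, Complex.conj_conj]

lemma grDual_exact (S : ShortComplex D.Grᵒᵖ) (hS : S.Exact) : (S.map D.grDual).Exact := by
  rw [← ShortComplex.exact_unop_iff, gr_exact_iff] at hS
  rw [gr_exact_iff]
  intro d φ hφ
  obtain ⟨ψ, hψ⟩ := exists_dual_lift (S.unop.f.app d).hom.toLinearMap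
    (S.unop.g.app d).hom.toLinearMap (hS d) φ (fun x => LinearMap.congr_fun hφ x)
  exact ⟨ψ, LinearMap.ext hψ⟩

/-- The duality on graded representations is exact. -/
instance : PreservesFiniteLimits D.grDual :=
  ((D.grDual.exact_tfae.out 1 3 rfl rfl).1 grDual_exact).1

instance : PreservesFiniteColimits D.grDual :=
  ((D.grDual.exact_tfae.out 1 3 rfl rfl).1 grDual_exact).2

end GradedDual

section Duality

/-- A conjugate linear `W`-equivariant isomorphism from `V` to its dual `V*`, which is Hermitian: the
sesquilinear form `(u, v) ↦ ⟨J u, v⟩` satisfies `⟨J u, v⟩ = conj ⟨J v, u⟩`. -/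
structure HermitianIso (D : Datum V) where
  /-- the isomorphism -/
  toEquiv : V ≃ₛₗ[starRingEnd ℂ] Module.Dual ℂ V
  equivariant : ∀ (w : D.W) (u v : V), toEquiv (w.1 u) v = toEquiv u (w⁻¹.1 v)
  hermitian : ∀ u v : V, toEquiv u v = conj (toEquiv v u)

/-- The conjugate linear anti-automorphism `h ↦ h̄` of `H_c` given by `w ↦ w⁻¹` on the group, and
exchanging the Dunkl operator of `v` with the linear form `J v`, for `v ∈ V`. -/
structure Bar {D : Datum V} (J : HermitianIso D) where
  /-- the map -/
  toFun : D.H → D.H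
  bijective : Function.Bijective toFun
  map_add : ∀ a b, toFun (a + b) = toFun a + toFun b
  map_mul : ∀ a b, toFun (a * b) = toFun b * toFun a
  map_smul : ∀ (a : ℂ) (h : D.H), toFun (a • h) = conj a • toFun h
  map_grp : ∀ w : D.W, toFun (D.grp w) = D.grp w⁻¹
  map_dun : ∀ v : V, toFun (D.dun v) = D.pol (linPoly (J.toEquiv v))
  map_pol : ∀ v : V, toFun (D.pol (linPoly (J.toEquiv v))) = D.dun v

lemma Bar.map_one {D : Datum V} {J : HermitianIso D} (σ : Bar J) : σ.toFun 1 = 1 := by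
  have h := σ.map_grp 1
  rwa [inv_one, _root_.map_one] at h

variable [FiniteDimensional ℂ V] {D : Datum V}

/-- The restricted conjugate linear dual of `M`: the conjugate linear forms which are non-zero on
only finitely many of the weight spaces `M_d`. When `M` is the direct sum of its weight spaces, this
is the direct sum of the conjugate linear duals of the `M_d`. -/
def restrictedDual (D : Datum V) (M : Type u) [AddCommGroup M] [Module D.H M] [Module ℂ M]
    [IsScalarTower ℂ D.H M] : Submodule ℂ (M →ₛₗ[starRingEnd ℂ] ℂ) where
  carrier := {φ | {d : ℂ | ∃ m ∈ D.weight M d, φ m ≠ 0}.Finite}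
  zero_mem' := by
    refine Set.Finite.subset Set.finite_empty ?_
    rintro d ⟨m, -, hm⟩
    exact hm rfl
  add_mem' {φ ψ} h1 h2 := by
    refine (Set.Finite.union h1 h2).subset ?_
    rintro d ⟨m, hm, hne⟩
    by_cases h : φ m = 0
    · refine Or.inr ⟨m, hm, fun h' => hne ?_⟩
      rw [LinearMap.add_apply, h, h', add_zero]
    · exact Or.inl ⟨m, hm, h⟩
  smul_mem' a φ h := by
    refine Set.Finite.subset h ?_
    rintro d ⟨m, hm, hne⟩
    exact ⟨m, hm, fun h' => hne (by rw [LinearMap.smul_apply, h', smul_zero])⟩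

section

variable {M : Type u} [AddCommGroup M] [Module D.H M] [Module ℂ M] [IsScalarTower ℂ D.H M]

/-- The transpose of the action of `h` on `M`. -/
def transpose (h : D.H) (φ : M →ₛₗ[starRingEnd ℂ] ℂ) : M →ₛₗ[starRingEnd ℂ] ℂ :=
  φ.comp (Algebra.lsmul ℂ ℂ M h)

lemma transpose_apply (h : D.H) (φ : M →ₛₗ[starRingEnd ℂ] ℂ) (m : M) :
    transpose h φ m = φ (h • m) := rfl

lemma transpose_shift {h : D.H} {a : ℂ}
    (hh : ∀ d, ∀ m ∈ D.weight M d, h • m ∈ D.weight M (d + a)) {φ : M →ₛₗ[starRingEnd ℂ] ℂ}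
    (hφ : φ ∈ D.restrictedDual M) : transpose h φ ∈ D.restrictedDual M := by
  refine Set.Finite.subset (Set.Finite.preimage (f := fun d => d + a)
    (add_left_injective a).injOn hφ) ?_
  rintro d ⟨m, hm, hne⟩
  exact ⟨h • m, hh d m hm, hne⟩

lemma transpose_mem (h : D.H) {φ : M →ₛₗ[starRingEnd ℂ] ℂ} (hφ : φ ∈ D.restrictedDual M) :
    transpose h φ ∈ D.restrictedDual M := by
  have hadd : ∀ a b : D.H, (∀ φ ∈ D.restrictedDual M, transpose a φ ∈ D.restrictedDual M) →
      (∀ φ ∈ D.restrictedDual M, transpose b φ ∈ D.restrictedDual M) →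
      ∀ φ ∈ D.restrictedDual M, transpose (a + b) φ ∈ D.restrictedDual M := by
    intro a b ha hb φ hφ
    convert! add_mem (ha φ hφ) (hb φ hφ) using 1
    ext1 m
    rw [LinearMap.add_apply, transpose_apply, add_smul, map_add]
    rfl
  have hmul : ∀ a b : D.H, (∀ φ ∈ D.restrictedDual M, transpose a φ ∈ D.restrictedDual M) →
      (∀ φ ∈ D.restrictedDual M, transpose b φ ∈ D.restrictedDual M) →
      ∀ φ ∈ D.restrictedDual M, transpose (a * b) φ ∈ D.restrictedDual M := by
    intro a b ha hb φ hφ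
    convert! hb _ (ha φ hφ) using 1
    ext1 m
    rw [transpose_apply, mul_smul]
    rfl
  have hs : ∀ a : ℂ, ∀ φ ∈ D.restrictedDual M,
      transpose (algebraMap ℂ D.H a) φ ∈ D.restrictedDual M := fun a φ hφ =>
    transpose_shift (a := 0) (fun d m hm => by
      rw [algebraMap_smul, add_zero]
      exact Submodule.smul_mem _ a hm) hφ
  revert φ
  induction h using D.H_induction with
  | hg w =>
    intro φ hφ
    exact transpose_shift (a := 0) (fun d m hm => by
      rw [add_zero]
      exact weight_grp w hm) hφ
  | hp f =>
    induction f using Pol.ind with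
    | hlin l =>
      intro φ hφ
      exact transpose_shift (fun d m hm => weight_pol l hm) hφ
    | hconst a =>
      intro φ hφ
      rw [AlgHom.commutes]
      exact hs a φ hφ
    | hadd f g h1 h2 =>
      rw [map_add]
      exact fun {φ} => hadd _ _ (fun _ => h1) (fun _ => h2) φ
    | hmul f g h1 h2 =>
      rw [map_mul]
      exact fun {φ} => hmul _ _ (fun _ => h1) (fun _ => h2) φ
  | hd v =>
    intro φ hφ
    exact transpose_shift (fun d m hm => weight_dun v hm) hφ
  | hs a => exact fun {φ} => hs a φ
  | hadd a b h1 h2 => exact fun {φ} => hadd a b (fun _ => h1) (fun _ => h2) φ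
  | hmul a b h1 h2 => exact fun {φ} => hmul a b (fun _ => h1) (fun _ => h2) φ

/-- The `H_c`-module structure `(h φ)(m) = φ (h̄ m)` on the restricted dual. -/
abbrev dualModule {J : HermitianIso D} (σ : Bar J) (M : Type u) [AddCommGroup M] [Module D.H M]
    [Module ℂ M] [IsScalarTower ℂ D.H M] : Module D.H (D.restrictedDual M) where
  smul h φ := ⟨transpose (σ.toFun h) φ.1, transpose_mem _ φ.2⟩
  one_smul φ := by
    apply Subtype.ext
    ext1 m
    change φ.1 (σ.toFun 1 • m) = φ.1 m
    rw [σ.map_one, one_smul]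
  mul_smul a b φ := by
    apply Subtype.ext
    ext1 m
    change φ.1 (σ.toFun (a * b) • m) = φ.1 (σ.toFun b • σ.toFun a • m)
    rw [σ.map_mul, mul_smul]
  smul_zero _ := rfl
  smul_add _ _ _ := rfl
  add_smul a b φ := by
    apply Subtype.ext
    ext1 m
    change φ.1 (σ.toFun (a + b) • m) = φ.1 (σ.toFun a • m) + φ.1 (σ.toFun b • m)
    rw [σ.map_add, add_smul, map_add]
  zero_smul φ := by
    apply Subtype.ext
    ext1 m
    change φ.1 (σ.toFun 0 • m) = 0
    have h := σ.map_smul 0 0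
    rw [map_zero, zero_smul, zero_smul] at h
    rw [h, zero_smul, map_zero]

end

open scoped ModuleCat

attribute [local instance] ModuleCat.isScalarTower_of_algebra_moduleCat

variable {J : HermitianIso D} (σ : Bar J)

/-- The contravariant functor `M ↦ M^∨` on `H_c`-modules, where `M^∨` is the restricted conjugate
linear dual with `(h φ)(m) = φ (h̄ m)`. -/
def dual : (ModuleCat.{u} D.H)ᵒᵖ ⥤ ModuleCat.{u} D.H where
  obj M := @ModuleCat.of D.H _ (D.restrictedDual M.unop) _ (dualModule σ M.unop)
  map {M N} f :=
    letI := dualModule σ M.unop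
    letI := dualModule σ N.unop
    ModuleCat.ofHom
      { toFun := fun φ => ⟨φ.1.comp (toComplex f.unop.hom), φ.2.subset (by
          rintro d ⟨m, hm, hne⟩
          exact ⟨f.unop.hom m, weight_map _ hm, hne⟩)⟩
        map_add' := fun _ _ => rfl
        map_smul' := fun h φ => by
          apply Subtype.ext
          ext1 m
          exact congrArg φ.1 (map_smul f.unop.hom (σ.toFun h) m).symm }
  map_id _ := rfl
  map_comp _ _ := rfl

instance : (dual σ).Additive where
  map_add {M N f g} := by
    apply ModuleCat.hom_ext
    apply LinearMap.ext
    intro φ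
    apply Subtype.ext
    apply LinearMap.ext
    intro m
    exact map_add φ.1 _ _

/-- The duality `M ↦ M^∨` on category `O_c`, given that it preserves `O_c`. -/
def dualO (hO : ∀ M : D.O, D.isO ((dual σ).obj (Opposite.op M.obj))) : D.Oᵒᵖ ⥤ D.O :=
  D.isO.lift (D.isO.ι.op ⋙ dual σ) fun M => hO M.unop

instance (hO : ∀ M : D.O, D.isO ((dual σ).obj (Opposite.op M.obj))) :
    (dualO σ hO).Additive where
  map_add {M N f g} := by
    apply ObjectProperty.hom_ext
    exact (dual σ).map_add (f := f.unop.hom.op) (g := g.unop.hom.op)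

end Duality

end Datum

section Derived

universe v₁ v₂ u₁ u₂ w₁ w₂ w₁' w₂'

variable (A : Type u₁) [Category.{v₁} A] [Abelian A]
variable {B : Type u₂} [Category.{v₂} B] [Abelian B]

/-- The bounded above derived category `D⁻(A)`, as the opposite of the bounded below derived category
of the opposite of `A`. -/
abbrev DMinus [HasDerivedCategory.{w₁} Aᵒᵖ] := (DerivedCategory.Plus Aᵒᵖ)ᵒᵖ

/-- The functor `A ⥤ D⁻(A)` sending an object to the complex concentrated in degree `0`. -/
def singleMinus [HasDerivedCategory.{w₁} Aᵒᵖ] : A ⥤ DMinus A :=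
  (DerivedCategory.Plus.singleFunctor Aᵒᵖ 0).rightOp

variable {A}

/-- The left derived functor `LΦ : D⁻(A) ⥤ D⁻(B)` of an additive functor `Φ : A ⥤ B`, where `A` has
enough projectives: it is the opposite of the right derived functor of `Φᵒᵖ`. -/
def leftDerived [HasDerivedCategory.{w₁} Aᵒᵖ] [HasDerivedCategory.{w₂} Bᵒᵖ]
    [EnoughProjectives A] (Φ : A ⥤ B) [Φ.Additive] : DMinus A ⥤ DMinus B :=
  Φ.op.rightDerivedFunctorPlus.op

lemma mapDerivedCategory_plus [HasDerivedCategory.{w₁} A] [HasDerivedCategory.{w₂} B] (Φ : A ⥤ B)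
    [Φ.Additive] [PreservesFiniteLimits Φ] [PreservesFiniteColimits Φ]
    (X : DerivedCategory.Plus A) :
    (DerivedCategory.TStructure.t (C := B)).plus
      (Φ.mapDerivedCategory.obj (DerivedCategory.Plus.ι.obj X)) := by
  let Y := DerivedCategory.Plus.Qh.objPreimage X
  let e : DerivedCategory.Plus.Qh.obj Y ≅ X := DerivedCategory.Plus.Qh.objObjPreimageIso X
  refine ObjectProperty.prop_of_iso _ ?_
    (DerivedCategory.Plus.Qh.obj (Φ.mapHomotopyCategoryPlus.obj Y)).property
  exact (Φ.mapDerivedCategoryFactorsh.app Y.obj).symm ≪≫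
    Φ.mapDerivedCategory.mapIso (DerivedCategory.Plus.ι.mapIso e)

/-- The functor `D⁺(A) ⥤ D⁺(B)` induced by an exact functor `Φ : A ⥤ B`. -/
def exactPlus [HasDerivedCategory.{w₁} A] [HasDerivedCategory.{w₂} B] (Φ : A ⥤ B)
    [Φ.Additive] [PreservesFiniteLimits Φ] [PreservesFiniteColimits Φ] :
    DerivedCategory.Plus A ⥤ DerivedCategory.Plus B :=
  ObjectProperty.lift _ (DerivedCategory.Plus.ι ⋙ Φ.mapDerivedCategory) (mapDerivedCategory_plus Φ)

/-- The contravariant functor from `D⁻(A)` to `D⁺(B)` induced by an exact contravariant functor `Φ`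
from `A` to `B`. -/
def exactContra [HasDerivedCategory.{w₁} Aᵒᵖ] [HasDerivedCategory.{w₂} B] (Φ : Aᵒᵖ ⥤ B)
    [Φ.Additive] [PreservesFiniteLimits Φ] [PreservesFiniteColimits Φ] :
    (DMinus A)ᵒᵖ ⥤ DerivedCategory.Plus B :=
  unopUnop _ ⋙ exactPlus Φ

end Derived

end Cherednik

end

open Cherednik

/-! The algebra H_c is given as an algebra of operators, so an anti-automorphism can be prescribed
on generators only once their relations are known to be complete. The relations collected in `Rels`
make the ordered monomials x^a w D^b span (`Rels.adjoin_le_span`). These monomials are linearly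
independent (`linearIndependent_pbw`): on functions vanishing to high order along a free W-orbit, a
Dunkl operator agrees to leading order with a partial derivative, because the divided differences
divide only by linear forms that are units along the orbit. Suitable test functions then isolate one
monomial. So H_c is presented by its relations (`exists_lift`), and these are symmetric under the
exchange of x and D because the parameters satisfy c(r⁻¹) = conj c(r) and the form is Hermitian.
This gives the anti-automorphism (`exists_bar`).

Write eu = ∑ x_i D_i + z with z = ∑ c_r (1 - r). On the regular representation z is self-adjoint,
hence it is annihilated by a polynomial with real roots (`exists_roots`). Induction on the number of
Dunkl operators needed to kill an element shows that a module with locally nilpotent Dunkl operators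
is the sum of its weight spaces, with weights in (roots of z) + ℕ (`LocNilp.wtSum_eq_top`). These
weights are real and bounded below. By the monomial basis, the weight spaces of a finitely generated
such module are finite-dimensional.

The anti-automorphism fixes eu (`Bar.map_eu`) and weights are real, so the dual of M_d is the weight
space of M^∨ for the same d. Local nilpotency on M^∨ holds because a form sees finitely many weights
and weights are bounded below. Finite generation holds because, for d not a root, the Dunkl
operators have no common kernel on M_d; dually, the part of M^∨ of weight d comes from weight d - 1
by multiplication by linear forms. Exactness is linear algebra in each weight.

Since weights are bounded below uniformly in M, the exact functor M ↦ M_d is represented on category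
O by a cyclic module (`projO`), whence enough projectives. The bijection between maps P → M^∨ and
maps M → P^∨ turns projectives into injectives (`injective_dualO`).

Finally D_v φ = 0 means that φ vanishes on (J v) M, so the dual of M / V* M is H⁰(V, M^∨)
(`coinvDualIso`). The derived statement is then formal: LF is the opposite of the right derived
functor of the opposite of F, composition with exact functors is compatible with deriving, and the
duality sends projectives to injectives (`derivedDuality`). -/

noncomputable section

namespace Cherednik

/-! ### Monomials in commuting families. -/

section Monomial

variable {ι A B : Type*} [Monoid A] [Monoid B]

/-- The product of the values of a commuting family over a multiset of indices. -/
def mon (a : ι → A) (h : ∀ i j, a i * a j = a j * a i) (s : Multiset ι) : A :=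
  haveI : LeftCommutative fun i x => a i * x := ⟨fun i j x => by
    rw [← mul_assoc, h, mul_assoc]⟩
  s.foldr (fun i x => a i * x) 1

variable {a : ι → A} {h : ∀ i j, a i * a j = a j * a i}

@[simp] lemma mon_zero : mon a h 0 = 1 := rfl

@[simp] lemma mon_cons (i : ι) (s : Multiset ι) : mon a h (i ::ₘ s) = a i * mon a h s :=
  haveI : LeftCommutative fun i x => a i * x := ⟨fun i j x => by
    rw [← mul_assoc, h, mul_assoc]⟩
  Multiset.foldr_cons _ _ _ _

lemma map_mon (f : A →* B) (s : Multiset ι) :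
    f (mon a h s) = mon (fun i => f (a i)) (fun i j => by rw [← map_mul, h, map_mul]) s := by
  induction s using Multiset.induction_on with
  | empty => simp
  | cons i s ih => simp [ih]

/-- Commutation allows the new factor to be placed on the right; for operators this means that it
acts first, which suits inductions on the function it is applied to. -/
lemma mon_cons' (i : ι) (s : Multiset ι) : mon a h (i ::ₘ s) = mon a h s * a i := by
  rw [mon_cons]
  induction s using Multiset.induction_on with
  | empty => simp
  | cons j s ih => rw [mon_cons, ← mul_assoc, h, mul_assoc, ih, mul_assoc]

end Monomial

/-! ### The defining relations and the spanning set of ordered monomials. -/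

namespace Datum

variable {V : Type u} [AddCommGroup V] [Module ℂ V]

/-- Elements of an algebra satisfying the defining relations of the rational Cherednik algebra. -/
structure Rels (D : Datum V) (A : Type*) [Ring A] [Algebra ℂ A] where
  /-- the images of the linear forms -/
  X : Module.Dual ℂ V →ₗ[ℂ] A
  /-- the images of the Dunkl operators -/
  Y : V →ₗ[ℂ] A
  /-- the images of the group elements -/
  g : D.W →* A
  X_comm : ∀ l m, X l * X m = X m * X l
  Y_comm : ∀ u v, Y u * Y v = Y v * Y u
  g_X : ∀ w l, g w * X l = X (l ∘ₗ (w.1⁻¹ : V ≃ₗ[ℂ] V).toLinearMap) * g w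
  Y_g : ∀ v w, Y v * g w = g w * Y (w⁻¹.1 v)
  -- The scalar l(v) - l(r⁻¹ v) equals α_r(v) times the constant (l - r l) / α_r
  -- (`divDiff_linPoly`). In this form the choice of α_r disappears, and the behaviour under the
  -- Hermitian form becomes visible.
  Y_X : ∀ v l, Y v * X l = X l * Y v + algebraMap ℂ A (l v) -
    ∑ r : D.R, (D.c r.1 * (l v - l (r.1⁻¹.1 v))) • g r.1

namespace Rels

variable {D : Datum V} {A B : Type*} [Ring A] [Algebra ℂ A] [Ring B] [Algebra ℂ B]

/-- The pairs of elements satisfying the relations. -/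
def prod (P : Rels D A) (Q : Rels D B) : Rels D (A × B) where
  X := P.X.prod Q.X
  Y := P.Y.prod Q.Y
  g := P.g.prod Q.g
  X_comm l m := Prod.ext (P.X_comm l m) (Q.X_comm l m)
  Y_comm l m := Prod.ext (P.Y_comm l m) (Q.Y_comm l m)
  g_X w l := Prod.ext (P.g_X w l) (Q.g_X w l)
  Y_g v w := Prod.ext (P.Y_g v w) (Q.Y_g v w)
  Y_X v l := Prod.ext (by simpa [Prod.fst_sum] using! P.Y_X v l)
    (by simpa [Prod.snd_sum] using! Q.Y_X v l)

/-- The set of generators. -/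
def gens (P : Rels D A) : Set A := Set.range P.X ∪ Set.range P.g ∪ Set.range P.Y

variable [FiniteDimensional ℂ V]

/-- The monomials in the coordinate functions. -/
def monX (P : Rels D A) : Multiset (Fin (Module.finrank ℂ V)) → A :=
  mon (fun i => P.X ((Module.finBasis ℂ V).coord i)) (fun _ _ => P.X_comm _ _)

/-- The monomials in the Dunkl operators of the basis vectors. -/
def monY (P : Rels D A) : Multiset (Fin (Module.finrank ℂ V)) → A :=
  mon (fun i => P.Y (Module.finBasis ℂ V i)) (fun _ _ => P.Y_comm _ _)

variable (V) in
/-- The index set of the Poincaré-Birkhoff-Witt basis. -/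
abbrev Idx (D : Datum V) : Type u := Multiset (Fin (Module.finrank ℂ V)) × D.W ×
  Multiset (Fin (Module.finrank ℂ V))

/-- The ordered monomials. -/
def pbw (P : Rels D A) (i : Idx V D) : A := P.monX i.1 * P.g i.2.1 * P.monY i.2.2

lemma map_pbw (P : Rels D A) (Q : Rels D B) (f : A →ₐ[ℂ] B) (hX : ∀ l, f (P.X l) = Q.X l)
    (hY : ∀ v, f (P.Y v) = Q.Y v) (hg : ∀ w, f (P.g w) = Q.g w) (i : Idx V D) :
    f (P.pbw i) = Q.pbw i := by
  have h1 : f (P.monX i.1) = Q.monX i.1 := by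
    refine (map_mon (f : A →* B) i.1).trans ?_
    simp only [MonoidHom.coe_coe, hX]
    rfl
  have h2 : f (P.monY i.2.2) = Q.monY i.2.2 := by
    refine (map_mon (f : A →* B) i.2.2).trans ?_
    simp only [MonoidHom.coe_coe, hY]
    rfl
  rw [pbw, map_mul, map_mul, h1, h2, hg, pbw]

variable (P : Rels D A)

lemma X_eq_sum (l : Module.Dual ℂ V) :
    P.X l = ∑ i, l (Module.finBasis ℂ V i) • P.X ((Module.finBasis ℂ V).coord i) := by
  conv_lhs => rw [← (Module.finBasis ℂ V).sum_dual_apply_smul_coord l]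
  simp only [map_sum, map_smul]

lemma Y_eq_sum (v : V) :
    P.Y v = ∑ i, (Module.finBasis ℂ V).repr v i • P.Y (Module.finBasis ℂ V i) := by
  conv_lhs => rw [← (Module.finBasis ℂ V).sum_repr v]
  simp only [map_sum, map_smul]

lemma X_mul_mem (l : Module.Dual ℂ V) {m : A} (hm : m ∈ Submodule.span ℂ (Set.range P.pbw)) :
    P.X l * m ∈ Submodule.span ℂ (Set.range P.pbw) := by
  induction hm using Submodule.span_induction with
  | zero => rw [mul_zero]; exact zero_mem _
  | add x y _ _ h1 h2 => rw [mul_add]; exact add_mem h1 h2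
  | smul a x _ h1 => rw [mul_smul_comm]; exact Submodule.smul_mem _ _ h1
  | mem x hx =>
    obtain ⟨⟨t, w, s⟩, rfl⟩ := hx
    rw [X_eq_sum, Finset.sum_mul]
    refine sum_mem fun i _ => ?_
    rw [smul_mul_assoc]
    refine Submodule.smul_mem _ _ (Submodule.subset_span ⟨⟨i ::ₘ t, w, s⟩, ?_⟩)
    simp [pbw, monX, mul_assoc]

lemma g_mul_mem (u : D.W) {m : A} (hm : m ∈ Submodule.span ℂ (Set.range P.pbw)) :
    P.g u * m ∈ Submodule.span ℂ (Set.range P.pbw) := by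
  induction hm using Submodule.span_induction with
  | zero => rw [mul_zero]; exact zero_mem _
  | add x y _ _ h1 h2 => rw [mul_add]; exact add_mem h1 h2
  | smul a x _ h1 => rw [mul_smul_comm]; exact Submodule.smul_mem _ _ h1
  | mem x hx =>
    obtain ⟨⟨t, w, s⟩, rfl⟩ := hx
    induction t using Multiset.induction_on with
    | empty => exact Submodule.subset_span ⟨⟨0, u * w, s⟩, by simp [pbw, monX, mul_assoc]⟩
    | cons i t ih =>
      have : P.g u * P.pbw (i ::ₘ t, w, s) = P.X ((Module.finBasis ℂ V).coord i ∘ₗ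
          (u.1⁻¹ : V ≃ₗ[ℂ] V).toLinearMap) * (P.g u * P.pbw (t, w, s)) := by
        rw [← mul_assoc, ← P.g_X u ((Module.finBasis ℂ V).coord i)]
        simp [pbw, monX, mul_assoc]
      rw [this]
      exact P.X_mul_mem _ ih

/-- Moving a Dunkl operator past one linear form produces, besides the reordered product, only group
elements times the shorter monomial, so induction on the polynomial part applies. Once no linear
form is left, the operator passes the group element and joins the Dunkl monomial. -/
lemma Y_mul_mem (v : V) {m : A} (hm : m ∈ Submodule.span ℂ (Set.range P.pbw)) :
    P.Y v * m ∈ Submodule.span ℂ (Set.range P.pbw) := by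
  induction hm using Submodule.span_induction with
  | zero => rw [mul_zero]; exact zero_mem _
  | add x y _ _ h1 h2 => rw [mul_add]; exact add_mem h1 h2
  | smul a x _ h1 => rw [mul_smul_comm]; exact Submodule.smul_mem _ _ h1
  | mem x hx =>
    obtain ⟨⟨t, w, s⟩, rfl⟩ := hx
    induction t using Multiset.induction_on with
    | empty =>
      have : P.Y v * P.pbw (0, w, s) = P.g w * P.Y (w⁻¹.1 v) * P.monY s := by
        rw [← P.Y_g]
        simp [pbw, monX, mul_assoc]
      rw [this, Y_eq_sum, Finset.mul_sum, Finset.sum_mul]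
      refine sum_mem fun i _ => ?_
      rw [mul_smul_comm, smul_mul_assoc]
      refine Submodule.smul_mem _ _ (Submodule.subset_span ⟨⟨0, w, i ::ₘ s⟩, ?_⟩)
      simp [pbw, monX, monY, mul_assoc]
    | cons i t ih =>
      have : P.pbw (i ::ₘ t, w, s) = P.X ((Module.finBasis ℂ V).coord i) * P.pbw (t, w, s) := by
        simp [pbw, monX, mul_assoc]
      rw [this, ← mul_assoc, P.Y_X, sub_mul, add_mul, Finset.sum_mul, mul_assoc,
        ← Algebra.smul_def]
      refine sub_mem (add_mem (P.X_mul_mem _ ih)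
        (Submodule.smul_mem _ _ (Submodule.subset_span ⟨_, rfl⟩))) (sum_mem fun r _ => ?_)
      rw [smul_mul_assoc]
      exact Submodule.smul_mem _ _ (P.g_mul_mem _ (Submodule.subset_span ⟨_, rfl⟩))

/-- The subalgebra generated by elements satisfying the relations is spanned by the ordered
monomials. -/
lemma adjoin_le_span :
    (Algebra.adjoin ℂ P.gens).toSubmodule ≤ Submodule.span ℂ (Set.range P.pbw) := by
  have key : ∀ a ∈ Algebra.adjoin ℂ P.gens, ∀ m ∈ Submodule.span ℂ (Set.range P.pbw),
      a * m ∈ Submodule.span ℂ (Set.range P.pbw) := by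
    intro a ha
    induction ha using Algebra.adjoin_induction with
    | mem x hx =>
      rcases hx with (⟨l, rfl⟩ | ⟨w, rfl⟩) | ⟨v, rfl⟩
      exacts [fun m => P.X_mul_mem l, fun m => P.g_mul_mem w, fun m => P.Y_mul_mem v]
    | algebraMap r =>
      intro m hm
      rw [← Algebra.smul_def]
      exact Submodule.smul_mem _ _ hm
    | add x y _ _ hx hy =>
      intro m hm
      rw [add_mul]
      exact add_mem (hx m hm) (hy m hm)
    | mul x y _ _ hx hy =>
      intro m hm
      rw [mul_assoc]
      exact hx _ (hy m hm)
  intro a ha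
  have := key a ha 1 (Submodule.subset_span ⟨⟨0, 1, 0⟩, by simp [pbw, monX, monY]⟩)
  rwa [mul_one] at this

end Rels

variable (D : Datum V)

/-- Both l - r l and α_r are linear forms, and the first vanishes on the hyperplane of the second,
so their quotient is a constant. -/
lemma divDiff_linPoly (l : Module.Dual ℂ V) (r : D.R) : ∃ k : ℂ,
    divDiff r (linPoly l) = algebraMap ℂ _ k ∧ ∀ v, D.α r.1 v * k = l v - l (r.1⁻¹.1 v) := by
  obtain ⟨k, hk⟩ := exists_coeff (D.α r.1) l r.1.1 (fun x hx => (r.ker_iff x).1 hx)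
  refine ⟨k, divDiff_eq r ?_, fun v => ?_⟩
  · rw [polyAction_linPoly, mul_comm, ← Algebra.smul_def]
    apply Pol.ext
    funext x
    exact LinearMap.congr_fun hk x
  · rw [mul_comm]
    exact LinearMap.congr_fun hk v

/-- The defining relations of the rational Cherednik algebra. -/
def rels : Rels D D.H where
  X := { toFun l := D.pol (linPoly l)
         map_add' l m := map_add D.pol (linPoly l) (linPoly m)
         map_smul' a l := map_smul D.pol a (linPoly l) }
  Y := D.dun
  g := D.grp
  X_comm l m := by
    change D.pol _ * D.pol _ = D.pol _ * D.pol _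
    rw [← map_mul, mul_comm, map_mul]
  Y_comm := dun_comm
  g_X w l := grp_pol w (linPoly l)
  Y_g v w := dun_grp w v
  Y_X v l := by
    change D.dun v * D.pol _ = D.pol _ * D.dun v + _ - _
    rw [dun_pol, partialDeriv_linPoly, AlgHom.commutes]
    congr 1
    refine Finset.sum_congr rfl fun r _ => ?_
    obtain ⟨k, hk, h⟩ := divDiff_linPoly D l r
    rw [hk, AlgHom.commutes, ← Algebra.smul_def, smul_smul, mul_assoc, h]

lemma adjoin_gens : Algebra.adjoin ℂ D.rels.gens = ⊤ := by
  rw [eq_top_iff]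
  rintro h -
  induction h using D.H_induction with
  | hg w => exact Algebra.subset_adjoin (Or.inl (Or.inr ⟨w, rfl⟩))
  | hp f =>
    induction f using Pol.ind with
    | hlin l => exact Algebra.subset_adjoin (Or.inl (Or.inl ⟨l, rfl⟩))
    | hconst a => rw [AlgHom.commutes]; exact algebraMap_mem _ a
    | hadd f g hf hg => rw [map_add]; exact add_mem hf hg
    | hmul f g hf hg => rw [map_mul]; exact mul_mem hf hg
  | hd v => exact Algebra.subset_adjoin (Or.inr ⟨v, rfl⟩)
  | hs a => exact algebraMap_mem _ a
  | hadd a b ha hb => exact add_mem ha hb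
  | hmul a b ha hb => exact mul_mem ha hb

/-- The rational Cherednik algebra is spanned by the ordered monomials. -/
lemma span_pbw [FiniteDimensional ℂ V] : Submodule.span ℂ (Set.range D.rels.pbw) = ⊤ := by
  rw [eq_top_iff, ← Algebra.top_toSubmodule, ← adjoin_gens]
  exact D.rels.adjoin_le_span

end Datum

/-! ### Orders of vanishing, interpolation and partial derivatives. -/

section VanishingIdeals

variable {V : Type u} [AddCommGroup V] [Module ℂ V]

/-- Evaluation of polynomial functions at a point. -/
def evalAt (p : V) : Pol V →ₐ[ℂ] ℂ where
  toFun f := f p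
  map_one' := rfl
  map_mul' _ _ := rfl
  map_zero' := rfl
  map_add' _ _ := rfl
  commutes' _ := rfl

@[simp] lemma evalAt_apply (p : V) (f : Pol V) : evalAt p f = f p := rfl

/-- The ideal of the polynomials vanishing on a set. -/
def vanishOn (S : Set V) : Ideal (Pol V) := ⨅ p ∈ S, RingHom.ker (evalAt p)

lemma mem_vanishOn {S : Set V} {f : Pol V} : f ∈ vanishOn S ↔ ∀ p ∈ S, f p = 0 := by
  simp [vanishOn, Submodule.mem_iInf, RingHom.mem_ker]

lemma partialDeriv_comm (u v : V) :
    (partialDeriv u * partialDeriv v : Module.End ℂ (Pol V)) = partialDeriv v * partialDeriv u := by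
  ext1 f
  simp only [Module.End.mul_apply]
  induction f using Pol.ind with
  | hlin l => simp [partialDeriv_linPoly, partialDeriv_algebraMap]
  | hconst a => simp [partialDeriv_algebraMap]
  | hadd f g hf hg => simp only [map_add, hf, hg]
  | hmul f g hf hg =>
    simp only [partialDeriv_mul, map_add]
    linear_combination g * hf + f * hg

/-- By the Leibniz rule a derivation lowers the order of vanishing by at most one. -/
lemma partialDeriv_mem_pow (I : Ideal (Pol V)) (v : V) {k : ℕ} {f : Pol V} (hf : f ∈ I ^ (k + 1)) :
    partialDeriv v f ∈ I ^ k := by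
  induction k generalizing f with
  | zero => simp
  | succ k ih =>
    rw [pow_succ] at hf
    induction hf using Submodule.mul_induction_on' with
    | mem_mul_mem a ha b hb =>
      rw [partialDeriv_mul]
      refine add_mem ?_ (Ideal.mul_mem_right _ _ ha)
      rw [pow_succ]
      exact Ideal.mul_mem_mul (ih ha) hb
    | add x _ y _ hx hy => rw [map_add]; exact add_mem hx hy

lemma polyAction_mem_pow (I : Ideal (Pol V)) (w : V ≃ₗ[ℂ] V)
    (hI : ∀ f ∈ I, polyAction w f ∈ I) {k : ℕ} {f : Pol V} (hf : f ∈ I ^ k) :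
    polyAction w f ∈ I ^ k := by
  induction k generalizing f with
  | zero => simp
  | succ k ih =>
    rw [pow_succ] at hf
    induction hf using Submodule.mul_induction_on' with
    | mem_mul_mem a ha b hb =>
      rw [polyAction_mul_apply, pow_succ]
      exact Ideal.mul_mem_mul (ih ha) (hI b hb)
    | add x _ y _ hx hy => rw [map_add]; exact add_mem hx hy

/-- An element invertible modulo I is invertible modulo every power of I: (αβ - 1)^k lies in I^k and
is congruent to (-1)^k modulo α. Division by α therefore loses no order of vanishing. -/
lemma mem_pow_of_mul_mem (I : Ideal (Pol V)) {α β : Pol V} (h : α * β - 1 ∈ I) {k : ℕ}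
    {q : Pol V} (hq : α * q ∈ I ^ k) : q ∈ I ^ k := by
  obtain ⟨δ, hδ⟩ := sub_dvd_pow_sub_pow (α * β - 1) (-1) k
  have h1 : q * (-1) ^ k = q * (α * β - 1) ^ k - α * q * (β * δ) := by
    linear_combination (-q) * hδ
  have h2 : q * (-1) ^ k ∈ I ^ k := by
    rw [h1]
    exact sub_mem (Ideal.mul_mem_left _ _ (Ideal.pow_mem_pow h k)) (Ideal.mul_mem_right _ _ hq)
  have h3 : q = q * (-1) ^ k * (-1) ^ k := by
    rw [mul_assoc, ← mul_pow, neg_mul_neg, one_mul, one_pow, mul_one]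
  rw [h3]
  exact Ideal.mul_mem_right _ _ h2

/-- Only the constant term of the product, seen as a polynomial in α, matters; it yields the inverse
in `exists_inv_mod`. -/
lemma exists_prod_sub_eq {ι : Type*} (s : Finset ι) (α : Pol V) (t : ι → ℂ) : ∃ γ : Pol V,
    ∏ i ∈ s, (α - algebraMap ℂ _ (t i)) = α * γ + algebraMap ℂ _ (∏ i ∈ s, -t i) := by
  classical
  induction s using Finset.induction_on with
  | empty => exact ⟨0, by simp⟩
  | insert i s hi ih =>
    obtain ⟨γ, hγ⟩ := ih
    refine ⟨(α - algebraMap ℂ _ (t i)) * γ + algebraMap ℂ _ (∏ i ∈ s, -t i), ?_⟩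
    rw [Finset.prod_insert hi, Finset.prod_insert hi, hγ, map_mul, map_neg]
    ring

/-- A polynomial without zeros on a finite set is invertible modulo the ideal of this set. -/
lemma exists_inv_mod {ι : Type*} [Fintype ι] (p : ι → V) (α : Pol V) (h : ∀ i, α (p i) ≠ 0) :
    ∃ β : Pol V, α * β - 1 ∈ vanishOn (Set.range p) := by
  obtain ⟨γ, hγ⟩ := exists_prod_sub_eq Finset.univ α (fun i => α (p i))
  set c := ∏ i, -α (p i) with hc
  have hc0 : c ≠ 0 := Finset.prod_ne_zero_iff.2 fun i _ => neg_ne_zero.2 (h i)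
  -- The product of the α - α(p_i) vanishes at every p_i and equals αγ + c, so αγ takes the value -c
  -- at these points.
  refine ⟨-(algebraMap ℂ _ c⁻¹ * γ), mem_vanishOn.2 ?_⟩
  rintro _ ⟨i, rfl⟩
  have h1 := congrArg (evalAt (p i)) hγ
  rw [map_prod, Finset.prod_eq_zero (Finset.mem_univ i) (by
    rw [map_sub, AlgHom.commutes]; exact sub_self _), map_add, AlgHom.commutes, map_mul] at h1
  rw [← evalAt_apply]
  simp only [map_sub, map_mul, map_neg, AlgHom.commutes, map_one, Algebra.algebraMap_self,
    RingHom.id_apply] at h1 ⊢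
  field_simp
  linear_combination h1

/-- There are polynomials with value one at a point and zero at finitely many other points. -/
lemma exists_interpolation [FiniteDimensional ℂ V] {ι : Type*} (s : Finset ι) (p : ι → V) (y : V)
    (h : ∀ i ∈ s, p i ≠ y) : ∃ e : Pol V, e y = 1 ∧ ∀ i ∈ s, e (p i) = 0 := by
  classical
  have h1 : ∀ i, ∃ f : Pol V, i ∈ s → f y = 1 ∧ f (p i) = 0 := by
    intro i
    by_cases hi : i ∈ s
    · obtain ⟨l, hl⟩ := Module.exists_dual_forall_apply_ne_zero (K := ℂ)
        (fun _ : Fin 1 => y - p i) (fun _ => sub_ne_zero.2 (h i hi).symm)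
      refine ⟨algebraMap ℂ _ (l (y - p i))⁻¹ * (linPoly l - algebraMap ℂ _ (l (p i))), fun _ => ?_⟩
      simp only [← evalAt_apply, map_sub, map_mul, AlgHom.commutes, Algebra.algebraMap_self,
        RingHom.id_apply]
      refine ⟨?_, ?_⟩
      · change _ * (l y - _) = 1
        rw [← map_sub, inv_mul_cancel₀ (hl 0)]
      · change _ * (l (p i) - _) = 0
        rw [sub_self, mul_zero]
    · exact ⟨0, fun h => absurd h hi⟩
  choose f hf using h1
  refine ⟨∏ i ∈ s, f i, ?_, fun i hi => ?_⟩
  · rw [← evalAt_apply, map_prod]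
    exact Finset.prod_eq_one fun i hi => (hf i hi).1
  · rw [← evalAt_apply, map_prod]
    exact Finset.prod_eq_zero hi (hf i hi).2

variable [FiniteDimensional ℂ V]

/-- The monomials in the partial derivatives. -/
def monD : Multiset (Fin (Module.finrank ℂ V)) → Module.End ℂ (Pol V) :=
  mon (fun i => partialDeriv (Module.finBasis ℂ V i)) (fun _ _ => partialDeriv_comm _ _)

lemma monD_mem_pow (I : Ideal (Pol V)) (s : Multiset (Fin (Module.finrank ℂ V))) {k : ℕ}
    {f : Pol V} (hf : f ∈ I ^ (s.card + k)) : monD s f ∈ I ^ k := by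
  induction s using Multiset.induction_on generalizing k with
  | empty => simpa [monD] using! hf
  | cons i s ih =>
    have : monD (i ::ₘ s) f = partialDeriv (Module.finBasis ℂ V i) (monD s f) := by
      simp [monD]
    rw [this]
    refine partialDeriv_mem_pow _ _ (ih ?_)
    rwa [Multiset.card_cons, add_assoc, add_comm 1] at hf

/-- The coordinate functions centered at a point. -/
def centered (y : V) (i : Fin (Module.finrank ℂ V)) : Pol V :=
  linPoly ((Module.finBasis ℂ V).coord i) - algebraMap ℂ _ ((Module.finBasis ℂ V).coord i y)

lemma centered_self (y : V) (i : Fin (Module.finrank ℂ V)) : centered y i y = 0 :=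
  sub_self ((Module.finBasis ℂ V).coord i y)

lemma partialDeriv_centered (y : V) (i j : Fin (Module.finrank ℂ V)) :
    partialDeriv (Module.finBasis ℂ V j) (centered y i) = if i = j then 1 else 0 := by
  rw [centered, map_sub, partialDeriv_algebraMap, partialDeriv_linPoly]
  simp only [Module.Basis.coord_apply, Module.Basis.repr_self, Finsupp.single_apply]
  split_ifs with h1 h2 h3 <;> simp_all

lemma partialDeriv_prod_centered (y : V) (j : Fin (Module.finrank ℂ V))
    (a : Multiset (Fin (Module.finrank ℂ V))) :
    partialDeriv (Module.finBasis ℂ V j) (a.map (centered y)).prod =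
      (a.count j : ℂ) • ((a.erase j).map (centered y)).prod := by
  induction a using Multiset.induction_on with
  | empty =>
    have := partialDeriv_algebraMap (Module.finBasis ℂ V j) 1
    rw [map_one] at this
    simpa using this
  | cons i a ih =>
    rw [Multiset.map_cons, Multiset.prod_cons, partialDeriv_mul, ih, partialDeriv_centered]
    by_cases hij : i = j
    · subst hij
      rw [if_pos rfl, Multiset.erase_cons_head, Multiset.count_cons_self, one_mul, mul_smul_comm]
      by_cases hi : i ∈ a
      · conv_lhs => rw [← Multiset.prod_cons, ← Multiset.map_cons, Multiset.cons_erase hi]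
        push_cast
        rw [add_smul, one_smul, add_comm]
      · rw [Multiset.count_eq_zero_of_notMem hi]
        simp
    · rw [if_neg hij, Multiset.erase_cons_tail _ hij, Multiset.count_cons_of_ne (Ne.symm hij),
        Multiset.map_cons, Multiset.prod_cons, zero_mul, zero_add, mul_smul_comm]

/-- Derivatives are applied one at a time. Each removes a factor from the product, or kills it if
that factor does not occur; if the derivatives run out first, a remaining factor vanishes at y. No
comparison of degrees is needed. -/
lemma monD_prod_centered_ne (y : V) (a s : Multiset (Fin (Module.finrank ℂ V))) (h : s ≠ a) :
    monD s (a.map (centered y)).prod y = 0 := by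
  induction s using Multiset.induction_on generalizing a with
  | empty =>
    obtain ⟨i, hi⟩ := Multiset.exists_mem_of_ne_zero h.symm
    change (a.map (centered y)).prod y = 0
    rw [← evalAt_apply, map_multiset_prod]
    apply Multiset.prod_eq_zero
    rw [Multiset.map_map]
    exact Multiset.mem_map.2 ⟨i, hi, centered_self y i⟩
  | cons j s ih =>
    rw [monD, mon_cons', Module.End.mul_apply, partialDeriv_prod_centered, map_smul, pol_smul]
    by_cases hj : j ∈ a
    · rw [← monD, ih _ fun e => h (by rw [e, Multiset.cons_erase hj]), mul_zero]
    · rw [Multiset.count_eq_zero_of_notMem hj, Nat.cast_zero, zero_mul]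

lemma monD_prod_centered_self (y : V) (a : Multiset (Fin (Module.finrank ℂ V))) :
    monD a (a.map (centered y)).prod y ≠ 0 := by
  induction a using Multiset.induction_on with
  | empty => exact one_ne_zero (α := ℂ)
  | cons j a ih =>
    rw [monD, mon_cons', Module.End.mul_apply, partialDeriv_prod_centered, map_smul, pol_smul,
      Multiset.erase_cons_head, ← monD]
    refine mul_ne_zero ?_ ih
    rw [Multiset.count_cons_self]
    exact Nat.cast_ne_zero.2 (Nat.succ_ne_zero _)

end VanishingIdeals

/-! ### Dunkl operators near a free orbit, and the Poincaré-Birkhoff-Witt theorem. -/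

namespace Datum

variable {V : Type u} [AddCommGroup V] [Module ℂ V] {D : Datum V}

/-- The ideal of polynomials vanishing on the orbit of a point. -/
def orbitIdeal (D : Datum V) (y : V) : Ideal (Pol V) := vanishOn (Set.range fun w : D.W => w.1 y)

lemma R.ne_one (r : D.R) : r.1 ≠ 1 := fun h => by
  have h1 := r.2
  rw [h] at h1
  have h2 : fixedSpace (1 : V ≃ₗ[ℂ] V) = ⊤ := by
    rw [eq_top_iff]
    exact fun x _ => rfl
  rw [IsReflection, OneMemClass.coe_one, h2, finrank_top] at h1
  omega

lemma act_mem_orbitIdeal (y : V) (w : D.W) (f : Pol V) (hf : f ∈ D.orbitIdeal y) :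
    act w f ∈ D.orbitIdeal y := by
  rw [orbitIdeal, mem_vanishOn] at hf ⊢
  rintro _ ⟨u, rfl⟩
  exact hf _ ⟨w⁻¹ * u, rfl⟩

section Regular

variable {y : V} (hy : ∀ w : D.W, w ≠ 1 → w.1 y ≠ y)

include hy

/-- A reflection fixing w y is conjugate to a nontrivial element fixing y. -/
lemma α_ne_zero_of_regular (r : D.R) (w : D.W) : D.α r.1 (w.1 y) ≠ 0 := fun h => by
  have h1 : r.1.1 (w.1 y) = w.1 y := (r.ker_iff _).1 h
  refine hy (w⁻¹ * r.1 * w) (fun e => r.ne_one ?_) ?_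
  · rw [mul_assoc, inv_mul_eq_one] at e
    exact mul_eq_right.1 e.symm
  · change w.1⁻¹ (r.1.1 (w.1 y)) = y
    rw [h1]
    exact w.1.symm_apply_apply y

/-- The form α_r has no zero on the free orbit, so it is invertible modulo the orbit ideal and
dividing f - r f by it keeps the order of vanishing. -/
lemma divDiff_mem_pow (r : D.R) {k : ℕ} {f : Pol V} (hf : f ∈ D.orbitIdeal y ^ k) :
    divDiff r f ∈ D.orbitIdeal y ^ k := by
  obtain ⟨β, hβ⟩ := exists_inv_mod (fun w : D.W => w.1 y) (linPoly (D.α r.1))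
    (fun w => α_ne_zero_of_regular hy r w)
  refine mem_pow_of_mul_mem _ hβ ?_
  rw [mul_divDiff]
  exact sub_mem hf (polyAction_mem_pow _ _ (act_mem_orbitIdeal y r.1) hf)

/-- The reflection part of a Dunkl operator preserves the order of vanishing while the derivative
lowers it by one. The derivative is therefore the leading part. -/
lemma dunkl_sub_mem_pow (v : V) {k : ℕ} {f : Pol V} (hf : f ∈ D.orbitIdeal y ^ k) :
    D.dunkl v f - partialDeriv v f ∈ D.orbitIdeal y ^ k := by
  rw [dunkl_apply, sub_sub_cancel_left]
  refine neg_mem (sum_mem fun r _ => ?_)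
  rw [Algebra.smul_def]
  exact Ideal.mul_mem_left _ _ (divDiff_mem_pow hy r hf)

lemma dunkl_mem_pow (v : V) {k : ℕ} {f : Pol V} (hf : f ∈ D.orbitIdeal y ^ (k + 1)) :
    D.dunkl v f ∈ D.orbitIdeal y ^ k := by
  rw [← sub_add_cancel (D.dunkl v f) (partialDeriv v f)]
  exact add_mem (Ideal.pow_le_pow_right (Nat.le_succ k) (dunkl_sub_mem_pow hy v hf))
    (partialDeriv_mem_pow _ v hf)

variable [FiniteDimensional ℂ V]

/-- In the induction the error splits in two: a Dunkl operator applied to the previous error, which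
was one order smaller, and the difference of Dunkl operator and derivative on `monD s f`, which
loses no order. Both lie in the power k + 1, whereas each monomial alone only reaches the power k.
-/
lemma monY_sub_mem_pow (s : Multiset (Fin (Module.finrank ℂ V))) {k : ℕ} {f : Pol V}
    (hf : f ∈ D.orbitIdeal y ^ (s.card + k)) :
    D.op (D.rels.monY s) f - monD s f ∈ D.orbitIdeal y ^ (k + 1) := by
  induction s using Multiset.induction_on generalizing k with
  | empty => simp [Rels.monY, monD]
  | cons i s ih =>
    rw [Multiset.card_cons, add_assoc, add_comm 1] at hf
    have e1 : D.op (D.rels.monY (i ::ₘ s)) f =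
        D.dunkl (Module.finBasis ℂ V i) (D.op (D.rels.monY s) f) := by
      rw [Rels.monY, mon_cons, map_mul]
      rfl
    have e2 : monD (i ::ₘ s) f = partialDeriv (Module.finBasis ℂ V i) (monD s f) := by
      simp [monD]
    have e3 := add_mem (dunkl_mem_pow hy (Module.finBasis ℂ V i) (ih hf))
      (dunkl_sub_mem_pow hy (Module.finBasis ℂ V i) (monD_mem_pow _ s hf))
    rw [map_sub] at e3
    rw [e1, e2]
    convert! e3 using 1
    ring

/-- A test function detecting one monomial in the Dunkl operators and one point of a regular
orbit. -/
lemma exists_test (a : Multiset (Fin (Module.finrank ℂ V))) : ∃ (g : Pol V) (K : ℂ), K ≠ 0 ∧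
    (D.op (D.rels.monY a) g y = K) ∧ ∀ (s : Multiset (Fin (Module.finrank ℂ V))) (w : D.W),
      s.card ≤ a.card → (w ≠ 1 ∨ s ≠ a) → D.op (D.rels.monY s) g (w.1 y) = 0 := by
  classical
  obtain ⟨e, he1, he0⟩ := exists_interpolation (Finset.univ.erase (1 : D.W)) (fun w => w.1 y) y
    (fun w hw => hy w (Finset.ne_of_mem_erase hw))
  -- Here e is 1 at y and 0 elsewhere on the orbit. Each factor e (x_i - y_i) vanishes on the whole
  -- orbit, so g has order at least that of the monomial there; the extra factor e raises the order
  -- by one more at the points other than y.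
  set g := e * (a.map fun i => e * centered y i).prod with hg
  have hprod : ∀ (I : Ideal (Pol V)) (x : Fin (Module.finrank ℂ V) → Pol V)
      (b : Multiset (Fin (Module.finrank ℂ V))),
      (∀ i, x i ∈ I) → (b.map x).prod ∈ I ^ b.card := by
    intro I x b hx
    induction b using Multiset.induction_on with
    | empty => simp
    | cons i b ih =>
      rw [Multiset.map_cons, Multiset.prod_cons, Multiset.card_cons, pow_succ']
      exact Ideal.mul_mem_mul (hx i) ih
  have hgI : g ∈ D.orbitIdeal y ^ a.card := by
    refine Ideal.mul_mem_left _ _ (hprod _ _ _ fun i => mem_vanishOn.2 ?_)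
    rintro _ ⟨w, rfl⟩
    by_cases hw : w = 1
    · subst hw
      change e y * centered y i y = 0
      rw [centered_self, mul_zero]
    · change e (w.1 y) * _ = 0
      rw [he0 w (Finset.mem_erase.2 ⟨hw, Finset.mem_univ _⟩), zero_mul]
  have h1 : ∀ (s : Multiset (Fin (Module.finrank ℂ V))) (w : D.W), s.card ≤ a.card →
      D.op (D.rels.monY s) g (w.1 y) = monD s g (w.1 y) := by
    intro s w hs
    obtain ⟨k, hk⟩ := Nat.exists_eq_add_of_le hs
    have := Ideal.pow_le_pow_right (Nat.le_add_left 1 k) (monY_sub_mem_pow hy s (hk ▸ hgI))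
    rw [pow_one, orbitIdeal, mem_vanishOn] at this
    exact sub_eq_zero.1 (this _ ⟨w, rfl⟩)
  have h2 : ∀ (s : Multiset (Fin (Module.finrank ℂ V))) (p : V) (f : Pol V), s.card ≤ a.card →
      f ∈ vanishOn {p} ^ (a.card + 1) → monD s f p = 0 := by
    intro s p f hs hf
    obtain ⟨k, hk⟩ := Nat.exists_eq_add_of_le hs
    rw [hk, add_assoc] at hf
    have := Ideal.pow_le_pow_right (Nat.le_add_left 1 k) (monD_mem_pow _ s hf)
    rw [pow_one] at this
    exact mem_vanishOn.1 this p rfl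
  have h3 : ∀ (s : Multiset (Fin (Module.finrank ℂ V))), s.card ≤ a.card →
      monD s g y = monD s (a.map (centered y)).prod y := by
    intro s hs
    -- At y the powers of e are invisible to derivatives of order at most the degree of a: e^(n+1) -
    -- 1 vanishes at y and multiplies a product that vanishes to order n.
    have hmem : g - (a.map (centered y)).prod ∈ vanishOn {y} ^ (a.card + 1) := by
      have : g - (a.map (centered y)).prod =
          (e ^ (a.card + 1) - 1) * (a.map (centered y)).prod := by
        rw [hg, Multiset.prod_map_mul]
        simp only [Multiset.map_const', Multiset.prod_replicate]
        ring
      rw [this, pow_succ']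
      refine Ideal.mul_mem_mul (mem_vanishOn.2 ?_) (hprod _ _ _ fun i => mem_vanishOn.2 ?_)
      · rintro p rfl
        rw [← evalAt_apply, map_sub, map_pow, evalAt_apply, he1, one_pow, map_one, sub_self]
      · rintro p rfl
        exact centered_self _ _
    have := h2 s y _ hs hmem
    rw [map_sub] at this
    exact sub_eq_zero.1 this
  refine ⟨g, _, monD_prod_centered_self y a, ?_, fun s w hs h => ?_⟩
  · rw [← h3 a le_rfl]
    exact h1 a 1 le_rfl
  · rw [h1 s w hs]
    by_cases hw : w = 1
    · subst hw
      exact (h3 s hs).trans (monD_prod_centered_ne y a s (h.resolve_left (by simp)))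
    · refine h2 s _ _ hs ?_
      have he : e ∈ vanishOn {w.1 y} := mem_vanishOn.2 (by
        rintro p rfl
        exact he0 w (Finset.mem_erase.2 ⟨hw, Finset.mem_univ _⟩))
      rw [hg, pow_succ']
      exact Ideal.mul_mem_mul he (hprod _ _ _ fun i => Ideal.mul_mem_right _ _ he)

end Regular

/-- A nonzero polynomial is nonzero at some point with trivial stabilizer. -/
lemma exists_regular [FiniteDimensional ℂ V] {f : Pol V} (hf : f ≠ 0) :
    ∃ z : V, f z ≠ 0 ∧ ∀ w : D.W, w ≠ 1 → w.1 z ≠ z := by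
  classical
  have h1 : ∀ w : D.W, ∃ l : Module.Dual ℂ V, w ≠ 1 → l ≠ 0 ∧ ∀ z, w.1 z = z → l z = 0 := by
    intro w
    by_cases hw : w = 1
    · exact ⟨0, fun h => absurd hw h⟩
    · obtain ⟨x, hx⟩ : ∃ x, w.1 x ≠ x := by
        by_contra! h
        exact hw (Subtype.ext (LinearEquiv.ext h))
      obtain ⟨l, hl⟩ := Module.exists_dual_forall_apply_ne_zero (K := ℂ)
        (fun _ : Fin 1 => w.1 x - x) (fun _ => sub_ne_zero.2 hx)
      refine ⟨l ∘ₗ (w.1.toLinearMap - LinearMap.id), fun _ => ⟨fun h => hl 0 ?_, fun z hz => ?_⟩⟩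
      · exact LinearMap.congr_fun h x
      · change l (w.1 z - z) = 0
        rw [hz, sub_self, map_zero]
  choose l hl using h1
  -- Each form l_w is nonzero and vanishes on the fixed points of w. Nonzero linear forms are not
  -- zero divisors, so the product of f with all of them is nonzero; any point where it does not
  -- vanish is as required.
  have h2 : ∀ s : Finset D.W, 1 ∉ s → (∏ w ∈ s, linPoly (l w)) * f ≠ 0 := by
    intro s
    induction s using Finset.induction_on with
    | empty => simpa using hf
    | insert w s hw ih =>
      intro h0 h
      rw [Finset.prod_insert hw, mul_assoc, ← mul_zero (linPoly (l w))] at h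
      exact ih (fun h => h0 (Finset.mem_insert_of_mem h))
        (linPoly_mul_cancel (hl w (fun e => h0 (e ▸ Finset.mem_insert_self _ _))).1 h)
  obtain ⟨z, hz⟩ : ∃ z, ((∏ w ∈ Finset.univ.erase (1 : D.W), linPoly (l w)) * f) z ≠ 0 := by
    by_contra! h
    exact h2 _ (Finset.notMem_erase _ _) (Pol.ext (funext h))
  rw [← evalAt_apply, map_mul, map_prod] at hz
  refine ⟨z, right_ne_zero_of_mul hz, fun w hw e => ?_⟩
  exact Finset.prod_ne_zero_iff.1 (left_ne_zero_of_mul hz) w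
    (Finset.mem_erase.2 ⟨hw, Finset.mem_univ _⟩) ((hl w hw).2 z e)

variable [FiniteDimensional ℂ V]

lemma op_pbw (i : Rels.Idx V D) (f : Pol V) (z : V) :
    D.op (D.rels.pbw i) f z = (i.1.map (centered 0)).prod z *
      D.op (D.rels.monY i.2.2) f (i.2.1⁻¹.1 z) := by
  have h : ∀ t, D.op (D.rels.monX t) = LinearMap.mulLeft ℂ (t.map (centered 0)).prod := by
    intro t
    induction t using Multiset.induction_on with
    | empty => simp [Rels.monX]; rfl
    | cons i t ih =>
      rw [Rels.monX, mon_cons, map_mul, ← Rels.monX, ih, Multiset.map_cons, Multiset.prod_cons,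
        LinearMap.mulLeft_mul, centered, map_zero, map_zero, sub_zero]
      rfl
  rw [Rels.pbw, map_mul, map_mul, h]
  rfl

/-- The Poincaré-Birkhoff-Witt theorem: the ordered monomials are linearly independent. -/
theorem linearIndependent_pbw : LinearIndependent ℂ D.rels.pbw := by
  classical
  rw [linearIndependent_iff]
  intro c hc
  by_contra hne
  -- A term of maximal order in the Dunkl operators is chosen, since test functions control only
  -- monomials of order at most that of the one they detect.
  obtain ⟨i0, hi0, hmax⟩ := c.support.exists_max_image (fun i => i.2.2.card)
    (Finsupp.support_nonempty_iff.2 hne)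
  -- This is the polynomial coefficient in front of the group element and the Dunkl monomial of the
  -- chosen term. It is nonzero because monomials in the coordinates are separated by derivatives at
  -- the origin.
  set f : Pol V := ∑ i ∈ c.support with i.2 = i0.2, c i • (i.1.map (centered 0)).prod with hf
  have hf0 : f ≠ 0 := by
    intro h
    have h1 := congrArg (fun q : Pol V => monD i0.1 q (0 : V)) h
    simp only [hf, map_sum, map_zero, map_smul, pol_sum, pol_smul] at h1
    rw [Finset.sum_eq_single i0] at h1
    · exact mul_ne_zero (Finsupp.mem_support_iff.1 hi0) (monD_prod_centered_self 0 i0.1) h1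
    · intro i hi hne
      rw [monD_prod_centered_ne, mul_zero]
      exact fun e => hne (Prod.ext e.symm (Finset.mem_filter.1 hi).2)
    · exact fun h => (h (Finset.mem_filter.2 ⟨hi0, rfl⟩)).elim
  obtain ⟨z, hz, hreg⟩ := exists_regular (D := D) hf0
  set y := i0.2.1⁻¹.1 z with hy
  have hyreg : ∀ w : D.W, w ≠ 1 → w.1 y ≠ y := by
    intro w hw h
    refine hreg (i0.2.1 * w * i0.2.1⁻¹) (fun e => hw ?_) ?_
    · exact conj_eq_one_iff.1 e
    · change i0.2.1.1 (w.1 y) = z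
      rw [h]
      exact i0.2.1.1.apply_symm_apply z
  -- Evaluated at z, an ordered monomial with group element w reads its Dunkl monomial at w⁻¹ z. The
  -- test function at y = w₀⁻¹ z thus kills all terms with another group element or another Dunkl
  -- monomial, and the relation collapses to f(z) K = 0.
  obtain ⟨g, K, hK, h1, h2⟩ := exists_test hyreg i0.2.2
  have h3 := congrArg (fun h : D.H => D.op h g z) hc
  have h4 : D.op (0 : D.H) g z = 0 := by rw [map_zero]; rfl
  simp only [Finsupp.linearCombination_apply, Finsupp.sum, map_sum, map_smul, LinearMap.sum_apply,
    LinearMap.smul_apply, pol_sum, pol_smul, op_pbw, h4] at h3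
  have h5 : ∑ i ∈ c.support, c i * ((i.1.map (centered 0)).prod z *
      D.op (D.rels.monY i.2.2) g (i.2.1⁻¹.1 z)) = f z * K := by
    rw [hf, pol_sum, Finset.sum_mul, Finset.sum_filter]
    refine Finset.sum_congr rfl fun i hi => ?_
    have e : i.2.1⁻¹.1 z = (i.2.1⁻¹ * i0.2.1).1 y := by
      change _ = i.2.1⁻¹.1 (i0.2.1.1 (i0.2.1.1⁻¹ z))
      congr 1
      exact (i0.2.1.1.apply_symm_apply z).symm
    split_ifs with h
    · rw [h, ← hy, h1, pol_smul, mul_assoc]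
    · rw [e, h2 _ _ (hmax i hi), mul_zero, mul_zero]
      by_contra! h'
      exact h (Prod.ext (inv_mul_eq_one.1 h'.1) h'.2)
  rw [h5] at h3
  exact mul_ne_zero hz hK h3

end Datum

/-! ### The presentation of the algebra by its relations. -/

namespace Datum

variable {V : Type u} [AddCommGroup V] [Module ℂ V] [FiniteDimensional ℂ V] {D : Datum V}

/-- The rational Cherednik algebra is presented by its defining relations. -/
theorem exists_lift {A : Type*} [Ring A] [Algebra ℂ A] (Q : Rels D A) : ∃ Φ : D.H →ₐ[ℂ] A,
    (∀ l, Φ (D.rels.X l) = Q.X l) ∧ (∀ v, Φ (D.rels.Y v) = Q.Y v) ∧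
      ∀ w, Φ (D.rels.g w) = Q.g w := by
  -- The homomorphism is constructed through its graph. The pairs of generators in H_c × A satisfy
  -- the relations, so the subalgebra B they generate is spanned by ordered monomials; the first
  -- projection sends these to linearly independent elements, hence is injective on B, and it is
  -- onto. The second projection composed with its inverse is the required map.
  set P := D.rels.prod Q with hP
  let B := Algebra.adjoin ℂ P.gens
  let p : B →ₐ[ℂ] D.H := (AlgHom.fst ℂ D.H A).comp B.val
  have hX : ∀ l, P.X l ∈ B := fun l => Algebra.subset_adjoin (Or.inl (Or.inl ⟨l, rfl⟩))
  have hg : ∀ w, P.g w ∈ B := fun w => Algebra.subset_adjoin (Or.inl (Or.inr ⟨w, rfl⟩))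
  have hY : ∀ v, P.Y v ∈ B := fun v => Algebra.subset_adjoin (Or.inr ⟨v, rfl⟩)
  have hinj : Function.Injective p := by
    rw [injective_iff_map_eq_zero]
    rintro ⟨x, hx⟩ h0
    have h1 := P.adjoin_le_span hx
    rw [Finsupp.mem_span_range_iff_exists_finsupp] at h1
    obtain ⟨c, rfl⟩ := h1
    have h2 : c = 0 := by
      refine linearIndependent_iff.1 (linearIndependent_pbw (D := D)) c ?_
      rw [← show p _ = (0 : D.H) from h0]
      change _ = AlgHom.fst ℂ D.H A (c.sum fun i a => a • P.pbw i)
      rw [map_finsuppSum, Finsupp.linearCombination_apply]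
      refine Finsupp.sum_congr fun i _ => ?_
      rw [map_smul, Rels.map_pbw P D.rels (AlgHom.fst ℂ D.H A) (fun _ => rfl) (fun _ => rfl)
        (fun _ => rfl)]
    subst h2
    rfl
  have hsurj : Function.Surjective p := by
    rw [← AlgHom.range_eq_top, eq_top_iff, ← adjoin_gens, Algebra.adjoin_le_iff]
    rintro _ ((⟨l, rfl⟩ | ⟨w, rfl⟩) | ⟨v, rfl⟩)
    exacts [⟨⟨_, hX l⟩, rfl⟩, ⟨⟨_, hg w⟩, rfl⟩, ⟨⟨_, hY v⟩, rfl⟩]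
  let e : B ≃ₐ[ℂ] D.H := AlgEquiv.ofBijective p ⟨hinj, hsurj⟩
  have he : ∀ b : B, e.symm b.1.1 = b := fun b => e.symm_apply_apply b
  refine ⟨((AlgHom.snd ℂ D.H A).comp B.val).comp e.symm.toAlgHom, fun l => ?_, fun v => ?_,
    fun w => ?_⟩
  · exact congrArg (fun b : B => b.1.2) (he ⟨_, hX l⟩)
  · exact congrArg (fun b : B => b.1.2) (he ⟨_, hY v⟩)
  · exact congrArg (fun b : B => b.1.2) (he ⟨_, hg w⟩)

/-! ### The conjugate-linear anti-automorphism. -/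

/-- The opposite of the rational Cherednik algebra, with the conjugate complex structure. -/
def ConjOp (D : Datum V) : Type u := D.Hᵐᵒᵖ

instance : Ring (ConjOp D) := inferInstanceAs (Ring D.Hᵐᵒᵖ)

instance : Algebra ℂ (ConjOp D) :=
  RingHom.toAlgebra' ((algebraMap ℂ D.Hᵐᵒᵖ).comp (starRingEnd ℂ)) fun a (x : D.Hᵐᵒᵖ) =>
    Algebra.commutes (conj a) x

/-- An element of `H_c`, as an element of the opposite algebra. -/
def toConjOp : D.H ≃+ ConjOp D := MulOpposite.opAddEquiv

omit [FiniteDimensional ℂ V] in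
lemma toConjOp_mul (a b : D.H) : toConjOp (a * b) = toConjOp b * toConjOp a := rfl

omit [FiniteDimensional ℂ V] in
lemma toConjOp_one : toConjOp (1 : D.H) = 1 := rfl

omit [FiniteDimensional ℂ V] in
lemma algebraMap_conjOp (a : ℂ) :
    algebraMap ℂ (ConjOp D) a = toConjOp (algebraMap ℂ D.H (conj a)) := rfl

omit [FiniteDimensional ℂ V] in
lemma smul_toConjOp (a : ℂ) (h : D.H) : a • toConjOp h = toConjOp (conj a • h) := by
  rw [Algebra.smul_def, algebraMap_conjOp, ← toConjOp_mul, ← Algebra.commutes,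
    ← Algebra.smul_def]

omit [FiniteDimensional ℂ V] in
lemma isReflection_inv {w : V ≃ₗ[ℂ] V} (hw : IsReflection w) : IsReflection w⁻¹ := by
  have h : fixedSpace w⁻¹ = fixedSpace w := by
    ext x
    constructor
    · intro hx
      change w x = x
      conv_lhs => rw [← show w⁻¹ x = x from hx]
      exact w.apply_symm_apply x
    · intro hx
      change w⁻¹ x = x
      conv_lhs => rw [← show w x = x from hx]
      exact w.symm_apply_apply x
  rw [IsReflection, h]
  exact hw

/-- Inversion of reflections. -/
def R.inv : D.R ≃ D.R where
  toFun r := ⟨r.1⁻¹, isReflection_inv r.2⟩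
  invFun r := ⟨r.1⁻¹, isReflection_inv r.2⟩
  left_inv _ := Subtype.ext (inv_inv _)
  right_inv _ := Subtype.ext (inv_inv _)

variable (J : HermitianIso D)

omit [FiniteDimensional ℂ V] in
lemma HermitianIso.symm_comp (l : Module.Dual ℂ V) (w : D.W) :
    J.toEquiv.symm (l ∘ₗ (w.1⁻¹ : V ≃ₗ[ℂ] V).toLinearMap) = w.1 (J.toEquiv.symm l) := by
  rw [LinearEquiv.symm_apply_eq]
  ext v
  rw [J.equivariant, LinearEquiv.apply_symm_apply]
  rfl

/-- The relations satisfied in the opposite algebra by the images of the generators under the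
anti-automorphism. -/
def conjOpRels : Rels D (ConjOp D) where
  X := { toFun l := toConjOp (D.dun (J.toEquiv.symm l))
         map_add' l m := by rw [map_add, map_add, map_add]
         map_smul' a l := by rw [LinearEquiv.map_smulₛₗ, map_smul, RingHom.id_apply, smul_toConjOp] }
  Y := { toFun v := toConjOp (D.rels.X (J.toEquiv v))
         map_add' l m := by rw [map_add, map_add, map_add]
         map_smul' a l := by rw [LinearEquiv.map_smulₛₗ, map_smul, RingHom.id_apply, smul_toConjOp] }
  g := { toFun w := toConjOp (D.grp w⁻¹)
         map_one' := by rw [inv_one, map_one, toConjOp_one]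
         map_mul' w w' := by rw [mul_inv_rev, map_mul, toConjOp_mul] }
  X_comm l m := by
    change toConjOp _ * toConjOp _ = toConjOp _ * toConjOp _
    rw [← toConjOp_mul, dun_comm, toConjOp_mul]
  Y_comm l m := by
    change toConjOp _ * toConjOp _ = toConjOp _ * toConjOp _
    rw [← toConjOp_mul, D.rels.X_comm, toConjOp_mul]
  g_X w l := by
    change toConjOp _ * toConjOp _ = toConjOp _ * toConjOp _
    rw [← toConjOp_mul, ← toConjOp_mul, dun_grp, inv_inv, J.symm_comp]
  Y_g v w := by
    change toConjOp _ * toConjOp _ = toConjOp _ * toConjOp _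
    rw [← toConjOp_mul, ← toConjOp_mul]
    change toConjOp (D.rels.g w⁻¹ * _) = toConjOp (_ * D.rels.g w⁻¹)
    rw [D.rels.g_X]
    congr 3
    ext u
    exact (J.equivariant w⁻¹ v u).symm
  Y_X v l := by
    -- The required relation is the original one for the vector u and the form J v, read in the
    -- opposite algebra. Reindexing the reflections by r ↦ r⁻¹ matches the group elements, and the
    -- scalars agree up to the conjugation built into `ConjOp`, by c(r⁻¹) = conj c(r) and the
    -- Hermitian symmetry.
    obtain ⟨u, rfl⟩ := J.toEquiv.surjective l
    have h1 := congrArg toConjOp (D.rels.Y_X u (J.toEquiv v))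
    rw [map_sub, map_add, toConjOp_mul, toConjOp_mul, map_sum] at h1
    change toConjOp (D.rels.X (J.toEquiv v)) * toConjOp (D.rels.Y (J.toEquiv.symm (J.toEquiv u))) =
      toConjOp (D.rels.Y (J.toEquiv.symm (J.toEquiv u))) * toConjOp (D.rels.X (J.toEquiv v)) + _ -
        ∑ r : D.R, (D.c r.1 * (J.toEquiv u v - J.toEquiv u (r.1⁻¹.1 v))) • toConjOp (D.rels.g r.1⁻¹)
    rw [LinearEquiv.symm_apply_apply, h1, algebraMap_conjOp, ← J.hermitian]
    congr 1
    rw [← R.inv.sum_comp]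
    refine Finset.sum_congr rfl fun r _ => ?_
    rw [smul_toConjOp]
    have h2 : D.c (R.inv r).1 = conj (D.c r.1) := D.c_inv _ r.2
    have h3 : (R.inv r).1 = r.1⁻¹ := rfl
    have h4 : J.toEquiv v ((r.1⁻¹)⁻¹.1 u) = conj (J.toEquiv u (r.1⁻¹.1 v)) := by
      rw [← J.equivariant, J.hermitian]
    rw [h2, h3, h4, J.hermitian v u, ← map_sub, ← map_mul]

-- The square of f is multiplicative, complex linear and fixes the generators. The statement
-- concerns a bare function, so that it yields bijectivity while a `Bar` is being built and
-- involutivity for an arbitrary `Bar`.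
omit [FiniteDimensional ℂ V] in
lemma involutive_of_generators {f : D.H → D.H} (hadd : ∀ a b, f (a + b) = f a + f b)
    (hmul : ∀ a b, f (a * b) = f b * f a)
    (hs : ∀ a : ℂ, f (algebraMap ℂ D.H a) = algebraMap ℂ D.H (conj a))
    (hg : ∀ w, f (D.grp w) = D.grp w⁻¹)
    (hY : ∀ v, f (D.dun v) = D.pol (linPoly (J.toEquiv v)))
    (hX : ∀ v, f (D.pol (linPoly (J.toEquiv v))) = D.dun v) : Function.Involutive f := by
  intro h
  have h1 : h ∈ Algebra.adjoin ℂ D.rels.gens := by rw [adjoin_gens]; trivial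
  induction h1 using Algebra.adjoin_induction with
  | mem x hx =>
    rcases hx with (⟨l, rfl⟩ | ⟨w, rfl⟩) | ⟨v, rfl⟩
    · obtain ⟨u, rfl⟩ := J.toEquiv.surjective l
      change f (f (D.pol (linPoly (J.toEquiv u)))) = D.pol (linPoly (J.toEquiv u))
      rw [hX, hY]
    · change f (f (D.grp w)) = D.grp w
      rw [hg, hg, inv_inv]
    · change f (f (D.dun v)) = D.dun v
      rw [hY, hX]
  | algebraMap a => rw [hs, hs, Complex.conj_conj]
  | add x y _ _ hx hy => rw [hadd, hadd, hx, hy]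
  | mul x y _ _ hx hy => rw [hmul, hmul, hx, hy]

/-- The conjugate linear anti-automorphism exists. -/
theorem exists_bar : Nonempty (Bar J) := by
  obtain ⟨Φ, hX, hY, hg⟩ := exists_lift (conjOpRels J)
  let f : D.H → D.H := fun h => toConjOp.symm (Φ h)
  have hadd : ∀ a b, f (a + b) = f a + f b := fun a b => by simp only [f, map_add]
  have hmul : ∀ a b, f (a * b) = f b * f a := fun a b =>
    congrArg toConjOp.symm (map_mul Φ a b)
  have hs : ∀ a : ℂ, f (algebraMap ℂ D.H a) = algebraMap ℂ D.H (conj a) := fun a => by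
    simp only [f, AlgHom.commutes, algebraMap_conjOp, AddEquiv.symm_apply_apply]
  have hg' : ∀ w, f (D.grp w) = D.grp w⁻¹ := fun w => congrArg toConjOp.symm (hg w)
  have hY' : ∀ v, f (D.dun v) = D.pol (linPoly (J.toEquiv v)) := fun v =>
    congrArg toConjOp.symm (hY v)
  have hX' : ∀ v, f (D.pol (linPoly (J.toEquiv v))) = D.dun v := fun v => by
    have := congrArg toConjOp.symm (hX (J.toEquiv v))
    refine this.trans ?_
    change D.dun (J.toEquiv.symm (J.toEquiv v)) = _
    rw [LinearEquiv.symm_apply_apply]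
  exact ⟨{
    toFun := f
    bijective := (involutive_of_generators J hadd hmul hs hg' hY' hX').bijective
    map_add := hadd
    map_mul := hmul
    map_smul a h := by rw [Algebra.smul_def, hmul, hs, ← Algebra.commutes, ← Algebra.smul_def]
    map_grp := hg'
    map_dun := hY'
    map_pol := hX' }⟩

namespace Bar

variable {J} (σ : Bar J)

omit [FiniteDimensional ℂ V] in
lemma map_algebraMap (a : ℂ) : σ.toFun (algebraMap ℂ D.H a) = algebraMap ℂ D.H (conj a) := by
  rw [Algebra.algebraMap_eq_smul_one, σ.map_smul, σ.map_one, Algebra.algebraMap_eq_smul_one]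

/-- The anti-automorphism, as an additive map. -/
def toAddMonoidHom : D.H →+ D.H := AddMonoidHom.mk' σ.toFun σ.map_add

omit [FiniteDimensional ℂ V] in
lemma map_sub (a b : D.H) : σ.toFun (a - b) = σ.toFun a - σ.toFun b :=
  _root_.map_sub σ.toAddMonoidHom a b

omit [FiniteDimensional ℂ V] in
lemma map_sum {ι : Type*} (s : Finset ι) (a : ι → D.H) :
    σ.toFun (∑ i ∈ s, a i) = ∑ i ∈ s, σ.toFun (a i) :=
  _root_.map_sum σ.toAddMonoidHom a s

omit [FiniteDimensional ℂ V] in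
lemma map_pow (a : D.H) (n : ℕ) : σ.toFun (a ^ n) = σ.toFun a ^ n := by
  induction n with
  | zero => rw [pow_zero, pow_zero, σ.map_one]
  | succ n ih => rw [pow_succ, σ.map_mul, ih, pow_succ']

omit [FiniteDimensional ℂ V] in
/-- The anti-automorphism is an involution. -/
lemma involutive : Function.Involutive σ.toFun :=
  involutive_of_generators J σ.map_add σ.map_mul σ.map_algebraMap σ.map_grp σ.map_dun σ.map_pol

end Bar

end Datum

/-! ### A lifting property of sums of generalized eigenspaces. -/

/-- If `T - s` maps `m` to a sum of generalized eigenvectors, then `m` is such a sum, provided that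
`s` is one of the allowed eigenvalues. -/
lemma mem_iSup_maxGenEigenspace {M : Type*} [AddCommGroup M] [Module ℂ M] (T : Module.End ℂ M)
    (E : Set ℂ) {s : ℂ} (hs : s ∈ E) {m : M}
    (hm : T m - s • m ∈ ⨆ d ∈ E, T.maxGenEigenspace d) : m ∈ ⨆ d ∈ E, T.maxGenEigenspace d := by
  have hle : ∀ d ∈ E, T.maxGenEigenspace d ≤ ⨆ d ∈ E, T.maxGenEigenspace d := fun d hd =>
    le_biSup T.maxGenEigenspace hd
  -- On generalized eigenvectors for d ≠ s the operator T - s is invertible, with inverse a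
  -- polynomial in T obtained from a Bézout identity; for d = s nothing has to be solved. So m can
  -- be corrected by some n' in the sum until (T - s)(m - n') is a generalized eigenvector for s,
  -- and then m - n' is one too.
  have key : ∀ d ∈ E, ∀ n ∈ T.maxGenEigenspace d, ∃ n' ∈ ⨆ d ∈ E, T.maxGenEigenspace d,
      n - (T n' - s • n') ∈ T.maxGenEigenspace s := by
    intro d hd n hn
    by_cases hds : d = s
    · subst hds
      exact ⟨0, zero_mem _, by simpa using hn⟩
    · obtain ⟨k, hk⟩ := (Module.End.mem_maxGenEigenspace _ _ _).1 hn
      have hcop : IsCoprime (Polynomial.X - Polynomial.C s)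
          ((Polynomial.X - Polynomial.C d) ^ k) :=
        (Polynomial.isCoprime_X_sub_C_of_isUnit_sub
          (sub_ne_zero.2 (Ne.symm hds)).isUnit).pow_right
      obtain ⟨a, b, hab⟩ := hcop
      have h1 := congrArg (fun q => Polynomial.aeval T q n) hab
      have h2 : Polynomial.aeval T ((Polynomial.X - Polynomial.C d) ^ k) n = 0 := by
        simpa [Algebra.algebraMap_eq_smul_one] using hk
      refine ⟨Polynomial.aeval T a n, hle d hd ?_, ?_⟩
      · have hc : Commute T (Polynomial.aeval T a) := by
          have := congrArg (Polynomial.aeval T) (mul_comm Polynomial.X a)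
          simpa [Commute, SemiconjBy] using this
        exact Module.End.mapsTo_maxGenEigenspace_of_comm hc d hn
      · simp only [map_add, map_mul, LinearMap.add_apply, Module.End.mul_apply, map_one,
          Module.End.one_apply] at h1
        rw [h2, map_zero, add_zero] at h1
        have h3 : T (Polynomial.aeval T a n) - s • Polynomial.aeval T a n = n := by
          refine Eq.trans ?_ h1
          have := congrArg (fun q => Polynomial.aeval T q n)
            (mul_comm (Polynomial.X - Polynomial.C s) a)
          simpa [Algebra.algebraMap_eq_smul_one] using this
        rw [h3, sub_self]
        exact zero_mem _
  have key2 : ∀ n ∈ ⨆ d ∈ E, T.maxGenEigenspace d, ∃ n' ∈ ⨆ d ∈ E, T.maxGenEigenspace d,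
      n - (T n' - s • n') ∈ T.maxGenEigenspace s := by
    intro n hn
    rw [iSup_subtype'] at hn
    induction hn using Submodule.iSup_induction' with
    | mem d x hx => exact key d.1 d.2 x hx
    | zero => exact ⟨0, zero_mem _, by simp⟩
    | add x y _ _ h1 h2 =>
      obtain ⟨x', hx', hx⟩ := h1
      obtain ⟨y', hy', hy⟩ := h2
      refine ⟨x' + y', add_mem hx' hy', ?_⟩
      convert! add_mem hx hy using 1
      rw [map_add, smul_add]
      abel
  obtain ⟨n', hn', h⟩ := key2 _ hm
  have h1 : m - n' ∈ T.maxGenEigenspace s := by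
    rw [Module.End.mem_maxGenEigenspace] at h ⊢
    obtain ⟨k, hk⟩ := h
    refine ⟨k + 1, ?_⟩
    rw [pow_succ, Module.End.mul_apply, ← hk]
    congr 1
    simp only [LinearMap.sub_apply, LinearMap.smul_apply, Module.End.one_apply, map_sub]
  rw [← sub_add_cancel m n']
  exact add_mem (hle s hs h1) hn'

namespace Datum

variable {V : Type u} [AddCommGroup V] [Module ℂ V] {D : Datum V}

/-! ### The element z = ∑ c_r (1 - r) and the set of possible weights. -/

section CentralElement

variable (D)

/-- The central element `∑ c_r (1 - r)` of the group algebra. -/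
def cen : D.H := ∑ r : D.R, D.c r.1 • (1 - D.grp r.1)

/-- The action of the central element on functions on the group. -/
def cenReg : Module.End ℂ (D.W → ℂ) :=
  ∑ r : D.R, D.c r.1 • (LinearMap.id - LinearMap.funLeft ℂ ℂ (fun w => r.1⁻¹ * w))

lemma cenReg_apply (f : D.W → ℂ) (w : D.W) :
    D.cenReg f w = ∑ r : D.R, D.c r.1 * (f w - f (r.1⁻¹ * w)) := by
  simp [cenReg, LinearMap.sum_apply, Finset.sum_apply, LinearMap.funLeft_apply]

/-- The eigenvalues of the central element are real. -/
lemma conj_eq_of_hasEigenvalue {μ : ℂ} (h : D.cenReg.HasEigenvalue μ) : conj μ = μ := by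
  obtain ⟨f, hf⟩ := h.exists_hasEigenvector
  have h1 : ∀ w, D.cenReg f w = μ * f w := fun w => congrFun hf.apply_eq_smul w
  set S := ∑ w, conj (f w) * D.cenReg f w with hS
  set N : ℝ := ∑ w, Complex.normSq (f w) with hN
  have hSN : S = μ * N := by
    rw [hS, hN, Complex.ofReal_sum, Finset.mul_sum]
    refine Finset.sum_congr rfl fun w _ => ?_
    rw [h1, Complex.normSq_eq_conj_mul_self]
    ring
  have hN0 : (N : ℂ) ≠ 0 := by
    rw [Complex.ofReal_ne_zero]
    refine (Finset.sum_pos' (fun w _ => Complex.normSq_nonneg _) ?_).ne'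
    obtain ⟨w, hw⟩ := Function.ne_iff.1 hf.2
    exact ⟨w, Finset.mem_univ _, Complex.normSq_pos.2 hw⟩
  -- This is self-adjointness of z for the standard Hermitian form: the adjoint of translation by r
  -- is translation by r⁻¹, and the coefficients of r and r⁻¹ are conjugate.
  have hconj : conj S = S := by
    have e1 : S = ∑ r : D.R, D.c r.1 * ∑ w, conj (f w) * (f w - f (r.1⁻¹ * w)) := by
      simp only [hS, cenReg_apply, Finset.mul_sum]
      rw [Finset.sum_comm]
      refine Finset.sum_congr rfl fun r _ => Finset.sum_congr rfl fun w _ => ?_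
      ring
    rw [e1, map_sum, ← R.inv.sum_comp]
    refine Finset.sum_congr rfl fun r _ => ?_
    have h2 : (R.inv r).1 = r.1⁻¹ := rfl
    rw [map_mul, h2, D.c_inv r.1 r.2, Complex.conj_conj, inv_inv, map_sum]
    congr 1
    simp only [map_mul, map_sub, Complex.conj_conj, mul_sub, Finset.sum_sub_distrib]
    congr 1
    · exact Finset.sum_congr rfl fun w _ => mul_comm _ _
    · rw [← Equiv.sum_comp (Equiv.mulLeft r.1⁻¹)]
      refine Finset.sum_congr rfl fun w _ => ?_
      rw [Equiv.coe_mulLeft, mul_inv_cancel_left, mul_comm]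
  rw [hSN, map_mul, Complex.conj_ofReal] at hconj
  exact mul_right_cancel₀ hN0 hconj

/-- Left multiplication by z on combinations of group elements is given on coefficients by `cenReg`.
The minimal polynomial of that operator splits with real roots, and substituting z into it gives
zero, as one sees by letting it act on the identity element. -/
lemma exists_roots : ∃ L : List ℂ, (∀ s ∈ L, conj s = s) ∧
    (L.map fun s => D.cen - algebraMap ℂ D.H s).prod = 0 := by
  classical
  set p := minpoly ℂ D.cenReg with hp
  have hmonic : p.Monic := minpoly.monic (Algebra.IsIntegral.isIntegral D.cenReg)
  refine ⟨p.roots.toList, fun s hs => D.conj_eq_of_hasEigenvalue ?_, ?_⟩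
  · exact Module.End.hasEigenvalue_of_isRoot
      (Polynomial.isRoot_of_mem_roots (Multiset.mem_toList.1 hs))
  · have h1 : (p.roots.toList.map fun s => Polynomial.X - Polynomial.C s).prod = p := by
      rw [← Multiset.prod_coe, ← Multiset.map_coe, Multiset.coe_toList]
      exact ((IsAlgClosed.splits p).eq_prod_roots_of_monic hmonic).symm
    have h2 := congrArg (Polynomial.aeval D.cen) h1
    rw [map_list_prod, List.map_map] at h2
    have h3 : ((Polynomial.aeval D.cen) ∘ fun s => Polynomial.X - Polynomial.C s : ℂ → D.H) =
        fun s => D.cen - algebraMap ℂ D.H s := by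
      funext s
      simp
    rw [h3] at h2
    rw [h2]
    let L : (D.W → ℂ) →ₗ[ℂ] D.H :=
      { toFun f := ∑ w, f w • D.grp w
        map_add' f g := by simp [add_smul, Finset.sum_add_distrib]
        map_smul' a f := by simp [mul_smul, Finset.smul_sum] }
    have hL : ∀ f, L (D.cenReg f) = D.cen * L f := by
      intro f
      change ∑ w, D.cenReg f w • D.grp w = D.cen * ∑ w, f w • D.grp w
      simp only [cen, cenReg_apply, Finset.sum_mul, Finset.sum_smul]
      rw [Finset.sum_comm]
      refine Finset.sum_congr rfl fun r _ => ?_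
      rw [smul_mul_assoc, sub_mul, one_mul, smul_sub, Finset.mul_sum, Finset.smul_sum,
        Finset.smul_sum, ← Equiv.sum_comp (Equiv.mulLeft r.1⁻¹) (fun w => D.c r.1 • (D.grp r.1 *
          f w • D.grp w)), ← Finset.sum_sub_distrib]
      refine Finset.sum_congr rfl fun w _ => ?_
      rw [Equiv.coe_mulLeft, mul_smul_comm, ← map_mul, mul_inv_cancel_left, mul_sub, sub_smul,
        mul_smul, mul_smul]
    have hL2 : ∀ (q : Polynomial ℂ) (f : D.W → ℂ),
        L (Polynomial.aeval D.cenReg q f) = Polynomial.aeval D.cen q * L f := by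
      intro q
      induction q using Polynomial.induction_on' with
      | add p q hp hq =>
        intro f
        rw [map_add, map_add, LinearMap.add_apply, map_add, hp, hq, add_mul]
      | monomial n a =>
        have : ∀ f, L ((D.cenReg ^ n) f) = D.cen ^ n * L f := by
          induction n with
          | zero => intro f; simp
          | succ n ih =>
            intro f
            rw [pow_succ', Module.End.mul_apply, hL, ih, pow_succ', mul_assoc]
        intro f
        rw [Polynomial.aeval_monomial, Polynomial.aeval_monomial, ← Algebra.smul_def,
          ← Algebra.smul_def, LinearMap.smul_apply, map_smul, this, smul_mul_assoc]
    have h4 := hL2 p (Pi.single 1 1)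
    have h5 : L (Pi.single 1 1) = 1 := by
      change ∑ w, (Pi.single 1 1 : D.W → ℂ) w • D.grp w = 1
      rw [Finset.sum_eq_single 1] <;> simp +contextual
    rw [h5, mul_one, hp, minpoly.aeval, LinearMap.zero_apply, map_zero] at h4
    exact h4.symm

/-- The roots of a polynomial annihilating the central element. -/
def cenRoots : List ℂ := D.exists_roots.choose

lemma conj_cenRoots {s : ℂ} (hs : s ∈ D.cenRoots) : conj s = s :=
  D.exists_roots.choose_spec.1 s hs

lemma prod_cenRoots : (D.cenRoots.map fun s => D.cen - algebraMap ℂ D.H s).prod = 0 :=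
  D.exists_roots.choose_spec.2

/-- The complex numbers which can be weights of modules in category `O`. -/
def wts : Set ℂ := {d | ∃ s ∈ D.cenRoots, ∃ n : ℕ, d = s + n}

variable {D}

lemma conj_wts {d : ℂ} (hd : d ∈ D.wts) : conj d = d := by
  obtain ⟨s, hs, n, rfl⟩ := hd
  rw [map_add, D.conj_cenRoots hs, Complex.conj_natCast]

lemma wts_add_one {d : ℂ} (hd : d ∈ D.wts) : d + 1 ∈ D.wts := by
  obtain ⟨s, hs, n, rfl⟩ := hd
  exact ⟨s, hs, n + 1, by push_cast; ring⟩

lemma cenRoots_mem_wts {s : ℂ} (hs : s ∈ D.cenRoots) : s ∈ D.wts := ⟨s, hs, 0, by simp⟩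

variable (D) in
lemma exists_lower_bound : ∃ b : ℝ, ∀ d ∈ D.wts, b ≤ d.re := by
  obtain ⟨b, hb⟩ : ∃ b : ℝ, ∀ s ∈ D.cenRoots, b ≤ s.re := by
    induction D.cenRoots with
    | nil => exact ⟨0, by simp⟩
    | cons s L ih =>
      obtain ⟨b, hb⟩ := ih
      refine ⟨min s.re b, fun t ht => ?_⟩
      rcases List.mem_cons.1 ht with rfl | h
      · exact min_le_left _ _
      · exact (min_le_right _ _).trans (hb t h)
  refine ⟨b, ?_⟩
  rintro _ ⟨s, hs, n, rfl⟩
  rw [Complex.add_re, Complex.natCast_re]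
  exact (hb s hs).trans (le_add_of_nonneg_right n.cast_nonneg)

/-- The subtraction of large natural numbers leads out of the set of possible weights. -/
lemma exists_notMem_wts (d : ℂ) : ∃ k : ℕ, ∀ n : ℕ, k ≤ n → d - n ∉ D.wts := by
  obtain ⟨b, hb⟩ := D.exists_lower_bound
  obtain ⟨k, hk⟩ := exists_nat_gt (d.re - b)
  refine ⟨k, fun n hn h => ?_⟩
  have h1 := hb _ h
  rw [Complex.sub_re, Complex.natCast_re] at h1
  have h2 : (k : ℝ) ≤ n := Nat.cast_le.2 hn
  linarith

end CentralElement

/-! ### The filtration by the number of Dunkl operators needed to kill an element. -/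

section Level

variable (D) (M : Type*) [AddCommGroup M] [Module D.H M] [Module ℂ M] [IsScalarTower ℂ D.H M]

/-- The elements killed by all products of `k` Dunkl operators. -/
def lev : ℕ → Submodule ℂ M
  | 0 => ⊥
  | k + 1 => ⨅ v : V, (lev k).comap (Algebra.lsmul ℂ ℂ M (D.dun v))

variable {D M}

lemma mem_lev_zero {m : M} : m ∈ D.lev M 0 ↔ m = 0 := Submodule.mem_bot ℂ

lemma mem_lev_succ {k : ℕ} {m : M} : m ∈ D.lev M (k + 1) ↔ ∀ v, D.dun v • m ∈ D.lev M k :=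
  Submodule.mem_iInf _

lemma lev_le_succ (k : ℕ) : D.lev M k ≤ D.lev M (k + 1) := by
  induction k with
  | zero => exact bot_le
  | succ k ih => exact fun m hm => mem_lev_succ.2 fun v => ih (mem_lev_succ.1 hm v)

lemma lev_mono : Monotone (D.lev M) := monotone_nat_of_le_succ lev_le_succ

lemma dun_mem_lev {k : ℕ} (v : V) {m : M} (hm : m ∈ D.lev M k) : D.dun v • m ∈ D.lev M k :=
  mem_lev_succ.1 (lev_le_succ k hm) v

lemma grp_mem_lev {k : ℕ} (w : D.W) {m : M} (hm : m ∈ D.lev M k) : D.grp w • m ∈ D.lev M k := by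
  induction k generalizing m with
  | zero => rw [mem_lev_zero] at hm ⊢; rw [hm, smul_zero]
  | succ k ih =>
    refine mem_lev_succ.2 fun v => ?_
    rw [← mul_smul, dun_grp, mul_smul]
    exact ih (mem_lev_succ.1 hm _)

lemma cen_mem_lev {k : ℕ} {m : M} (hm : m ∈ D.lev M k) : D.cen • m ∈ D.lev M k := by
  rw [cen, Finset.sum_smul]
  refine sum_mem fun r _ => ?_
  rw [smul_assoc, sub_smul, one_smul]
  exact Submodule.smul_mem _ _ (sub_mem hm (grp_mem_lev _ hm))

/-- The commutator of a Dunkl operator with a linear form is a combination of group elements, and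
these preserve the filtration. -/
lemma pol_mem_lev {k : ℕ} (l : Module.Dual ℂ V) {m : M} (hm : m ∈ D.lev M k) :
    D.pol (linPoly l) • m ∈ D.lev M (k + 1) := by
  induction k generalizing m with
  | zero => rw [mem_lev_zero] at hm; rw [hm, smul_zero]; exact zero_mem _
  | succ k ih =>
    refine mem_lev_succ.2 fun v => ?_
    have h := congrArg (· • m) (D.rels.Y_X v l)
    simp only [sub_smul, add_smul, Finset.sum_smul, mul_smul, smul_assoc, algebraMap_smul] at h
    change D.dun v • D.pol (linPoly l) • m = D.pol (linPoly l) • D.dun v • m + _ - _ at h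
    rw [h]
    refine sub_mem (add_mem (ih (mem_lev_succ.1 hm v)) (Submodule.smul_mem _ _ hm))
      (sum_mem fun r _ => ?_)
    exact Submodule.smul_mem _ _ (sub_mem (Submodule.smul_mem _ _ (grp_mem_lev r.1 hm))
      (Submodule.smul_mem _ _ (grp_mem_lev r.1 hm)))

lemma pow_smul_eq_zero_of_mem_lev {k : ℕ} {m : M} (hm : m ∈ D.lev M k) (v : V) :
    D.dun v ^ k • m = 0 := by
  induction k generalizing m with
  | zero => rw [pow_zero, one_smul]; exact mem_lev_zero.1 hm
  | succ k ih => rw [pow_succ, mul_smul]; exact ih (mem_lev_succ.1 hm v)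

variable [FiniteDimensional ℂ V]

lemma mem_lev_succ_basis {k : ℕ} {m : M} (h : ∀ i, D.dun (Module.finBasis ℂ V i) • m ∈ D.lev M k) :
    m ∈ D.lev M (k + 1) := by
  refine mem_lev_succ.2 fun v => ?_
  rw [← (Module.finBasis ℂ V).sum_repr v, map_sum, Finset.sum_smul]
  refine sum_mem fun i _ => ?_
  rw [map_smul, smul_assoc]
  exact Submodule.smul_mem _ _ (h i)

/-- If the Dunkl operators act locally nilpotently, each element is killed by all products of
sufficiently many Dunkl operators. -/
lemma LocNilp.exists_mem_lev (hM : D.LocNilp M) (m : M) : ∃ k, m ∈ D.lev M k := by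
  -- Induction on the sum of exponents n_i with D_i^(n_i) m = 0: applying D_i lowers n_i by one and,
  -- since the Dunkl operators commute, the other exponents still work.
  have key : ∀ (K : ℕ) (n : Fin (Module.finrank ℂ V) → ℕ) (m : M), ∑ i, n i = K →
      (∀ i, D.dun (Module.finBasis ℂ V i) ^ n i • m = 0) → ∃ k, m ∈ D.lev M k := by
    intro K
    induction K with
    | zero =>
      intro n m hn h
      refine ⟨1, mem_lev_succ_basis fun i => ?_⟩
      have h0 := h i
      rw [(Finset.sum_eq_zero_iff.1 hn) i (Finset.mem_univ i), pow_zero, one_smul] at h0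
      rw [h0, smul_zero]
      exact zero_mem _
    | succ K ih =>
      intro n m hn h
      have h1 : ∀ i, ∃ k, D.dun (Module.finBasis ℂ V i) • m ∈ D.lev M k := by
        intro i
        by_cases hi : n i = 0
        · refine ⟨0, ?_⟩
          have h0 := h i
          rw [hi, pow_zero, one_smul] at h0
          rw [h0, smul_zero]
          exact zero_mem _
        · refine ih (Function.update n i (n i - 1)) _ ?_ fun j => ?_
          · rw [Finset.sum_update_of_mem (Finset.mem_univ i)]
            rw [← Finset.add_sum_erase _ _ (Finset.mem_univ i)] at hn
            rw [← Finset.erase_eq]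
            omega
          · by_cases hj : j = i
            · subst hj
              rw [Function.update_self, ← mul_smul, ← pow_succ, Nat.sub_add_cancel (by omega)]
              exact h j
            · have hc : Commute (D.dun (Module.finBasis ℂ V i)) (D.dun (Module.finBasis ℂ V j)) :=
                dun_comm _ _
              rw [Function.update_of_ne hj, ← mul_smul, ← (hc.pow_right _).eq, mul_smul, h j,
                smul_zero]
      choose k hk using h1
      exact ⟨_, mem_lev_succ_basis fun i =>
        lev_mono (Finset.le_sup (f := k) (Finset.mem_univ i)) (hk i)⟩
  choose n hn using fun i => hM (Module.finBasis ℂ V i) m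
  exact key _ n m rfl hn

end Level

end Datum

/-! ### The Euler element and its invariance under the anti-automorphism. -/

namespace Datum

variable {V : Type u} [AddCommGroup V] [Module ℂ V] [FiniteDimensional ℂ V] {D : Datum V}

lemma eu_eq : D.eu = ∑ i, D.pol (linPoly ((Module.finBasis ℂ V).coord i)) *
    D.dun (Module.finBasis ℂ V i) + D.cen := by
  apply D.op_injective
  rw [map_add, map_sum, cen, map_sum]
  refine (euler_eq (D := D)).trans ?_
  congr 1

/-- The anti-automorphism sends ∑ x_i D_i to the sum of (J b_i) times the Dunkl operator of J⁻¹ x_i.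
This is again the canonical element of V* ⊗ V, because J is Hermitian. The summand z is fixed since
c(r⁻¹) = conj c(r). -/
lemma Bar.map_eu {J : HermitianIso D} (σ : Bar J) : σ.toFun D.eu = D.eu := by
  set b := Module.finBasis ℂ V with hb
  have h1 : σ.toFun D.cen = D.cen := by
    rw [cen, σ.map_sum, ← R.inv.sum_comp]
    refine Finset.sum_congr rfl fun r _ => ?_
    have h2 : (R.inv r).1 = r.1⁻¹ := rfl
    rw [σ.map_smul, σ.map_sub, σ.map_one, h2, D.c_inv r.1 r.2, Complex.conj_conj, σ.map_grp,
      inv_inv]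
  have h2 : ∀ l : Module.Dual ℂ V, σ.toFun (D.rels.X l) = D.dun (J.toEquiv.symm l) := fun l => by
    obtain ⟨u, rfl⟩ := J.toEquiv.surjective l
    rw [LinearEquiv.symm_apply_apply]
    exact σ.map_pol u
  have h3 : ∀ v : V, σ.toFun (D.dun v) = D.rels.X (J.toEquiv v) := σ.map_dun
  conv_lhs => rw [eu_eq, σ.map_add, h1, σ.map_sum]
  rw [eu_eq]
  congr 1
  change ∑ i, σ.toFun (D.rels.X (b.coord i) * _) = ∑ i, D.rels.X (b.coord i) * _
  have h4 : ∀ i, σ.toFun (D.rels.X (b.coord i) * D.dun (b i)) =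
      ∑ j, D.rels.X (b.coord j) * (J.toEquiv (b i) (b j) • D.dun (J.toEquiv.symm (b.coord i))) := by
    intro i
    rw [σ.map_mul, h2, h3, Rels.X_eq_sum, Finset.sum_mul]
    refine Finset.sum_congr rfl fun j _ => ?_
    rw [smul_mul_assoc, mul_smul_comm]
  rw [Finset.sum_congr rfl fun i _ => h4 i, Finset.sum_comm]
  refine Finset.sum_congr rfl fun j _ => ?_
  rw [← Finset.mul_sum]
  congr 1
  have h5 : b j = ∑ i, J.toEquiv (b i) (b j) • J.toEquiv.symm (b.coord i) := by
    apply J.toEquiv.injective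
    conv_lhs => rw [← b.sum_dual_apply_smul_coord (J.toEquiv (b j))]
    rw [_root_.map_sum]
    refine Finset.sum_congr rfl fun i _ => ?_
    rw [LinearEquiv.map_smulₛₗ, LinearEquiv.apply_symm_apply, ← J.hermitian]
  conv_rhs => rw [h5, _root_.map_sum]
  simp only [_root_.map_smul]

/-! ### Decomposition into weight spaces and finiteness of these. -/

section WeightSpaces

variable {M : Type u} [AddCommGroup M] [Module D.H M] [Module ℂ M] [IsScalarTower ℂ D.H M]
variable {N : Type u} [AddCommGroup N] [Module D.H N] [Module ℂ N] [IsScalarTower ℂ D.H N]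

lemma mem_weight_iff {d : ℂ} {m : M} :
    m ∈ D.weight M d ↔ ∃ k : ℕ, (D.eu - algebraMap ℂ D.H d) ^ k • m = 0 := by
  rw [weight, Module.End.mem_maxGenEigenspace]
  refine exists_congr fun k => ?_
  have := congrArg (fun T : Module.End ℂ M => T m)
    (map_pow (Algebra.lsmul ℂ ℂ M) (D.eu - algebraMap ℂ D.H d) k)
  rw [map_sub, AlgHom.commutes, Algebra.algebraMap_eq_smul_one] at this
  exact Eq.congr_left this.symm

omit [Module ℂ M] [IsScalarTower ℂ D.H M] in
lemma eu_smul_eq (m : M) : D.eu • m = ∑ i, D.pol (linPoly ((Module.finBasis ℂ V).coord i)) •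
    D.dun (Module.finBasis ℂ V i) • m + D.cen • m := by
  conv_lhs => rw [eu_eq, add_smul, Finset.sum_smul]
  simp only [mul_smul]

lemma iSupIndep_weight : iSupIndep (D.weight M) :=
  Module.End.independent_maxGenEigenspace _

lemma weight_disjoint {d e : ℂ} (h : d ≠ e) {m : M} (hd : m ∈ D.weight M d)
    (he : m ∈ D.weight M e) : m = 0 :=
  Submodule.disjoint_def.1 (iSupIndep_weight.pairwiseDisjoint h) m hd he

lemma eu_sub_mem_weight {d : ℂ} (s : ℂ) {m : M} (hm : m ∈ D.weight M d) :
    (D.eu - algebraMap ℂ D.H s) • m ∈ D.weight M d := by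
  have h1 : D.eu • m ∈ D.weight M d := by
    have := weight_shift (h := D.eu) (a := 0) (by rw [map_zero, add_zero]) hm
    rwa [add_zero] at this
  rw [sub_smul, algebraMap_smul]
  exact sub_mem h1 (Submodule.smul_mem _ _ hm)

lemma prod_eu_sub_mem_weight {d : ℂ} (L : List ℂ) {m : M} (hm : m ∈ D.weight M d) :
    (L.map fun s => D.eu - algebraMap ℂ D.H s).prod • m ∈ D.weight M d := by
  induction L with
  | nil => simpa using hm
  | cons t L ih =>
    rw [List.map_cons, List.prod_cons, mul_smul]
    exact eu_sub_mem_weight t ih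

/-- Each factor eu - s preserves the weight space, and its kernel lies in the weight space of s,
which meets that of d ≠ s trivially. -/
lemma prod_eu_sub_injective {d : ℂ} {L : List ℂ} (hd : d ∉ L) {m : M} (hm : m ∈ D.weight M d)
    (h : (L.map fun s => D.eu - algebraMap ℂ D.H s).prod • m = 0) : m = 0 := by
  induction L with
  | nil => simpa using h
  | cons s L ih =>
    rw [List.mem_cons, not_or] at hd
    refine ih hd.2 (weight_disjoint hd.1 (prod_eu_sub_mem_weight L hm) (mem_weight_iff.2 ⟨1, ?_⟩))
    rw [pow_one, ← mul_smul]
    rwa [List.map_cons, List.prod_cons] at h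

/-- The sum of the weight spaces for the weights which can occur in category `O`. -/
def wtSum (M : Type u) [AddCommGroup M] [Module D.H M] [Module ℂ M] [IsScalarTower ℂ D.H M] :
    Submodule ℂ M := ⨆ d ∈ D.wts, D.weight M d

lemma wtSum_pol (l : Module.Dual ℂ V) {m : M} (hm : m ∈ D.wtSum M) :
    D.pol (linPoly l) • m ∈ D.wtSum M := by
  rw [wtSum, iSup_subtype'] at hm
  induction hm using Submodule.iSup_induction' with
  | mem d x hx =>
    exact (le_biSup (D.weight M) (wts_add_one d.2)) (weight_pol l hx)
  | zero => rw [smul_zero]; exact zero_mem _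
  | add x y _ _ h1 h2 => rw [smul_add]; exact add_mem h1 h2

lemma wtSum_eu_sub (s : ℂ) {m : M} (hm : m ∈ D.wtSum M) :
    (D.eu - algebraMap ℂ D.H s) • m ∈ D.wtSum M := by
  rw [wtSum, iSup_subtype'] at hm
  induction hm using Submodule.iSup_induction' with
  | mem d x hx => exact (le_biSup (D.weight M) d.2) (eu_sub_mem_weight s hx)
  | zero => rw [smul_zero]; exact zero_mem _
  | add x y _ _ h1 h2 => rw [smul_add]; exact add_mem h1 h2

lemma wtSum_of_prod {L : List ℂ} (hL : ∀ s ∈ L, s ∈ D.wts) {m : M}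
    (h : (L.map fun s => D.eu - algebraMap ℂ D.H s).prod • m ∈ D.wtSum M) : m ∈ D.wtSum M := by
  induction L with
  | nil => simpa using h
  | cons s L ih =>
    refine ih (fun t ht => hL t (List.mem_cons_of_mem _ ht)) ?_
    refine mem_iSup_maxGenEigenspace _ _ (hL s List.mem_cons_self) ?_
    rw [List.map_cons, List.prod_cons, mul_smul, sub_smul, algebraMap_smul] at h
    exact h

/-- Induction on k. On level k + 1 the operator eu - z = ∑ x_i D_i has values in the sum of weight
spaces, since D_i drops to level k and multiplication by x_i raises a weight by one, which stays in
`wts`. Modulo that sum, the product of the eu - s over the roots acts like the product of the z - s,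
which is zero; `wtSum_of_prod` then removes the factors one by one. -/
lemma lev_le_wtSum (k : ℕ) : D.lev M k ≤ D.wtSum M := by
  induction k with
  | zero => exact bot_le
  | succ k ih =>
    have h1 : ∀ m ∈ D.lev M (k + 1), ∀ L : List ℂ,
        (L.map fun s => D.cen - algebraMap ℂ D.H s).prod • m ∈ D.lev M (k + 1) ∧
        (L.map fun s => D.eu - algebraMap ℂ D.H s).prod • m -
          (L.map fun s => D.cen - algebraMap ℂ D.H s).prod • m ∈ D.wtSum M := by
      intro m hm L
      induction L with
      | nil => simpa using hm
      | cons s L ih2 =>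
        obtain ⟨h1, h2⟩ := ih2
        simp only [List.map_cons, List.prod_cons, mul_smul]
        set p := (L.map fun s => D.eu - algebraMap ℂ D.H s).prod • m
        set q := (L.map fun s => D.cen - algebraMap ℂ D.H s).prod • m
        refine ⟨?_, ?_⟩
        · rw [sub_smul, algebraMap_smul]
          exact sub_mem (cen_mem_lev h1) (Submodule.smul_mem _ _ h1)
        · have h3 : (D.eu - algebraMap ℂ D.H s) • p - (D.cen - algebraMap ℂ D.H s) • q =
              (D.eu - algebraMap ℂ D.H s) • (p - q) + (D.eu • q - D.cen • q) := by
            simp only [smul_sub, sub_smul]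
            abel
          rw [h3]
          refine add_mem (wtSum_eu_sub s h2) ?_
          rw [eu_smul_eq, add_sub_cancel_right]
          exact sum_mem fun i _ => wtSum_pol _ (ih (mem_lev_succ.1 h1 _))
    intro m hm
    have h2 := (h1 m hm D.cenRoots).2
    rw [prod_cenRoots, zero_smul, sub_zero] at h2
    exact wtSum_of_prod (fun s => cenRoots_mem_wts) h2

lemma LocNilp.wtSum_eq_top (hM : D.LocNilp M) : D.wtSum M = ⊤ := by
  rw [eq_top_iff]
  intro m _
  obtain ⟨k, hk⟩ := hM.exists_mem_lev m
  exact lev_le_wtSum k hk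

/-- The weights of the elements killed by all Dunkl operators are roots of the polynomial
annihilating the central element. -/
lemma eq_zero_of_mem_inv {d : ℂ} (hd : d ∉ D.cenRoots) {m : M} (hm : m ∈ D.weight M d)
    (h : ∀ v, D.dun v • m = 0) : m = 0 := by
  refine prod_eu_sub_injective hd hm ?_
  -- On elements killed by all Dunkl operators eu acts as z, and z preserves these elements. Hence
  -- the product over the roots kills m, although it is injective on the weight space of a d that is
  -- not a root.
  have h1 : ∀ L : List ℂ,
      (L.map fun s => D.eu - algebraMap ℂ D.H s).prod • m =
        (L.map fun s => D.cen - algebraMap ℂ D.H s).prod • m ∧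
      (L.map fun s => D.cen - algebraMap ℂ D.H s).prod • m ∈ D.lev M 1 := by
    intro L
    induction L with
    | nil =>
      simp only [List.map_nil, List.prod_nil, one_smul, true_and]
      exact mem_lev_succ.2 fun v => mem_lev_zero.2 (h v)
    | cons s L ih =>
      obtain ⟨h2, h3⟩ := ih
      simp only [List.map_cons, List.prod_cons, mul_smul]
      rw [h2]
      set q := (L.map fun s => D.cen - algebraMap ℂ D.H s).prod • m
      refine ⟨?_, ?_⟩
      · rw [sub_smul, sub_smul, eu_smul_eq, Finset.sum_eq_zero, zero_add]
        intro i _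
        rw [mem_lev_zero.1 (mem_lev_succ.1 h3 _), smul_zero]
      · rw [sub_smul, algebraMap_smul]
        exact sub_mem (cen_mem_lev h3) (Submodule.smul_mem _ _ h3)
  rw [(h1 D.cenRoots).1, prod_cenRoots, zero_smul]

/-- All weights of modules with locally nilpotent action of the Dunkl operators are real. -/
lemma LocNilp.mem_wts (hM : D.LocNilp M) {d : ℂ} {m : M} (hm : m ∈ D.weight M d) (h0 : m ≠ 0) :
    d ∈ D.wts := by
  by_contra hd
  -- If d were not a possible weight, the weight spaces for the other eigenvalues would already span
  -- M, contradicting their independence from that of d.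
  have h1 : D.wtSum M ≤ ⨆ e ≠ d, D.weight M e :=
    iSup₂_le fun e he => le_iSup₂_of_le e (fun h => hd (h ▸ he)) le_rfl
  rw [hM.wtSum_eq_top] at h1
  exact h0 (Submodule.disjoint_def.1 (iSupIndep_weight d) m hm (h1 trivial))

variable (D) in
/-- The module is the sum of its weight spaces. -/
def IsWt (M : Type u) [AddCommGroup M] [Module D.H M] [Module ℂ M] [IsScalarTower ℂ D.H M] : Prop :=
  ⨆ d, D.weight M d = ⊤

lemma LocNilp.isWt (hM : D.LocNilp M) : D.IsWt M := by
  rw [IsWt, eq_top_iff, ← hM.wtSum_eq_top]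
  exact iSup₂_le fun d _ => le_iSup (D.weight M) d

lemma IsWt.isInternal (h : D.IsWt M) : DirectSum.IsInternal (D.weight M) :=
  DirectSum.isInternal_submodule_of_iSupIndep_of_iSup_eq_top iSupIndep_weight h

/-- The projection to a weight space. -/
def IsWt.proj (h : D.IsWt M) (d : ℂ) : M →ₗ[ℂ] M :=
  (D.weight M d).subtype ∘ₗ DirectSum.component ℂ ℂ (fun d => D.weight M d) d ∘ₗ
    (LinearEquiv.ofBijective (DirectSum.coeLinearMap (D.weight M)) h.isInternal).symm.toLinearMap

lemma IsWt.proj_mem (h : D.IsWt M) (d : ℂ) (m : M) : h.proj d m ∈ D.weight M d :=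
  Subtype.property _

lemma IsWt.symm_apply (h : D.IsWt M) {d : ℂ} {m : M} (hm : m ∈ D.weight M d) :
    (LinearEquiv.ofBijective (DirectSum.coeLinearMap (D.weight M)) h.isInternal).symm m =
      DirectSum.lof ℂ ℂ (fun d => D.weight M d) d ⟨m, hm⟩ := by
  rw [LinearEquiv.symm_apply_eq]
  exact (DirectSum.coeLinearMap_lof (D.weight M) d ⟨m, hm⟩).symm

lemma IsWt.proj_of_mem (h : D.IsWt M) {d : ℂ} {m : M} (hm : m ∈ D.weight M d) :
    h.proj d m = m := by
  simp [proj, h.symm_apply hm, DirectSum.component.lof_self]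

lemma IsWt.proj_of_mem_ne (h : D.IsWt M) {d e : ℂ} {m : M} (hm : m ∈ D.weight M e) (hne : e ≠ d) :
    h.proj d m = 0 := by
  simp [proj, h.symm_apply hm, DirectSum.component.of, hne]

lemma IsWt.induction (h : D.IsWt M) {p : M → Prop} (hw : ∀ d, ∀ m ∈ D.weight M d, p m)
    (hadd : ∀ x y, p x → p y → p (x + y)) (m : M) : p m := by
  have hm : m ∈ ⨆ d, D.weight M d := by rw [h]; trivial
  induction hm using Submodule.iSup_induction' with
  | mem d x hx => exact hw d x hx
  | zero => exact hw 0 0 (zero_mem _)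
  | add x y _ _ h1 h2 => exact hadd x y h1 h2

/-- Equality of additive maps on modules which are sums of weight spaces. -/
lemma IsWt.ext_of_weight (h : D.IsWt M) {P : Type*} [AddCommGroup P] {f g : M → P}
    (hf : ∀ x y, f (x + y) = f x + f y) (hg : ∀ x y, g (x + y) = g x + g y)
    (hw : ∀ d, ∀ m ∈ D.weight M d, f m = g m) (m : M) : f m = g m :=
  h.induction hw (fun x y h1 h2 => by rw [hf, hg, h1, h2]) m

/-- Allowing every larger finite set makes it possible to treat a sum of two elements over the union
of their supports. -/
lemma IsWt.exists_sum (h : D.IsWt M) (m : M) :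
    ∃ s : Finset ℂ, ∀ t : Finset ℂ, s ⊆ t → ∑ d ∈ t, h.proj d m = m := by
  classical
  induction m using h.induction with
  | hw d m hm =>
    refine ⟨{d}, fun t ht => ?_⟩
    rw [Finset.sum_eq_single d (fun e _ hne => h.proj_of_mem_ne hm hne.symm)
      (fun hd => absurd (ht (Finset.mem_singleton_self d)) hd), h.proj_of_mem hm]
  | hadd x y hx hy =>
    obtain ⟨s, hs⟩ := hx
    obtain ⟨s', hs'⟩ := hy
    refine ⟨s ∪ s', fun t ht => ?_⟩
    simp only [map_add, Finset.sum_add_distrib]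
    rw [hs t (Finset.subset_union_left.trans ht), hs' t (Finset.subset_union_right.trans ht)]

lemma IsWt.map_proj (h : D.IsWt M) (h' : D.IsWt N) (f : M →ₗ[D.H] N) (d : ℂ) (m : M) :
    f (h.proj d m) = h'.proj d (f m) := by
  refine h.ext_of_weight (f := fun m => f (h.proj d m)) (g := fun m => h'.proj d (f m))
    (fun _ _ => by simp only [map_add]) (fun _ _ => by simp only [map_add]) (fun e m hm => ?_) m
  by_cases hde : e = d
  · subst hde
    simp only [h.proj_of_mem hm, h'.proj_of_mem (weight_map f hm)]
  · simp only [h.proj_of_mem_ne hm hde, h'.proj_of_mem_ne (weight_map f hm) hde, map_zero]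

lemma IsWt.proj_pol (h : D.IsWt M) (l : Module.Dual ℂ V) (d : ℂ) (m : M) :
    h.proj d (D.pol (linPoly l) • m) = D.pol (linPoly l) • h.proj (d - 1) m := by
  refine h.ext_of_weight (f := fun m => h.proj d (D.pol (linPoly l) • m))
    (g := fun m => D.pol (linPoly l) • h.proj (d - 1) m)
    (fun _ _ => by simp only [map_add, smul_add]) (fun _ _ => by simp only [map_add, smul_add])
    (fun e m hm => ?_) m
  by_cases hde : e = d - 1
  · subst hde
    have := weight_pol l hm
    rw [sub_add_cancel] at this
    simp only [h.proj_of_mem hm, h.proj_of_mem this]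
  · have h1 : e + 1 ≠ d := fun h => hde (eq_sub_of_add_eq h)
    simp only [h.proj_of_mem_ne hm hde, h.proj_of_mem_ne (weight_pol l hm) h1, smul_zero]

lemma IsWt.proj_grp (h : D.IsWt M) (w : D.W) (d : ℂ) (m : M) :
    h.proj d (D.grp w • m) = D.grp w • h.proj d m := by
  refine h.ext_of_weight (f := fun m => h.proj d (D.grp w • m))
    (g := fun m => D.grp w • h.proj d m)
    (fun _ _ => by simp only [map_add, smul_add]) (fun _ _ => by simp only [map_add, smul_add])
    (fun e m hm => ?_) m
  by_cases hde : e = d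
  · subst hde
    simp only [h.proj_of_mem hm, h.proj_of_mem (weight_grp w hm)]
  · simp only [h.proj_of_mem_ne hm hde, h.proj_of_mem_ne (weight_grp w hm) hde, smul_zero]

/-- The projection to weight d fixes or kills each of the homogeneous spanning vectors. Indices of
zero vectors are excluded from the index set because only then is it finite in the application. -/
lemma IsWt.weight_le_span (h : D.IsWt M) {ι : Type*} (v : ι → M) (δ : ι → ℂ)
    (hv : ∀ i, v i ∈ D.weight M (δ i)) (hspan : Submodule.span ℂ (Set.range v) = ⊤) (d : ℂ) :
    D.weight M d ≤ Submodule.span ℂ (v '' {i | δ i = d ∧ v i ≠ 0}) := by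
  intro m hm
  have h1 : m ∈ Submodule.span ℂ (Set.range v) := by rw [hspan]; trivial
  have h2 : ∀ m ∈ Submodule.span ℂ (Set.range v),
      h.proj d m ∈ Submodule.span ℂ (v '' {i | δ i = d ∧ v i ≠ 0}) := by
    intro m hm
    induction hm using Submodule.span_induction with
    | zero => rw [map_zero]; exact zero_mem _
    | add x y _ _ h1 h2 => rw [map_add]; exact add_mem h1 h2
    | smul a x _ h1 => rw [map_smul]; exact Submodule.smul_mem _ _ h1
    | mem x hx =>
      obtain ⟨i, rfl⟩ := hx
      by_cases hi : δ i = d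
      · have := hv i
        rw [hi] at this
        rw [h.proj_of_mem this]
        by_cases h0 : v i = 0
        · rw [h0]
          exact zero_mem _
        · exact Submodule.subset_span ⟨i, ⟨hi, h0⟩, rfl⟩
      · rw [h.proj_of_mem_ne (hv i) hi]
        exact zero_mem _
  rw [← h.proj_of_mem hm]
  exact h2 m h1

/-- A finitely generated module which is the sum of its weight spaces is generated by finitely many
weight vectors. -/
lemma IsWt.exists_generators (h : D.IsWt M) [Module.Finite D.H M] :
    ∃ T : Finset (ℂ × M), (∀ p ∈ T, p.2 ∈ D.weight M p.1) ∧
      Submodule.span D.H (Prod.snd '' (T : Set (ℂ × M))) = ⊤ := by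
  classical
  obtain ⟨S, hS⟩ := Module.Finite.fg_top (R := D.H) (M := M)
  choose s hs using h.exists_sum
  refine ⟨S.biUnion fun m => (s m).image fun d => (d, h.proj d m), ?_, ?_⟩
  · intro p hp
    simp only [Finset.mem_biUnion, Finset.mem_image] at hp
    obtain ⟨m, -, d, -, rfl⟩ := hp
    exact h.proj_mem d m
  · rw [eq_top_iff, ← hS, Submodule.span_le]
    intro m hm
    rw [← hs m _ subset_rfl]
    refine sum_mem fun d hd => Submodule.subset_span ⟨(d, h.proj d m), ?_, rfl⟩
    simp only [Finset.coe_biUnion, Finset.coe_image, Set.mem_iUnion]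
    exact ⟨m, hm, d, hd, rfl⟩

lemma monX_mem_weight (t : Multiset (Fin (Module.finrank ℂ V))) {d : ℂ} {m : M}
    (hm : m ∈ D.weight M d) : D.rels.monX t • m ∈ D.weight M (d + t.card) := by
  induction t using Multiset.induction_on with
  | empty => simpa [Rels.monX] using hm
  | cons i t ih =>
    rw [Rels.monX, mon_cons, mul_smul, ← Rels.monX, Multiset.card_cons, Nat.cast_add, Nat.cast_one,
      ← add_assoc]
    exact weight_pol _ ih

lemma monY_mem_weight (t : Multiset (Fin (Module.finrank ℂ V))) {d : ℂ} {m : M}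
    (hm : m ∈ D.weight M d) : D.rels.monY t • m ∈ D.weight M (d - t.card) := by
  induction t using Multiset.induction_on with
  | empty => simpa [Rels.monY] using hm
  | cons i t ih =>
    rw [Rels.monY, mon_cons, mul_smul, ← Rels.monY, Multiset.card_cons, Nat.cast_add, Nat.cast_one,
      ← sub_sub, sub_eq_add_neg _ (1 : ℂ)]
    exact weight_dun _ ih

lemma monY_mem_lev (t : Multiset (Fin (Module.finrank ℂ V))) {k : ℕ} {m : M}
    (hm : m ∈ D.lev M (t.card + k)) : D.rels.monY t • m ∈ D.lev M k := by
  induction t using Multiset.induction_on generalizing k with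
  | empty => simpa [Rels.monY] using hm
  | cons i t ih =>
    rw [Rels.monY, mon_cons, mul_smul, ← Rels.monY]
    rw [Multiset.card_cons, add_assoc, add_comm 1] at hm
    exact mem_lev_succ.1 (ih hm) _

lemma finite_setOf_card_eq {n : ℕ} (c : ℂ) :
    {t : Multiset (Fin n) | (t.card : ℂ) = c}.Finite := by
  by_cases h : ∃ k : ℕ, (k : ℂ) = c
  · obtain ⟨k, rfl⟩ := h
    refine (Set.finite_range fun t : Sym (Fin n) k => (t : Multiset (Fin n))).subset ?_
    intro t ht
    exact ⟨⟨t, Nat.cast_injective ht⟩, rfl⟩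
  · refine Set.Finite.subset Set.finite_empty fun t ht => h ⟨_, ht⟩

/-- The weight spaces of the modules in category `O` are finite dimensional. -/
lemma LocNilp.finiteDimensional_weight (hM : D.LocNilp M) [Module.Finite D.H M] (d : ℂ) :
    FiniteDimensional ℂ (D.weight M d) := by
  obtain ⟨T, hT, hspan⟩ := hM.isWt.exists_generators
  choose κ hκ using hM.exists_mem_lev
  set k := T.sup fun p => κ p.2 with hk
  -- Ordered monomials applied to homogeneous generators span M, and each result is homogeneous: the
  -- Dunkl part lowers the weight by its degree and the polynomial part raises it.
  let v : Rels.Idx V D × T → M := fun i => D.rels.pbw i.1 • i.2.1.2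
  let δ : Rels.Idx V D × T → ℂ := fun i => i.2.1.1 - i.1.2.2.card + i.1.1.card
  have hv : ∀ i, v i ∈ D.weight M (δ i) := by
    rintro ⟨⟨t, w, s⟩, ⟨p, hp⟩⟩
    change (_ * _ * _) • _ ∈ _
    rw [mul_smul, mul_smul]
    exact monX_mem_weight t (weight_grp w (monY_mem_weight s (hT p hp)))
  have hv0 : ∀ i, v i ≠ 0 → i.1.2.2.card < k := by
    rintro ⟨⟨t, w, s⟩, ⟨p, hp⟩⟩ h0
    by_contra! hlt
    obtain ⟨j, hj⟩ := Nat.exists_eq_add_of_le hlt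
    apply h0
    change (_ * _ * _) • _ = _
    have h1 : p.2 ∈ D.lev M (s.card + 0) := by
      refine lev_mono ?_ (hκ p.2)
      exact (Finset.le_sup (f := fun p : ℂ × M => κ p.2) hp).trans hlt
    rw [mul_smul, mem_lev_zero.1 (monY_mem_lev s h1), smul_zero]
  have hspan' : Submodule.span ℂ (Set.range v) = ⊤ := by
    rw [eq_top_iff]
    intro m _
    have hm : m ∈ Submodule.span D.H (Prod.snd '' (T : Set (ℂ × M))) := by rw [hspan]; trivial
    have h1 : ∀ (h : D.H) (p : T), h • p.1.2 ∈ Submodule.span ℂ (Set.range v) := by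
      intro h p
      have hh : h ∈ Submodule.span ℂ (Set.range D.rels.pbw) := by rw [span_pbw]; trivial
      induction hh using Submodule.span_induction with
      | zero => rw [zero_smul]; exact zero_mem _
      | add x y _ _ h1 h2 => rw [add_smul]; exact add_mem h1 h2
      | smul a x _ h1 => rw [smul_assoc]; exact Submodule.smul_mem _ _ h1
      | mem x hx =>
        obtain ⟨i, rfl⟩ := hx
        exact Submodule.subset_span ⟨(i, p), rfl⟩
    have h2 : ∀ m ∈ Submodule.span D.H (Prod.snd '' (T : Set (ℂ × M))), ∀ h : D.H,
        h • m ∈ Submodule.span ℂ (Set.range v) := by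
      intro m hm
      induction hm using Submodule.span_induction with
      | zero => intro h; rw [smul_zero]; exact zero_mem _
      | add x y _ _ hx hy => intro h; rw [smul_add]; exact add_mem (hx h) (hy h)
      | smul a x _ hx => intro h; rw [← mul_smul]; exact hx _
      | mem x hx =>
        obtain ⟨p, hp, rfl⟩ := hx
        exact fun h => h1 h ⟨p, hp⟩
    rw [← one_smul D.H m]
    exact h2 m hm 1
  -- A nonzero vector has Dunkl part of degree less than k, which leaves finitely many choices of
  -- Dunkl part, group element and generator. For each of them the weight d determines the degree of
  -- the polynomial part.
  have hfin : {i | δ i = d ∧ v i ≠ 0}.Finite := by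
    have h1 : ({s : Multiset (Fin (Module.finrank ℂ V)) | s.card < k}).Finite := by
      refine (Set.Finite.biUnion (Set.finite_lt_nat k) fun j _ =>
        finite_setOf_card_eq (j : ℂ)).subset ?_
      intro s hs
      exact Set.mem_biUnion hs rfl
    refine (Set.Finite.biUnion ((h1.prod (Set.finite_univ (α := D.W))).prod
      (Set.finite_univ (α := T))) (t := fun q => (fun t => ((t, q.1.2, q.1.1), q.2)) ''
        {t | (t.card : ℂ) = d - (q.2.1.1 - q.1.1.card)}) fun q _ =>
        (finite_setOf_card_eq _).image _).subset ?_
    rintro ⟨⟨t, w, s⟩, p⟩ ⟨h2, h3⟩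
    refine Set.mem_biUnion (x := ((s, w), p)) ⟨⟨hv0 _ h3, trivial⟩, trivial⟩ ⟨t, ?_, rfl⟩
    exact eq_sub_of_add_eq' h2
  have := FiniteDimensional.span_of_finite ℂ (hfin.image v)
  exact Submodule.finiteDimensional_of_le (hM.isWt.weight_le_span v δ hv hspan' d)

end WeightSpaces

end Datum

namespace Datum

variable {V : Type u} [AddCommGroup V] [Module ℂ V] [FiniteDimensional ℂ V] {D : Datum V}

/-! ### The restricted dual: weights, local nilpotency, finite generation, exactness. -/

section DualModule

variable {J : HermitianIso D} (σ : Bar J)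
variable (M : Type u) [AddCommGroup M] [Module D.H M] [Module ℂ M] [IsScalarTower ℂ D.H M]

/-- The restricted dual, with its `H_c`-module structure. -/
def RDual (_ : Bar J) (M : Type u) [AddCommGroup M] [Module D.H M] [Module ℂ M]
    [IsScalarTower ℂ D.H M] : Type u := D.restrictedDual M

instance : AddCommGroup (RDual σ M) := inferInstanceAs (AddCommGroup (D.restrictedDual M))

instance : Module D.H (RDual σ M) := dualModule σ M

instance : Module ℂ (RDual σ M) := Module.restrictScalars ℂ D.H (RDual σ M)

instance : IsScalarTower ℂ D.H (RDual σ M) := IsScalarTower.restrictScalars ℂ D.H (RDual σ M)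

variable {σ M}

lemma RDual.ext {φ ψ : RDual σ M} (h : ∀ m, φ.1 m = ψ.1 m) : φ = ψ :=
  Subtype.ext (LinearMap.ext h)

@[simp] lemma RDual.zero_apply (m : M) : (0 : RDual σ M).1 m = 0 := rfl

@[simp] lemma RDual.add_apply (φ ψ : RDual σ M) (m : M) : (φ + ψ).1 m = φ.1 m + ψ.1 m := rfl

@[simp] lemma RDual.smul_apply (h : D.H) (φ : RDual σ M) (m : M) :
    (h • φ).1 m = φ.1 (σ.toFun h • m) := rfl

-- The conjugation of scalars by the anti-automorphism and the one in the forms cancel, so the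
-- complex structure inherited from H_c is the pointwise one.
@[simp] lemma RDual.csmul_apply (a : ℂ) (φ : RDual σ M) (m : M) :
    (a • φ).1 m = a * φ.1 m := by
  rw [← algebraMap_smul D.H a φ, RDual.smul_apply, σ.map_algebraMap, algebraMap_smul,
    LinearMap.map_smulₛₗ, Complex.conj_conj, smul_eq_mul]

@[simp] lemma RDual.sum_apply {ι : Type*} (s : Finset ι) (φ : ι → RDual σ M) (m : M) :
    (∑ i ∈ s, φ i).1 m = ∑ i ∈ s, (φ i).1 m := by
  classical
  induction s using Finset.induction_on with
  | empty => rfl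
  | insert i s hi ih => rw [Finset.sum_insert hi, Finset.sum_insert hi, RDual.add_apply, ih]

lemma RDual.eu_sub_pow_apply (d : ℂ) (k : ℕ) (φ : RDual σ M) (m : M) :
    ((D.eu - algebraMap ℂ D.H d) ^ k • φ).1 m =
      φ.1 ((D.eu - algebraMap ℂ D.H (conj d)) ^ k • m) := by
  rw [RDual.smul_apply, σ.map_pow, σ.map_sub, σ.map_eu, σ.map_algebraMap]

lemma eu_sub_pow_mem_weight {d : ℂ} (s : ℂ) (k : ℕ) {m : M} (hm : m ∈ D.weight M d) :
    (D.eu - algebraMap ℂ D.H s) ^ k • m ∈ D.weight M d := by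
  have := prod_eu_sub_mem_weight (List.replicate k s) hm
  rwa [List.map_replicate, List.prod_replicate] at this

lemma eu_sub_pow_smul_eq_zero {d s : ℂ} (h : d ≠ s) (k : ℕ) {m : M} (hm : m ∈ D.weight M d)
    (h0 : (D.eu - algebraMap ℂ D.H s) ^ k • m = 0) : m = 0 :=
  weight_disjoint h hm (mem_weight_iff.2 ⟨k, h0⟩)

/-- A form in a weight space of the dual vanishes on the other weight spaces. -/
lemma RDual.apply_eq_zero (hM : D.LocNilp M) [Module.Finite D.H M] {d e : ℂ} (hne : e ≠ d)
    {φ : RDual σ M} (hφ : φ ∈ D.weight (RDual σ M) d) {m : M} (hm : m ∈ D.weight M e) :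
    φ.1 m = 0 := by
  by_cases h0 : m = 0
  · rw [h0, map_zero]
  have he := conj_wts (hM.mem_wts hm h0)
  obtain ⟨k, hk⟩ := mem_weight_iff.1 hφ
  have := hM.finiteDimensional_weight e
  -- Since e is real and differs from d, the operator (eu - conj d)^k is injective on M_e, hence
  -- surjective by finite dimension. So m is the image of some x, and φ(m) = ((eu - d)^k φ)(x) = 0.
  let T : D.weight M e →ₗ[ℂ] D.weight M e :=
    (Algebra.lsmul ℂ ℂ M ((D.eu - algebraMap ℂ D.H (conj d)) ^ k)).restrict
      fun m hm => eu_sub_pow_mem_weight _ k hm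
  have hT : Function.Injective T := by
    rw [injective_iff_map_eq_zero]
    rintro ⟨x, hx⟩ h
    apply Subtype.ext
    refine eu_sub_pow_smul_eq_zero (fun h' => hne ?_) k hx (congrArg Subtype.val h)
    rw [← he, h', Complex.conj_conj]
  obtain ⟨⟨x, hx⟩, hxm⟩ := LinearMap.surjective_of_injective hT ⟨m, hm⟩
  have h1 : (D.eu - algebraMap ℂ D.H (conj d)) ^ k • x = m := congrArg Subtype.val hxm
  rw [← h1, ← RDual.eu_sub_pow_apply, hk, RDual.zero_apply]

lemma exists_pow_of_finiteDimensional (d : ℂ) [FiniteDimensional ℂ (D.weight M d)] :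
    ∃ k, ∀ m ∈ D.weight M d, (D.eu - algebraMap ℂ D.H d) ^ k • m = 0 := by
  classical
  obtain ⟨s, hs⟩ := Module.Finite.fg_top (R := ℂ) (M := D.weight M d)
  choose n hn using fun m : D.weight M d => mem_weight_iff.1 m.2
  refine ⟨s.sup n, fun m hm => ?_⟩
  have h1 : (⟨m, hm⟩ : D.weight M d) ∈ Submodule.span ℂ (s : Set (D.weight M d)) := by
    rw [hs]; trivial
  have h2 : ∀ x ∈ Submodule.span ℂ (s : Set (D.weight M d)),
      (D.eu - algebraMap ℂ D.H d) ^ s.sup n • (x : M) = 0 := by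
    intro x hx
    induction hx using Submodule.span_induction with
    | mem x hx =>
      obtain ⟨k, hk⟩ := Nat.exists_eq_add_of_le' (Finset.le_sup (f := n) hx)
      rw [hk, pow_add, mul_smul, hn, smul_zero]
    | zero => exact smul_zero _
    | add x y _ _ h1 h2 => rw [Submodule.coe_add, smul_add, h1, h2, add_zero]
    | smul a x _ h1 => rw [Submodule.coe_smul, smul_comm, h1, smul_zero]
  exact h2 _ h1

/-- Finite dimension of M_d provides one exponent k for all of M_d, so that (eu - d)^k kills the
whole form. Reality of the weights identifies d with its conjugate. -/
lemma RDual.mem_weight (hM : D.LocNilp M) [Module.Finite D.H M] {d : ℂ} {φ : RDual σ M}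
    (h : ∀ e, e ≠ d → ∀ m ∈ D.weight M e, φ.1 m = 0) : φ ∈ D.weight (RDual σ M) d := by
  have := hM.finiteDimensional_weight d
  obtain ⟨k, hk⟩ := exists_pow_of_finiteDimensional (D := D) (M := M) d
  refine mem_weight_iff.2 ⟨k, RDual.ext fun m => ?_⟩
  refine hM.isWt.ext_of_weight (f := fun m => ((D.eu - algebraMap ℂ D.H d) ^ k • φ).1 m)
    (g := fun m => (0 : RDual σ M).1 m) (fun _ _ => map_add _ _ _) (fun _ _ => map_add _ _ _)
    (fun e m hm => ?_) m
  change ((D.eu - algebraMap ℂ D.H d) ^ k • φ).1 m = 0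
  rw [RDual.eu_sub_pow_apply]
  by_cases h0 : m = 0
  · rw [h0, smul_zero, map_zero]
  by_cases hed : e = d
  · subst hed
    rw [conj_wts (hM.mem_wts hm h0), hk m hm, map_zero]
  · exact h e hed _ (eu_sub_pow_mem_weight _ k hm)

lemma IsWt.comp_proj_mem (h : D.IsWt M) (ψ : M →ₛₗ[starRingEnd ℂ] ℂ) (d : ℂ) :
    ψ.comp (h.proj d) ∈ D.restrictedDual M := by
  refine (Set.finite_singleton d).subset ?_
  rintro e ⟨m, hm, hne⟩
  by_contra hed
  exact hne (by rw [LinearMap.comp_apply, h.proj_of_mem_ne hm hed, map_zero])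

variable (σ) in
/-- The restriction of a form to a weight space, extended by zero to the other weight spaces. -/
def IsWt.cut (h : D.IsWt M) (ψ : M →ₛₗ[starRingEnd ℂ] ℂ) (d : ℂ) : RDual σ M :=
  ⟨ψ.comp (h.proj d), h.comp_proj_mem ψ d⟩

@[simp] lemma IsWt.cut_apply (h : D.IsWt M) (ψ : M →ₛₗ[starRingEnd ℂ] ℂ) (d : ℂ) (m : M) :
    (h.cut σ ψ d).1 m = ψ (h.proj d m) := rfl

lemma LocNilp.cut_mem_weight (hM : D.LocNilp M) [Module.Finite D.H M]
    (ψ : M →ₛₗ[starRingEnd ℂ] ℂ) (d : ℂ) : hM.isWt.cut σ ψ d ∈ D.weight (RDual σ M) d :=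
  RDual.mem_weight hM fun e hne m hm => by
    rw [IsWt.cut_apply, hM.isWt.proj_of_mem_ne hm hne, map_zero]

lemma pol_pow_mem_weight (l : Module.Dual ℂ V) (n : ℕ) {d : ℂ} {m : M} (hm : m ∈ D.weight M d) :
    D.pol (linPoly l) ^ n • m ∈ D.weight M (d + n) := by
  induction n with
  | zero => simpa using hm
  | succ n ih =>
    rw [pow_succ', mul_smul]
    have := weight_pol l ih
    rwa [add_assoc, ← Nat.cast_succ] at this

/-- The n-th power of D_v acts on forms as the transpose of multiplication by (J v)^n, which raises
weights by n. A form sees only finitely many weights, and for large n none of them is n more than a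
possible weight. -/
lemma LocNilp.rdual (hM : D.LocNilp M) : D.LocNilp (RDual σ M) := by
  intro v φ
  choose k hk using fun d : ℂ => exists_notMem_wts (D := D) d
  have hfin : {d : ℂ | ∃ m ∈ D.weight M d, φ.1 m ≠ 0}.Finite := φ.2
  refine ⟨hfin.toFinset.sup k, RDual.ext fun m => ?_⟩
  refine hM.isWt.ext_of_weight (f := fun m => (D.dun v ^ _ • φ).1 m)
    (g := fun m => (0 : RDual σ M).1 m) (fun _ _ => map_add _ _ _) (fun _ _ => map_add _ _ _)
    (fun e m hm => ?_) m
  change (D.dun v ^ hfin.toFinset.sup k • φ).1 m = 0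
  rw [RDual.smul_apply, σ.map_pow, σ.map_dun]
  by_contra hne
  have h1 : e + ↑(hfin.toFinset.sup k) ∈ hfin.toFinset :=
    hfin.mem_toFinset.2 ⟨_, pol_pow_mem_weight _ _ hm, hne⟩
  have h2 := hk _ _ (Finset.le_sup (f := k) h1)
  rw [add_sub_cancel_right] at h2
  refine h2 (hM.mem_wts hm fun h0 => hne ?_)
  rw [h0, smul_zero, map_zero]

variable (σ) in
/-- The extension by zero of the conjugate of a linear form on a weight space. -/
def IsWt.conjExt (h : D.IsWt M) {d : ℂ} (l : Module.Dual ℂ (D.weight M d)) :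
    M →ₛₗ[starRingEnd ℂ] ℂ where
  toFun m := conj (l ⟨h.proj d m, h.proj_mem d m⟩)
  map_add' x y := by
    rw [← map_add, ← map_add]
    congr 2
    exact Subtype.ext (map_add _ _ _)
  map_smul' a x := by
    rw [smul_eq_mul, ← _root_.map_mul, ← smul_eq_mul, ← _root_.map_smul]
    congr 2
    exact Subtype.ext (map_smul _ _ _)

/-- The spanning forms are the conjugates of the coordinates in a basis of M_d, extended by zero. -/
lemma LocNilp.exists_span_weight_rdual (hM : D.LocNilp M) [Module.Finite D.H M] (d : ℂ) :
    ∃ s : Finset (RDual σ M),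
      ∀ φ ∈ D.weight (RDual σ M) d, φ ∈ Submodule.span D.H (s : Set (RDual σ M)) := by
  classical
  have := hM.finiteDimensional_weight d
  let b := Module.finBasis ℂ (D.weight M d)
  refine ⟨Finset.univ.image fun i => hM.isWt.cut σ (hM.isWt.conjExt (b.coord i)) d,
    fun φ hφ => ?_⟩
  have h1 : φ = ∑ i, φ.1 (b i) • hM.isWt.cut σ (hM.isWt.conjExt (b.coord i)) d := by
    refine RDual.ext fun m => ?_
    refine hM.isWt.ext_of_weight (f := fun m => φ.1 m) (g := fun m => (∑ i, φ.1 (b i) •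
      hM.isWt.cut σ (hM.isWt.conjExt (b.coord i)) d).1 m) (fun _ _ => map_add _ _ _)
      (fun _ _ => map_add _ _ _) (fun e m hm => ?_) m
    rw [RDual.sum_apply]
    simp only [RDual.csmul_apply, IsWt.cut_apply]
    by_cases hed : e = d
    · subst hed
      have h2 := congrArg Subtype.val (b.sum_repr ⟨m, hm⟩)
      rw [AddSubmonoidClass.coe_finsetSum] at h2
      refine (congrArg φ.1 h2.symm).trans ?_
      rw [map_sum]
      refine Finset.sum_congr rfl fun i _ => ?_
      rw [Submodule.coe_smul, LinearMap.map_smulₛₗ, smul_eq_mul, mul_comm]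
      congr 1
      change _ = conj (b.coord i _)
      congr 2
      rw [Module.Basis.coord_apply]
      congr 3
      rw [hM.isWt.proj_of_mem hm, hM.isWt.proj_of_mem hm]
    · rw [RDual.apply_eq_zero hM hed hφ hm]
      refine (Finset.sum_eq_zero fun i _ => ?_).symm
      rw [hM.isWt.proj_of_mem_ne hm hed, map_zero, mul_zero]
  rw [h1]
  refine sum_mem fun i _ => Submodule.smul_of_tower_mem _ _ (Submodule.subset_span ?_)
  simp

/-- When d is not a root, the map m ↦ (D_i m)_i is injective on M_d by `eq_zero_of_mem_inv`, so
every form on M_d factors through it. On the dual, J b_i acts as the transpose of D_i, which turns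
the factorization into the stated sum. -/
lemma LocNilp.exists_sum_pol_rdual (hM : D.LocNilp M) [Module.Finite D.H M] {d : ℂ}
    (hd : d ∉ D.cenRoots) {φ : RDual σ M} (hφ : φ ∈ D.weight (RDual σ M) d) :
    ∃ ψ : Fin (Module.finrank ℂ V) → RDual σ M, (∀ i, ψ i ∈ D.weight (RDual σ M) (d - 1)) ∧
      φ = ∑ i, D.pol (linPoly (J.toEquiv (Module.finBasis ℂ V i))) • ψ i := by
  classical
  let T : D.weight M d →ₗ[ℂ] Fin (Module.finrank ℂ V) → M :=
    LinearMap.pi fun i => Algebra.lsmul ℂ ℂ M (D.dun (Module.finBasis ℂ V i)) ∘ₗ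
      (D.weight M d).subtype
  have hT : ∀ m, T m = 0 → ∃ x : D.weight M d, (0 : D.weight M d →ₗ[ℂ] D.weight M d) x = m := by
    rintro ⟨m, hm⟩ h
    refine ⟨0, Subtype.ext (eq_zero_of_mem_inv hd hm fun v => ?_).symm⟩
    rw [← (Module.finBasis ℂ V).sum_repr v, map_sum, Finset.sum_smul]
    refine Finset.sum_eq_zero fun i _ => ?_
    have h1 : D.dun (Module.finBasis ℂ V i) • m = 0 := congrFun h i
    rw [map_smul, smul_assoc, h1, smul_zero]
  -- The first arrow is the zero map of M_d, so that exactness expresses the injectivity of T.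
  obtain ⟨ψ, hψ⟩ := exists_dual_lift _ T hT (φ.1.comp (D.weight M d).subtype) (fun x => by simp)
  refine ⟨fun i => hM.isWt.cut σ (ψ.comp (LinearMap.single ℂ (fun _ => M) i)) (d - 1),
    fun i => hM.cut_mem_weight _ _, RDual.ext fun m => ?_⟩
  refine hM.isWt.ext_of_weight (f := fun m => φ.1 m) (g := fun m => (∑ i,
    D.pol (linPoly (J.toEquiv (Module.finBasis ℂ V i))) •
      hM.isWt.cut σ (ψ.comp (LinearMap.single ℂ (fun _ => M) i)) (d - 1)).1 m)
      (fun _ _ => map_add _ _ _) (fun _ _ => map_add _ _ _) (fun e m hm => ?_) m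
  refine Eq.trans ?_ (RDual.sum_apply _ _ _).symm
  simp only [RDual.smul_apply, σ.map_pol, IsWt.cut_apply]
  by_cases hed : e = d
  · subst hed
    refine (hψ ⟨m, hm⟩).symm.trans ?_
    rw [← Finset.univ_sum_single (T ⟨m, hm⟩), map_sum]
    refine Finset.sum_congr rfl fun i _ => ?_
    rw [hM.isWt.proj_of_mem (by rw [sub_eq_add_neg]; exact weight_dun _ hm)]
    rfl
  · rw [RDual.apply_eq_zero hM hed hφ hm]
    refine (Finset.sum_eq_zero fun i _ => ?_).symm
    rw [hM.isWt.proj_of_mem_ne (weight_dun _ hm) (fun h => hed ?_), map_zero]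
    linear_combination h

/-- The weight spaces at the finitely many roots generate. A form of any other weight d comes from
weight d - 1 by `LocNilp.exists_sum_pol_rdual`, and the descent stops because the weights are
bounded below. -/
lemma LocNilp.finite_rdual (hM : D.LocNilp M) [Module.Finite D.H M] :
    Module.Finite D.H (RDual σ M) := by
  classical
  choose s hs using hM.exists_span_weight_rdual (σ := σ)
  refine ⟨⟨D.cenRoots.toFinset.biUnion s, ?_⟩⟩
  set U := Submodule.span D.H ((D.cenRoots.toFinset.biUnion s : Finset _) : Set (RDual σ M))
  have key : ∀ (k : ℕ) (d : ℂ), (∀ n : ℕ, k ≤ n → d - n ∉ D.wts) →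
      ∀ φ ∈ D.weight (RDual σ M) d, φ ∈ U := by
    intro k
    induction k with
    | zero =>
      intro d hd φ hφ
      have h0 : φ = 0 := by
        by_contra h0
        refine hd 0 le_rfl ?_
        rw [Nat.cast_zero, sub_zero]
        exact hM.rdual.mem_wts hφ h0
      rw [h0]
      exact zero_mem _
    | succ k ih =>
      intro d hd φ hφ
      by_cases hroot : d ∈ D.cenRoots
      · refine Submodule.span_mono ?_ (hs d φ hφ)
        exact_mod_cast Finset.subset_biUnion_of_mem s (List.mem_toFinset.2 hroot)
      · obtain ⟨ψ, hψ, rfl⟩ := hM.exists_sum_pol_rdual hroot hφ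
        refine sum_mem fun i _ => Submodule.smul_mem _ _ (ih (d - 1) (fun n hn => ?_) _ (hψ i))
        have := hd (n + 1) (by omega)
        rwa [Nat.cast_succ, add_comm, ← sub_sub] at this
  rw [eq_top_iff]
  intro φ _
  refine hM.rdual.isWt.induction (p := fun φ => φ ∈ U) (fun d φ hφ => ?_)
    (fun x y hx hy => add_mem hx hy) φ
  obtain ⟨k, hk⟩ := exists_notMem_wts (D := D) d
  exact key k d hk φ hφ

variable {N P : Type u} [AddCommGroup N] [Module D.H N] [Module ℂ N] [IsScalarTower ℂ D.H N]
  [AddCommGroup P] [Module D.H P] [Module ℂ P] [IsScalarTower ℂ D.H P]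

/-- Forms on the middle term of an exact sequence which vanish on the image of the first term
extend to the third term. -/
lemma RDual.exists_lift (hN : D.LocNilp N) (hP : D.LocNilp P) (f : M →ₗ[D.H] N) (g : N →ₗ[D.H] P)
    (h : ∀ y, g y = 0 → ∃ x, f x = y) (φ : RDual σ N) (hφ : ∀ x, φ.1 (f x) = 0) :
    ∃ ψ : RDual σ P, ∀ y, ψ.1 (g y) = φ.1 y := by
  classical
  obtain ⟨ψ, hψ⟩ := exists_dual_lift (toComplex f) (toComplex g) h φ.1 hφ
  have hfin : {d : ℂ | ∃ m ∈ D.weight N d, φ.1 m ≠ 0}.Finite := φ.2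
  -- The lift given by linear algebra may be nonzero on infinitely many weight spaces; cutting it
  -- down to the weights on which φ is nonzero does not affect its restriction to the image of g.
  refine ⟨∑ d ∈ hfin.toFinset, hP.isWt.cut σ ψ d, fun y => ?_⟩
  refine hN.isWt.ext_of_weight
    (f := fun y => (∑ d ∈ hfin.toFinset, hP.isWt.cut σ ψ d).1 (g y)) (g := fun y => φ.1 y)
    (fun _ _ => by simp only [map_add]) (fun _ _ => map_add _ _ _) (fun e y hy => ?_) y
  refine (RDual.sum_apply _ _ _).trans ?_
  simp only [IsWt.cut_apply]
  rw [Finset.sum_eq_single e (fun d _ hd => by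
    rw [hP.isWt.proj_of_mem_ne (weight_map g hy) hd.symm, map_zero]) (fun he => ?_),
    hP.isWt.proj_of_mem (weight_map g hy)]
  · exact hψ y
  · rw [hP.isWt.proj_of_mem (weight_map g hy)]
    refine (hψ y).trans ?_
    by_contra hne
    exact he (hfin.mem_toFinset.2 ⟨y, hy, hne⟩)

variable (σ) in
lemma RDual.exists_ne_zero (hM : D.LocNilp M) {m : M} (hm : m ≠ 0) :
    ∃ φ : RDual σ M, φ.1 m ≠ 0 := by
  obtain ⟨s, hs⟩ := hM.isWt.exists_sum m
  obtain ⟨d, -, hd⟩ : ∃ d ∈ s, hM.isWt.proj d m ≠ 0 := by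
    by_contra! h
    exact hm ((hs s le_rfl).symm.trans (Finset.sum_eq_zero h))
  have hd' : (⟨hM.isWt.proj d m, hM.isWt.proj_mem d m⟩ : D.weight M d) ≠ 0 :=
    fun h => hd (congrArg Subtype.val h)
  obtain ⟨l, hl⟩ : ∃ l : Module.Dual ℂ (D.weight M d),
      l ⟨hM.isWt.proj d m, hM.isWt.proj_mem d m⟩ ≠ 0 := by
    by_contra! h
    exact hd' ((Module.forall_dual_apply_eq_zero_iff ℂ _).1 h)
  refine ⟨hM.isWt.cut σ (hM.isWt.conjExt l) d, ?_⟩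
  rw [IsWt.cut_apply]
  change conj (l ⟨hM.isWt.proj d _, _⟩) ≠ 0
  rw [Ne, map_eq_zero]
  convert! hl using 3
  exact Subtype.ext (hM.isWt.proj_of_mem (hM.isWt.proj_mem d m))

/-- The map `M → P^∨` corresponding to a map `P → M^∨`. -/
def RDual.flip (hM : D.LocNilp M) [Module.Finite D.H M] (q : P →ₗ[D.H] RDual σ M) :
    M →ₗ[D.H] RDual σ P where
  toFun m := ⟨
    { toFun := fun p => conj ((q p).1 m)
      map_add' := fun x y => by rw [map_add, RDual.add_apply, map_add]
      map_smul' := fun a x => by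
        have : q (a • x) = a • q x := map_smul (toComplex q) a x
        rw [this, RDual.csmul_apply, _root_.map_mul, smul_eq_mul] }, by
    -- Finiteness of the support: for p of weight d, the form q(p) has weight d and vanishes on the
    -- components of m in other weights, and m has only finitely many components.
    obtain ⟨s, hs⟩ := hM.isWt.exists_sum m
    refine s.finite_toSet.subset ?_
    rintro d ⟨p, hp, hne⟩
    by_contra hd
    refine hne ?_
    change conj ((q p).1 m) = 0
    rw [← hs s le_rfl, map_sum, Finset.sum_eq_zero fun e he => ?_, map_zero]
    refine RDual.apply_eq_zero hM (fun h => hd ?_) (weight_map q hp) (hM.isWt.proj_mem e m)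
    rw [← h]
    exact he⟩
  map_add' x y := RDual.ext fun p => by
    change conj ((q p).1 (x + y)) = conj ((q p).1 x) + conj ((q p).1 y)
    rw [map_add, map_add]
  map_smul' h x := RDual.ext fun p => by
    change conj ((q p).1 (h • x)) = conj ((q (σ.toFun h • p)).1 x)
    rw [map_smul q, RDual.smul_apply, σ.involutive]

end DualModule

end Datum

namespace Datum

/-! ### Cyclic modules representing the weight functors. -/

section Projectives

variable {V : Type u} [AddCommGroup V] [Module ℂ V] (D : Datum V)

/-- The products of `k` Dunkl operators. -/
def dunWords : ℕ → Set D.H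
  | 0 => {1}
  | k + 1 => {h | ∃ a ∈ dunWords k, ∃ v, h = a * D.dun v}

variable {D}

section

variable {M : Type*} [AddCommGroup M] [Module D.H M] [Module ℂ M] [IsScalarTower ℂ D.H M]

lemma mem_lev_iff {k : ℕ} {m : M} : m ∈ D.lev M k ↔ ∀ h ∈ D.dunWords k, h • m = 0 := by
  induction k generalizing m with
  | zero =>
    rw [mem_lev_zero]
    constructor
    · rintro rfl h -
      exact smul_zero _
    · intro h
      have := h 1 rfl
      rwa [one_smul] at this
  | succ k ih =>
    rw [mem_lev_succ]
    constructor
    · rintro h _ ⟨a, ha, v, rfl⟩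
      rw [mul_smul]
      exact ih.1 (h v) a ha
    · intro h v
      refine ih.2 fun a ha => ?_
      rw [← mul_smul]
      exact h _ ⟨a, ha, v, rfl⟩

/-- Group elements and Dunkl operators keep the level, and a linear form raises it by at most one.
-/
lemma exists_smul_mem_lev (h : D.H) (m : M) (hm : ∃ k, m ∈ D.lev M k) :
    ∃ k, h • m ∈ D.lev M k := by
  have hsum : ∀ x y : M, (∃ k, x ∈ D.lev M k) → (∃ k, y ∈ D.lev M k) →
      ∃ k, x + y ∈ D.lev M k := by
    rintro x y ⟨k, hk⟩ ⟨l, hl⟩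
    exact ⟨k ⊔ l, add_mem (lev_mono le_sup_left hk) (lev_mono le_sup_right hl)⟩
  have hs : ∀ (a : ℂ) (m : M), (∃ k, m ∈ D.lev M k) →
      ∃ k, algebraMap ℂ D.H a • m ∈ D.lev M k := by
    rintro a m ⟨k, hk⟩
    rw [algebraMap_smul]
    exact ⟨k, Submodule.smul_mem _ a hk⟩
  induction h using D.H_induction generalizing m with
  | hg w =>
    obtain ⟨k, hk⟩ := hm
    exact ⟨k, grp_mem_lev w hk⟩
  | hp f =>
    induction f using Pol.ind generalizing m with
    | hlin l =>
      obtain ⟨k, hk⟩ := hm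
      exact ⟨k + 1, pol_mem_lev l hk⟩
    | hconst a => rw [AlgHom.commutes]; exact hs a m hm
    | hadd f g h1 h2 => rw [map_add, add_smul]; exact hsum _ _ (h1 m hm) (h2 m hm)
    | hmul f g h1 h2 => rw [map_mul, mul_smul]; exact h1 _ (h2 m hm)
  | hd v =>
    obtain ⟨k, hk⟩ := hm
    exact ⟨k, dun_mem_lev v hk⟩
  | hs a => exact hs a m hm
  | hadd a b h1 h2 => rw [add_smul]; exact hsum _ _ (h1 m hm) (h2 m hm)
  | hmul a b h1 h2 => rw [mul_smul]; exact h1 _ (h2 m hm)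

lemma locNilp_of_generator {m : M} {k : ℕ} (hm : m ∈ D.lev M k) (h : ∀ x : M, ∃ a : D.H, a • m = x) :
    D.LocNilp M := by
  intro v x
  obtain ⟨a, rfl⟩ := h x
  obtain ⟨l, hl⟩ := exists_smul_mem_lev a m ⟨k, hm⟩
  exact ⟨l, pow_smul_eq_zero_of_mem_lev hl v⟩

end

variable (D) in
/-- The quotient of `H_c` by the left ideal generated by the products of `k` Dunkl operators. -/
abbrev LevMod (k : ℕ) : Type u := D.H ⧸ Submodule.span D.H (D.dunWords k)

variable (D) in
lemma LevMod.one_mem_lev (k : ℕ) :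
    (Submodule.Quotient.mk 1 : D.LevMod k) ∈ D.lev (D.LevMod k) k := by
  refine mem_lev_iff.2 fun h hh => ?_
  rw [← Submodule.Quotient.mk_smul, smul_eq_mul, mul_one, Submodule.Quotient.mk_eq_zero]
  exact Submodule.subset_span hh

variable (D) in
lemma LevMod.locNilp (k : ℕ) : D.LocNilp (D.LevMod k) := by
  refine locNilp_of_generator (LevMod.one_mem_lev D k) fun x => ?_
  obtain ⟨a, rfl⟩ := Submodule.Quotient.mk_surjective _ x
  exact ⟨a, by rw [← Submodule.Quotient.mk_smul, smul_eq_mul, mul_one]⟩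

variable [FiniteDimensional ℂ V]
variable {M : Type u} [AddCommGroup M] [Module D.H M] [Module ℂ M] [IsScalarTower ℂ D.H M]

omit [FiniteDimensional ℂ V] in
-- The cyclic module `LevMod` is universal among modules with an element of level k.
lemma LevMod.exists_lift {k : ℕ} {m : M} (hm : m ∈ D.lev M k) :
    ∃ f : D.LevMod k →ₗ[D.H] M, f (Submodule.Quotient.mk 1) = m := by
  refine ⟨Submodule.liftQ _ (LinearMap.toSpanSingleton D.H M m) ?_, ?_⟩
  · rw [Submodule.span_le]
    intro h hh
    exact mem_lev_iff.1 hm h hh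
  · exact one_smul _ _

/-- Each Dunkl operator lowers the weight by one, and after k steps it is no longer a possible
weight. The bound k depends only on d and not on M, which makes M ↦ M_d representable. -/
lemma LocNilp.weight_le_lev (hM : D.LocNilp M) {k : ℕ} {d : ℂ} (hd : ∀ n : ℕ, k ≤ n → d - n ∉ D.wts)
    {m : M} (hm : m ∈ D.weight M d) : m ∈ D.lev M k := by
  induction k generalizing d m with
  | zero =>
    rw [mem_lev_zero]
    by_contra h0
    refine hd 0 le_rfl ?_
    rw [Nat.cast_zero, sub_zero]
    exact hM.mem_wts hm h0
  | succ k ih =>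
    refine mem_lev_succ.2 fun v => ih (fun n hn => ?_) (weight_dun v hm)
    have := hd (n + 1) (by omega)
    rwa [Nat.cast_succ, add_comm (n : ℂ), ← sub_sub] at this

variable (D) in
/-- The number of steps by which a weight has to be lowered to leave the set of weights which can
occur in category `O`. -/
def wtLen (d : ℂ) : ℕ := (exists_notMem_wts (D := D) d).choose

omit [FiniteDimensional ℂ V] in
lemma wtLen_spec (d : ℂ) : ∀ n : ℕ, D.wtLen d ≤ n → d - n ∉ D.wts :=
  (exists_notMem_wts (D := D) d).choose_spec

variable (D) in
/-- The generator of weight `d` of the projective module `ProjMod d`. -/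
def projGen (d : ℂ) : D.LevMod (D.wtLen d) :=
  (LevMod.locNilp D (D.wtLen d)).isWt.proj d (Submodule.Quotient.mk 1)

variable (D) in
/-- The module representing `M ↦ M_d` on category `O`. -/
abbrev ProjMod (d : ℂ) : Type u := Submodule.span D.H {D.projGen d}

variable (D) in
lemma ProjMod.isO (d : ℂ) : D.isO (ModuleCat.of D.H (D.ProjMod d)) := by
  have h : D.isO (ModuleCat.of D.H (D.LevMod (D.wtLen d))) :=
    ⟨(inferInstance : Module.Finite D.H (D.LevMod (D.wtLen d))), LevMod.locNilp D _⟩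
  have : Mono (ModuleCat.ofHom (Submodule.subtype (Submodule.span D.H {D.projGen d}))) :=
    (ModuleCat.mono_iff_injective _).2 (Submodule.subtype_injective _)
  exact isO_of_mono (ModuleCat.ofHom (Submodule.subtype (Submodule.span D.H {D.projGen d}))) h

variable (D) in
/-- The generator of `ProjMod d`. -/
def ProjMod.gen (d : ℂ) : D.ProjMod d := ⟨D.projGen d, Submodule.mem_span_singleton_self _⟩

lemma ProjMod.gen_mem_weight (d : ℂ) : ProjMod.gen D d ∈ D.weight (D.ProjMod d) d := by
  obtain ⟨k, hk⟩ := mem_weight_iff.1 ((LevMod.locNilp D (D.wtLen d)).isWt.proj_mem d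
    (Submodule.Quotient.mk 1))
  exact mem_weight_iff.2 ⟨k, Subtype.ext hk⟩

omit [Module ℂ M] [IsScalarTower ℂ D.H M] in
lemma ProjMod.hom_ext {d : ℂ} {f g : D.ProjMod d →ₗ[D.H] M}
    (h : f (ProjMod.gen D d) = g (ProjMod.gen D d)) : f = g := by
  refine LinearMap.ext ?_
  rintro ⟨x, hx⟩
  obtain ⟨a, rfl⟩ := Submodule.mem_span_singleton.1 hx
  have : (⟨a • D.projGen d, hx⟩ : D.ProjMod d) = a • ProjMod.gen D d := rfl
  rw [this, map_smul, map_smul, h]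

/-- An element m of weight d has level `D.wtLen d`, so it is the image of the class of 1 under some
homomorphism. Homomorphisms commute with weight projections, hence the component of weight d of that
class also maps to m. -/
lemma ProjMod.exists_lift (hM : D.LocNilp M) {d : ℂ} {m : M} (hm : m ∈ D.weight M d) :
    ∃ f : D.ProjMod d →ₗ[D.H] M, f (ProjMod.gen D d) = m := by
  obtain ⟨f, hf⟩ := LevMod.exists_lift (hM.weight_le_lev (wtLen_spec d) hm)
  refine ⟨f ∘ₗ Submodule.subtype _, ?_⟩
  change f (D.projGen d) = m
  rw [projGen, IsWt.map_proj _ hM.isWt, hf, hM.isWt.proj_of_mem hm]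

variable {N : Type u} [AddCommGroup N] [Module D.H N] [Module ℂ N] [IsScalarTower ℂ D.H N]

/-- Taking weight spaces is exact: a preimage of the image of the generator may be replaced by its
component of weight d. -/
lemma ProjMod.exists_factor (hM : D.LocNilp M) (hN : D.LocNilp N) (g : M →ₗ[D.H] N)
    (hg : Function.Surjective g) {d : ℂ} (f : D.ProjMod d →ₗ[D.H] N) :
    ∃ f' : D.ProjMod d →ₗ[D.H] M, g ∘ₗ f' = f := by
  obtain ⟨m, hm⟩ := hg (f (ProjMod.gen D d))
  obtain ⟨f', hf'⟩ := ProjMod.exists_lift hM (hM.isWt.proj_mem d m)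
  refine ⟨f', ProjMod.hom_ext ?_⟩
  rw [LinearMap.comp_apply, hf', hM.isWt.map_proj hN.isWt, hm,
    hN.isWt.proj_of_mem (weight_map f (ProjMod.gen_mem_weight d))]

end Projectives

/-! ### Category O: exactness criteria and enough projectives. -/

section CategoryO

open scoped ModuleCat

attribute [local instance] ModuleCat.isScalarTower_of_algebra_moduleCat

variable {V : Type u} [AddCommGroup V] [Module ℂ V] [FiniteDimensional ℂ V] {D : Datum V}

instance : D.isO.ι.PreservesEpimorphisms := D.isO.preservesEpimorphisms_ι_of_isNormalMonoCategory

instance : PreservesFiniteLimits D.isO.ι := by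
  have := D.isO.preservesKernels_ι
  exact Functor.preservesFiniteLimits_of_preservesKernels _

instance : PreservesFiniteColimits D.isO.ι := by
  have := D.isO.preservesCokernels_ι
  exact Functor.preservesFiniteColimits_of_preservesCokernels _

lemma O.surjective {X Y : D.O} (f : X ⟶ Y) [Epi f] : Function.Surjective f.hom.hom :=
  (ModuleCat.epi_iff_surjective _).1 (inferInstanceAs (Epi (D.isO.ι.map f)))

lemma O.mono_of_injective {X Y : D.O} (f : X ⟶ Y) (hf : Function.Injective f.hom.hom) : Mono f :=
  D.isO.ι.mono_of_mono_map ((ModuleCat.mono_iff_injective _).2 hf)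

lemma O.exact_iff (S : ShortComplex D.O) : S.Exact ↔
    ∀ y : S.X₂.obj, S.g.hom.hom y = 0 → ∃ x : S.X₁.obj, S.f.hom.hom x = y := by
  rw [← ShortComplex.exact_map_iff_of_faithful _ D.isO.ι, ShortComplex.moduleCat_exact_iff]
  rfl

variable (D) in
/-- The module `ProjMod d`, as an object of category `O`. -/
def projO (d : ℂ) : D.O := ⟨ModuleCat.of D.H (D.ProjMod d), ProjMod.isO D d⟩

instance (d : ℂ) : Projective (D.projO d) where
  factors {E X} f e he := by
    obtain ⟨f', hf'⟩ := ProjMod.exists_factor E.property.2 X.property.2 e.hom.hom (O.surjective e)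
      (d := d) f.hom.hom
    exact ⟨ObjectProperty.homMk (ModuleCat.ofHom f'),
      ObjectProperty.hom_ext _ (ModuleCat.hom_ext hf')⟩

/-- A finitely generated module has finitely many generators that are weight vectors, and each of
them is the image of the generator of some `projO`; their finite coproduct covers the module. -/
instance : EnoughProjectives D.O where
  presentation X := by
    have := X.property.1
    obtain ⟨s, hs, hspan⟩ := X.property.2.isWt.exists_generators
    choose f hf using fun i : s => ProjMod.exists_lift X.property.2 (hs i.1 i.2)
    let F : ∀ i : s, D.projO i.1.1 ⟶ X := fun i => ObjectProperty.homMk (ModuleCat.ofHom (f i))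
    have hF : Epi (Sigma.desc F) := by
      constructor
      intro Z g h hgh
      have key : ∀ i : s, g.hom.hom i.1.2 = h.hom.hom i.1.2 := fun i => by
        have h1 : F i ≫ g = F i ≫ h := by
          rw [← Sigma.ι_desc F i, Category.assoc, Category.assoc, hgh]
        have h2 := congrArg (fun q : D.projO i.1.1 ⟶ Z => q.hom.hom (ProjMod.gen D i.1.1)) h1
        change g.hom.hom (f i (ProjMod.gen D i.1.1)) = h.hom.hom (f i (ProjMod.gen D i.1.1)) at h2
        rwa [hf] at h2
      refine ObjectProperty.hom_ext _ (ModuleCat.hom_ext (LinearMap.ext_on hspan ?_))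
      rintro _ ⟨p, hp, rfl⟩
      exact key ⟨p, hp⟩
    exact ⟨{ p := ∐ fun i : s => D.projO i.1.1, f := Sigma.desc F }⟩

end CategoryO

end Datum

namespace Datum

variable {V : Type u} [AddCommGroup V] [Module ℂ V] [FiniteDimensional ℂ V] {D : Datum V}

/-! ### The dual of the coinvariants as the invariants of the dual. -/

section CoinvariantDual

variable {J : HermitianIso D} {σ : Bar J}
variable {M : Type u} [AddCommGroup M] [Module D.H M] [Module ℂ M] [IsScalarTower ℂ D.H M]

/-- The projection of `M` to the degree `d` part of `M / V* M`. -/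
def IsWt.toCoinv (h : D.IsWt M) (d : ℂ) : M →ₗ[ℂ] D.coinvDeg M d :=
  ((D.dualSmul M).mkQ ∘ₗ h.proj d).codRestrict _ fun m => ⟨h.proj d m, h.proj_mem d m, rfl⟩

lemma IsWt.toCoinv_of_mem (h : D.IsWt M) {d : ℂ} {m : M} (hm : m ∈ D.weight M d) :
    h.toCoinv d m = ⟨(D.dualSmul M).mkQ m, ⟨m, hm, rfl⟩⟩ :=
  Subtype.ext (congrArg (D.dualSmul M).mkQ (h.proj_of_mem hm))

lemma IsWt.toCoinv_surjective (h : D.IsWt M) (d : ℂ) : Function.Surjective (h.toCoinv d) := by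
  rintro ⟨_, ⟨m, hm, rfl⟩⟩
  exact ⟨m, h.toCoinv_of_mem hm⟩

lemma IsWt.toCoinv_of_mem_ne (h : D.IsWt M) {d e : ℂ} {m : M} (hm : m ∈ D.weight M e)
    (hne : e ≠ d) : h.toCoinv d m = 0 :=
  Subtype.ext ((congrArg (D.dualSmul M).mkQ (h.proj_of_mem_ne hm hne)).trans (map_zero _))

lemma IsWt.toCoinv_pol (h : D.IsWt M) (d : ℂ) (l : Module.Dual ℂ V) (m : M) :
    h.toCoinv d (D.pol (linPoly l) • m) = 0 := by
  refine Subtype.ext ((Submodule.Quotient.mk_eq_zero _).2 ?_)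
  rw [h.proj_pol]
  exact Submodule.subset_span ⟨l, _, rfl⟩

lemma IsWt.toCoinv_grp (h : D.IsWt M) (d : ℂ) (w : D.W) (m : M) :
    h.toCoinv d (D.grp w • m) = D.coinvRep M d w (h.toCoinv d m) :=
  Subtype.ext (congrArg (D.dualSmul M).mkQ (h.proj_grp w d m))

lemma IsWt.coinvDegMap_toCoinv {N : Type u} [AddCommGroup N] [Module D.H N] [Module ℂ N]
    [IsScalarTower ℂ D.H N] (h : D.IsWt M) (h' : D.IsWt N) (f : M →ₗ[D.H] N) (d : ℂ) (m : M) :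
    coinvDegMap f d (h.toCoinv d m) = h'.toCoinv d (f m) :=
  Subtype.ext (congrArg (D.dualSmul N).mkQ (h.map_proj h' f d m))

/-- By definition of the action, (D_u φ)(m) = φ((J u) m), and every linear form is some J u. -/
lemma RDual.apply_eq_zero_of_inv {φ : RDual σ M} (hφ : φ ∈ D.inv (RDual σ M)) {m : M}
    (hm : m ∈ D.dualSmul M) : φ.1 m = 0 := by
  induction hm using Submodule.span_induction with
  | mem x hx =>
    obtain ⟨l, m, rfl⟩ := hx
    obtain ⟨u, rfl⟩ := J.toEquiv.surjective l
    rw [← σ.map_dun, ← RDual.smul_apply, hφ u, RDual.zero_apply]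
  | zero => exact map_zero _
  | add x y _ _ h1 h2 => rw [map_add, h1, h2, add_zero]
  | smul a x _ h1 => rw [LinearMap.map_smulₛₗ, h1, smul_zero]

variable (σ) in
/-- The form on `M` given by a form on the degree `d` part of `M / V* M`. -/
def IsWt.coinvForm (h : D.IsWt M) {d : ℂ} (ψ : D.coinvDeg M d →ₛₗ[starRingEnd ℂ] ℂ) : RDual σ M :=
  ⟨ψ.comp (h.toCoinv d), by
    refine (Set.finite_singleton d).subset ?_
    rintro e ⟨m, hm, hne⟩
    by_contra hed
    exact hne ((congrArg ψ (h.toCoinv_of_mem_ne hm hed)).trans (map_zero ψ))⟩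

@[simp] lemma IsWt.coinvForm_apply (h : D.IsWt M) {d : ℂ}
    (ψ : D.coinvDeg M d →ₛₗ[starRingEnd ℂ] ℂ) (m : M) :
    (h.coinvForm σ ψ).1 m = ψ (h.toCoinv d m) := rfl

variable (σ) in
/-- The dual of the degree `d` part of `M / V* M` maps to the degree `d` part of
`H⁰(V, M^∨)`. -/
def LocNilp.coinvDual (hM : D.LocNilp M) [Module.Finite D.H M] (d : ℂ) :
    (D.coinvDeg M d →ₛₗ[starRingEnd ℂ] ℂ) →ₗ[ℂ] D.invDeg (RDual σ M) d where
  toFun ψ := ⟨hM.isWt.coinvForm σ ψ,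
    fun v => RDual.ext fun m => by
      rw [RDual.smul_apply, σ.map_dun, IsWt.coinvForm_apply, hM.isWt.toCoinv_pol, map_zero,
        RDual.zero_apply],
    RDual.mem_weight hM fun e hne m hm => by
      rw [IsWt.coinvForm_apply, hM.isWt.toCoinv_of_mem_ne hm hne, map_zero]⟩
  map_add' _ _ := rfl
  map_smul' a ψ := Subtype.ext (RDual.ext fun m =>
    (RDual.csmul_apply a (hM.isWt.coinvForm σ ψ) m).symm)

/-- For surjectivity: a form of weight d depends only on the component of weight d, and if it is
killed by the Dunkl operators it vanishes on V* M. It therefore factors through the degree d part of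
the quotient. -/
lemma LocNilp.coinvDual_bijective (hM : D.LocNilp M) [Module.Finite D.H M] (d : ℂ) :
    Function.Bijective (hM.coinvDual σ d) := by
  constructor
  · intro ψ ψ' h
    refine LinearMap.ext fun x => ?_
    obtain ⟨m, rfl⟩ := hM.isWt.toCoinv_surjective d x
    exact congrArg (fun φ : D.invDeg (RDual σ M) d => φ.1.1 m) h
  · rintro ⟨φ, hinv, hwt⟩
    have hproj : ∀ m, φ.1 (hM.isWt.proj d m) = φ.1 m := fun m => by
      refine hM.isWt.ext_of_weight (f := fun m => φ.1 (hM.isWt.proj d m)) (g := fun m => φ.1 m)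
        (fun _ _ => by simp only [map_add]) (fun _ _ => map_add _ _ _) (fun e m hm => ?_) m
      by_cases hed : e = d
      · subst hed
        exact congrArg φ.1 (hM.isWt.proj_of_mem hm)
      · exact ((congrArg φ.1 (hM.isWt.proj_of_mem_ne hm hed)).trans (map_zero φ.1)).trans
          (RDual.apply_eq_zero hM hed hwt hm).symm
    obtain ⟨ψ, hψ⟩ := exists_dual_lift (LinearMap.ker (hM.isWt.toCoinv d)).subtype
      (hM.isWt.toCoinv d) (fun y hy => ⟨⟨y, hy⟩, rfl⟩) φ.1 (fun x => by
        have h1 : (D.dualSmul M).mkQ (hM.isWt.proj d x) = 0 := congrArg Subtype.val x.2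
        have h2 := RDual.apply_eq_zero_of_inv hinv ((Submodule.Quotient.mk_eq_zero _).1 h1)
        rw [hproj] at h2
        exact h2)
    exact ⟨ψ, Subtype.ext (RDual.ext hψ)⟩

variable (σ) in
/-- The dual of the degree `d` part of `M / V* M` is the degree `d` part of `H⁰(V, M^∨)`. -/
def LocNilp.coinvDualEquiv (hM : D.LocNilp M) [Module.Finite D.H M] (d : ℂ) :
    (D.conjDual (D.coinvRep M d)).Equiv (D.invRep (RDual σ M) d) :=
  Representation.Equiv.mk (LinearEquiv.ofBijective _ (hM.coinvDual_bijective (σ := σ) d))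
    fun w => LinearMap.ext fun ψ => Subtype.ext (RDual.ext fun m => by
      change ψ (D.coinvRep M d w⁻¹ (hM.isWt.toCoinv d m)) =
        ψ (hM.isWt.toCoinv d (σ.toFun (D.grp w) • m))
      rw [σ.map_grp, hM.isWt.toCoinv_grp])

end CoinvariantDual

/-! ### The duality on category O and enough injectives. -/

section DualityO

open scoped ModuleCat

attribute [local instance] ModuleCat.isScalarTower_of_algebra_moduleCat

variable {J : HermitianIso D} (σ : Bar J)

/-- The restricted dual preserves category `O`. -/
lemma isO_dual (M : D.O) : D.isO ((dual σ).obj (Opposite.op M.obj)) := by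
  have := M.property.1
  exact ⟨(M.property.2.finite_rdual : Module.Finite D.H (RDual σ M.obj)),
    (M.property.2.rdual : D.LocNilp (RDual σ M.obj))⟩

lemma exists_lift_rdual {X Y Z : D.O} (f : X ⟶ Y) (g : Y ⟶ Z)
    (h : ∀ y : Y.obj, g.hom.hom y = 0 → ∃ x : X.obj, f.hom.hom x = y)
    (φ : RDual σ Y.obj) (hφ : ∀ x : X.obj, φ.1 (f.hom.hom x) = 0) :
    ∃ ψ : RDual σ Z.obj, ∀ y : Y.obj, ψ.1 (g.hom.hom y) = φ.1 y :=
  RDual.exists_lift Y.property.2 Z.property.2 f.hom.hom g.hom.hom h φ hφ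

lemma dualO_exact (S : ShortComplex D.Oᵒᵖ) (hS : S.Exact) :
    (S.map (dualO σ (isO_dual σ))).Exact := by
  rw [← ShortComplex.exact_unop_iff, O.exact_iff] at hS
  rw [O.exact_iff]
  intro φ hφ
  obtain ⟨ψ, hψ⟩ := exists_lift_rdual σ S.unop.f S.unop.g hS φ (fun x => LinearMap.congr_fun (congrArg Subtype.val hφ) x)
  exact ⟨ψ, RDual.ext (σ := σ) (M := S.unop.X₂.obj) hψ⟩

instance : PreservesFiniteLimits (dualO σ (isO_dual σ)) :=
  (((dualO σ (isO_dual σ)).exact_tfae.out 1 3 rfl rfl).1 (dualO_exact σ)).1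

instance : PreservesFiniteColimits (dualO σ (isO_dual σ)) :=
  (((dualO σ (isO_dual σ)).exact_tfae.out 1 3 rfl rfl).1 (dualO_exact σ)).2

variable {σ}

/-- The module homomorphism underlying a morphism to a dual. -/
def toRDual {P M : D.O} (q : P ⟶ (dualO σ (isO_dual σ)).obj (Opposite.op M)) :
    P.obj →ₗ[D.H] RDual σ M.obj := q.hom.hom

/-- The map `M → P^∨` corresponding to a map `P → M^∨`. -/
def flipO {P M : D.O} (q : P ⟶ (dualO σ (isO_dual σ)).obj (Opposite.op M)) :
    M ⟶ (dualO σ (isO_dual σ)).obj (Opposite.op P) :=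
  have := M.property.1
  ObjectProperty.homMk (ModuleCat.ofHom (Y := ModuleCat.of D.H (RDual σ P.obj))
    (RDual.flip M.property.2 (toRDual q)))

lemma dualO_hom_ext {P M : D.O} {q q' : P ⟶ (dualO σ (isO_dual σ)).obj (Opposite.op M)}
    (h : ∀ p m, (toRDual q p).1 m = (toRDual q' p).1 m) : q = q' :=
  ObjectProperty.hom_ext _ (ModuleCat.hom_ext (LinearMap.ext fun p =>
    RDual.ext (σ := σ) (M := M.obj) (h p)))

variable (σ)

lemma injective_dualO (P : D.O) [Projective P] :
    Injective ((dualO σ (isO_dual σ)).obj (Opposite.op P)) where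
  factors {A B} g f hf := by
    -- The extension problem for g along the monomorphism f is transposed into a lifting problem for
    -- P along the dual of f, an epimorphism by exactness of the duality. Transposing the lift back
    -- solves the original problem.
    let q' := Projective.factorThru (flipO g) ((dualO σ (isO_dual σ)).map f.op)
    have hq : q' ≫ (dualO σ (isO_dual σ)).map f.op = flipO g := Projective.factorThru_comp _ _
    refine ⟨flipO q', dualO_hom_ext fun a p => ?_⟩
    have h1 := congrArg (fun t => conj ((toRDual t p).1 a)) hq
    exact h1.trans (Complex.conj_conj _)

lemma injective_dualO_of_injective (X : D.Oᵒᵖ) (hX : Injective X) :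
    Injective ((dualO σ (isO_dual σ)).obj X) := by
  have : Projective X.unop := Injective.projective_iff_injective_op.2 hX
  exact injective_dualO σ X.unop

/-- A projective cover P → X^∨, in the sense of a mere epimorphism, transposes to X → P^∨. This map
is injective because P reaches all forms in X^∨ and these separate the points of X. -/
lemma enoughInjectives_of_bar (σ : Bar J) : EnoughInjectives D.O where
  presentation X := by
    let π := Projective.π ((dualO σ (isO_dual σ)).obj (Opposite.op X))
    have := injective_dualO σ (Projective.over ((dualO σ (isO_dual σ)).obj (Opposite.op X)))
    have hmono : Mono (flipO π) := by
      refine O.mono_of_injective _ ((injective_iff_map_eq_zero _).2 fun m hm => ?_)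
      by_contra h0
      obtain ⟨φ, hφ⟩ := RDual.exists_ne_zero (M := X.obj) σ X.property.2 h0
      obtain ⟨p, hp⟩ := O.surjective π φ
      have h1 : conj ((toRDual π p).1 m) = 0 :=
        congrArg (fun t : RDual σ (Projective.over
          ((dualO σ (isO_dual σ)).obj (Opposite.op X))).obj => t.1 p) hm
      rw [map_eq_zero] at h1
      exact hφ ((congrArg (fun t : RDual σ X.obj => t.1 m) hp).symm.trans h1)
    exact ⟨{ J := _, f := flipO π }⟩

/-- The duality exchanges the functors `M ↦ M / V* M` and `M ↦ H⁰(V, M)`. -/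
def coinvDualIso : D.F.op ⋙ D.grDual ≅ dualO σ (isO_dual σ) ⋙ D.G :=
  NatIso.ofComponents (fun X => Discrete.natIso fun d =>
    have := X.unop.property.1
    Rep.mkIso (X.unop.property.2.coinvDualEquiv (M := X.unop.obj) σ d.as)) fun {X Y} f => by
    ext1
    funext d
    apply Rep.hom_ext
    ext1
    refine LinearMap.ext fun ψ => Subtype.ext (RDual.ext (σ := σ) (M := Y.unop.obj) fun m => ?_)
    exact congrArg (show D.coinvDeg X.unop.obj d.as →ₛₗ[starRingEnd ℂ] ℂ from ψ)
      (IsWt.coinvDegMap_toCoinv (M := Y.unop.obj) (N := X.unop.obj)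
      Y.unop.property.2.isWt X.unop.property.2.isWt f.unop.hom.hom d.as m)

end DualityO

end Datum

/-! ### Right derived functors and composition with exact functors. -/

section DerivedComp

universe v₁ v₂ v₃ u₁ u₂ u₃ w₁ w₂ w₃

variable {A : Type u₁} [Category.{v₁} A] [Abelian A] [HasDerivedCategory.{w₁} A]
variable {B : Type u₂} [Category.{v₂} B] [Abelian B] [HasDerivedCategory.{w₂} B]
variable {C : Type u₃} [Category.{v₃} C] [Abelian C] [HasDerivedCategory.{w₃} C]

/-- The functor induced by an exact functor on bounded below derived categories is compatible with
the localization functors. -/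
def exactPlusFactors (Φ : A ⥤ B) [Φ.Additive] [PreservesFiniteLimits Φ]
    [PreservesFiniteColimits Φ] :
    DerivedCategory.Plus.Qh ⋙ exactPlus Φ ≅
      Φ.mapHomotopyCategoryPlus ⋙ DerivedCategory.Plus.Qh :=
  ((DerivedCategory.TStructure.t.plus.fullyFaithfulι.whiskeringRight _).preimageIso
    (Functor.isoWhiskerLeft (HomotopyCategory.Plus.ι A) Φ.mapDerivedCategoryFactorsh))

/-- The functor induced by an exact functor on bounded below derived categories is compatible with
the inclusions of the hearts. -/
def exactPlusSingle (Φ : A ⥤ B) [Φ.Additive] [PreservesFiniteLimits Φ]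
    [PreservesFiniteColimits Φ] (n : ℤ) :
    DerivedCategory.Plus.singleFunctor A n ⋙ exactPlus Φ ≅
      Φ ⋙ DerivedCategory.Plus.singleFunctor B n :=
  ((DerivedCategory.TStructure.t.plus.fullyFaithfulι.whiskeringRight _).preimageIso
    (Φ.mapDerivedCategorySingleFunctor n))

/-- The right derived functor of the composition with an exact functor. -/
def rightDerivedCompExact [EnoughInjectives A] (Φ : A ⥤ B) [Φ.Additive] (E : B ⥤ C) [E.Additive]
    [PreservesFiniteLimits E] [PreservesFiniteColimits E] :
    Φ.rightDerivedFunctorPlus ⋙ exactPlus E ≅ (Φ ⋙ E).rightDerivedFunctorPlus := by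
  let α : (Φ ⋙ E).mapHomotopyCategoryPlus ⋙ DerivedCategory.Plus.Qh ⟶
      DerivedCategory.Plus.Qh ⋙ (Φ.rightDerivedFunctorPlus ⋙ exactPlus E) :=
    Functor.whiskerRight (Functor.mapHomotopyCategoryPlusCompIso (Iso.refl (Φ ⋙ E))).inv
      DerivedCategory.Plus.Qh ≫
    Functor.whiskerLeft Φ.mapHomotopyCategoryPlus (exactPlusFactors E).inv ≫
    Functor.whiskerRight Φ.rightDerivedFunctorPlusUnit (exactPlus E)
  -- It suffices to test on complexes of injective objects. There the unit of the derived functor of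
  -- Φ is invertible, and the other factors of α are always invertible.
  have : (Φ.rightDerivedFunctorPlus ⋙ exactPlus E).IsRightDerivedFunctor α
      (HomotopyCategory.Plus.quasiIso A) := by
    refine (HomotopyCategory.Plus.localizerMorphism_derives _).isRightDerivedFunctor_of_isIso α
      fun X => ?_
    have : IsIso (Φ.rightDerivedFunctorPlusUnit.app
      ((HomotopyCategory.Plus.localizerMorphism A).functor.obj X)) :=
      inferInstanceAs (IsIso (Φ.rightDerivedFunctorPlusUnit.app
        ((InjectiveObject.ι A).mapHomotopyCategoryPlus.obj X)))
    dsimp only [α, NatTrans.comp_app, Functor.whiskerRight_app, Functor.whiskerLeft_app]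
    infer_instance
  exact Functor.rightDerivedUnique _ _ α (Φ ⋙ E).rightDerivedFunctorPlusUnit
    (HomotopyCategory.Plus.quasiIso A)

/-- The right derived functor of the composition with an exact functor which preserves injective
objects. -/
def rightDerivedExactComp [EnoughInjectives A] [EnoughInjectives B] (E : A ⥤ B) [E.Additive]
    [PreservesFiniteLimits E] [PreservesFiniteColimits E]
    (hE : ∀ X : A, Injective X → Injective (E.obj X)) (Φ : B ⥤ C) [Φ.Additive] :
    exactPlus E ⋙ Φ.rightDerivedFunctorPlus ≅ (E ⋙ Φ).rightDerivedFunctorPlus := by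
  let α : (E ⋙ Φ).mapHomotopyCategoryPlus ⋙ DerivedCategory.Plus.Qh ⟶
      DerivedCategory.Plus.Qh ⋙ (exactPlus E ⋙ Φ.rightDerivedFunctorPlus) :=
    Functor.whiskerRight (Functor.mapHomotopyCategoryPlusCompIso (Iso.refl (E ⋙ Φ))).inv
      DerivedCategory.Plus.Qh ≫
    Functor.whiskerLeft E.mapHomotopyCategoryPlus Φ.rightDerivedFunctorPlusUnit ≫
    Functor.whiskerRight (exactPlusFactors E).inv Φ.rightDerivedFunctorPlus
  have : (exactPlus E ⋙ Φ.rightDerivedFunctorPlus).IsRightDerivedFunctor α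
      (HomotopyCategory.Plus.quasiIso A) := by
    refine (HomotopyCategory.Plus.localizerMorphism_derives _).isRightDerivedFunctor_of_isIso α
      fun X => ?_
    -- This is where preservation of injectives enters: E of a complex of injectives is again such a
    -- complex, so the unit for Φ is invertible at it.
    have inj (n : ℤ) : Injective ((E.mapHomotopyCategoryPlus.obj
        ((HomotopyCategory.Plus.localizerMorphism A).functor.obj X)).obj.as.X n) :=
      hE _ (inferInstanceAs (Injective
        (((InjectiveObject.ι A).mapHomotopyCategoryPlus.obj X).obj.as.X n)))
    have : IsIso (Φ.rightDerivedFunctorPlusUnit.app (E.mapHomotopyCategoryPlus.obj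
      ((HomotopyCategory.Plus.localizerMorphism A).functor.obj X))) := inferInstance
    dsimp only [α, NatTrans.comp_app, Functor.whiskerRight_app, Functor.whiskerLeft_app]
    infer_instance
  exact Functor.rightDerivedUnique _ _ α (E ⋙ Φ).rightDerivedFunctorPlusUnit
    (HomotopyCategory.Plus.quasiIso A)

/-- The right derived functors of isomorphic functors are isomorphic. -/
def rightDerivedPlusIso [EnoughInjectives A] {Φ Ψ : A ⥤ B} [Φ.Additive] [Ψ.Additive] (e : Φ ≅ Ψ) :
    Φ.rightDerivedFunctorPlus ≅ Ψ.rightDerivedFunctorPlus := by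
  -- The isomorphism on homotopy categories passes through the composite of 𝟭 A and Φ, a
  -- factorization which `e` identifies with Ψ as well as with Φ.
  let τ : Φ.mapHomotopyCategoryPlus ≅ Ψ.mapHomotopyCategoryPlus :=
    (Functor.mapHomotopyCategoryPlusCompIso (F := 𝟭 A) (G := Φ) (Functor.leftUnitor Φ)).symm ≪≫
      Functor.mapHomotopyCategoryPlusCompIso (F := 𝟭 A) (G := Φ) (Functor.leftUnitor Φ ≪≫ e)
  exact Functor.rightDerivedNatIso _ _ Φ.rightDerivedFunctorPlusUnit Ψ.rightDerivedFunctorPlusUnit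
    (HomotopyCategory.Plus.quasiIso A) (Functor.isoWhiskerRight τ DerivedCategory.Plus.Qh)

end DerivedComp

/-! ### The derived duality isomorphism. -/

section DualityIso

universe v₁ v₂ u₁ u₂ w₁ w₂ w₃ w₄

variable {A : Type u₁} [Category.{v₁} A] [Abelian A] [HasDerivedCategory.{w₁} A]
  [HasDerivedCategory.{w₂} Aᵒᵖ]
variable {B : Type u₂} [Category.{v₂} B] [Abelian B] [HasDerivedCategory.{w₃} B]
  [HasDerivedCategory.{w₄} Bᵒᵖ]

/-- If exact dualities exchange the functors `F` and `G`, and projective and injective objects, then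
they exchange the left derived functor of `F` and the right derived functor of `G`. -/
def derivedDuality [EnoughProjectives A] [EnoughInjectives A] (F G : A ⥤ B) [F.Additive]
    [G.Additive] (δ : Aᵒᵖ ⥤ A) [δ.Additive] [PreservesFiniteLimits δ] [PreservesFiniteColimits δ]
    (ε : Bᵒᵖ ⥤ B) [ε.Additive] [PreservesFiniteLimits ε] [PreservesFiniteColimits ε]
    (hδ : ∀ X : Aᵒᵖ, Injective X → Injective (δ.obj X)) (e : F.op ⋙ ε ≅ δ ⋙ G) :
    (leftDerived F).op ⋙ exactContra ε ≅ exactContra δ ⋙ G.rightDerivedFunctorPlus :=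
  -- Since D⁻(A) is the opposite of D⁺ of the opposite category and the left derived functor is
  -- defined accordingly, the claim becomes an isomorphism of right derived functors on that D⁺. The
  -- exact ε is absorbed on one side, and δ, which preserves injectives, on the other.
  Functor.isoWhiskerLeft (unopUnop _)
    (rightDerivedCompExact F.op ε ≪≫ rightDerivedPlusIso e ≪≫ (rightDerivedExactComp δ hδ G).symm)

/-- The functor induced by an exact duality on derived categories is compatible with the inclusions
of the hearts. -/
def singleMinusExactContra (δ : Aᵒᵖ ⥤ B) [δ.Additive] [PreservesFiniteLimits δ]
    [PreservesFiniteColimits δ] :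
    (singleMinus A).op ⋙ exactContra δ ≅ δ ⋙ DerivedCategory.Plus.singleFunctor B 0 :=
  exactPlusSingle δ 0

end DualityIso

end Cherednik

end

theorem mainTheorem10 {V : Type u} [AddCommGroup V] [Module ℂ V] [FiniteDimensional ℂ V]
    (D : Datum V) (J : Datum.HermitianIso D)
    [HasDerivedCategory D.O] [HasDerivedCategory D.Oᵒᵖ]
    [HasDerivedCategory D.Gr] [HasDerivedCategory D.Grᵒᵖ] :
    ∃ (σ : Datum.Bar J)
      (hO : ∀ M : D.O, D.isO ((Datum.dual σ).obj (Opposite.op M.obj)))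
      (_ : EnoughProjectives D.O) (_ : EnoughInjectives D.O)
      (_ : PreservesFiniteLimits (Datum.dualO σ hO))
      (_ : PreservesFiniteColimits (Datum.dualO σ hO)),
      Nonempty
        ((singleMinus D.O).op ⋙ (leftDerived D.F).op ⋙ exactContra D.grDual ≅
          Datum.dualO σ hO ⋙ DerivedCategory.Plus.singleFunctor D.O 0 ⋙
            D.G.rightDerivedFunctorPlus) ∧
      Nonempty
        ((leftDerived D.F).op ⋙ exactContra D.grDual ≅
          exactContra (Datum.dualO σ hO) ⋙ D.G.rightDerivedFunctorPlus) := by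
  obtain ⟨σ⟩ := Datum.exists_bar J
  have hI := Datum.enoughInjectives_of_bar σ
  have e := derivedDuality D.F D.G (Datum.dualO σ (Datum.isO_dual σ)) D.grDual
    (Datum.injective_dualO_of_injective σ) (Datum.coinvDualIso σ)
  exact ⟨σ, Datum.isO_dual σ, inferInstance, hI, inferInstance, inferInstance,
    -- The statement for modules is the derived one restricted to complexes concentrated in degree
    -- 0, where the induced duality is the duality of category O.
    ⟨Functor.isoWhiskerLeft (singleMinus D.O).op e ≪≫
      Functor.isoWhiskerRight (singleMinusExactContra (Datum.dualO σ (Datum.isO_dual σ)))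
        D.G.rightDerivedFunctorPlus⟩, ⟨e⟩⟩
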